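/- **Proposition 4.1.** Let $d\ge 3$. For Lebesgue-almost every $\beta\in[1,2]^d$ the following holds. Write $Q(x)=\sum_{i=1}^d\beta_i x_i^2$ for $x \in \mathbb R^d$. *Setting.* Let $\phi:\mathbb R^d\to[0,\infty)$ be smooth and rapidly decaying (i.e. $|x|^N\phi(x)$ is bounded for every $N\in\mathbb N$). For $L\ge 1$ let $\mathbb Z_L^d=\frac1L\mathbb Z^d$, let $(\vartheta_k)_{k\in\mathbb Z_L^d}$ be independent random variables, uniformly distributed on $[0,2\pi]$, and put $a_k^0=\sqrt{\phi(k)}\,e^{i\vartheta_k}$. For $\lambda>0$ put $\tau=\frac{L^{2d}}{2\lambda^4}$. *Trees.* For $n\ge 0$ let $\boldsymbol\ell=(\ell_1,\dots,\ell_n)$ range over the vectors of integers with $1\le \ell_j\le 2(n-j)+1$, and let $\sigma_{\boldsymbol\ell}=\prod_{j=1}^n(-1)^{\ell_j+1}$. Given $\boldsymbol k=(k_{0,1},\dots,k_{0,2n+1})\in(\mathbb Z_L^d)^{2n+1}$, define $k_{j,m}$ for $1\le j\le n$, $1\le m\le 2(n-j)+1$, by $$k_{j,m}=\begin{cases}k_{j-1,m},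 & m<\ell_j,\\ k_{j-1,\ell_j}-k_{j-1,\ell_j+1}+k_{j-1,\ell_j+2}, & m=\ell_j,\\ k_{j-1,m+2}, & m>\ell_j,\end{cases}$$ and let $$\Omega_j(\boldsymbol k)=(-1)^{\ell_j+1}\big(Q(k_{j,\ell_j})-Q(k_{j-1,\ell_j})+Q(k_{j-1,\ell_j+1})-Q(k_{j-1,\ell_j+2})\big).$$ Let $a^0_{k_{0,m},\sigma_m}$ be $a^0_{k_{0,m}}$ for odd $m$ and $\overline{a^0_{k_{0,m}}}$ for even $m$. For $t>0$ and $k\in\mathbb Z_L^d$ set $$\mathcal J_{n,\boldsymbol\ell}(t,k)=\Big(\frac{i\lambda^2}{L^{2d}}\Big)^n\sigma_{\boldsymbol\ell}\sum_{\substack{\boldsymbol k\in(\mathbb Z_L^d)^{2n+1}\\ k_{n,1}=k}}\ \prod_{m=1}^{2n+1}a^0_{k_{0,m},\sigma_m}\int_{\mathbb R_+^{n+1}}\prod_{m=1}^n e^{-2\pi i\,t_m(\boldsymbol s)\,\Omega_m(\boldsymbol k)}\ \delta\Big(t-\sum_{i=0}^n s_i\Big)\,d\boldsymbol s,$$ where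 $t_m(\boldsymbol s)=s_0+\dots+s_{m-1}$. *Claim.* For every such $\phi$, every $\epsilon_0>0$ and every integer $S\ge1$ there is a constant $C$, depending only on $d,\beta,\phi,\epsilon_0,S$ (not on $L$, $\lambda$, $t$, $k$ or the probability space), such that for all $L\ge1$, $\lambda>0$, $0<t<L^{d-\epsilon_0}$ and $k\in\mathbb Z_L^d$ the series defining the $\mathcal J_{n,\boldsymbol\ell}(t,k)$ converge absolutely, the products $\mathcal J_{n,\boldsymbol\ell}(t,k)\overline{\mathcal J_{n',\boldsymbol\ell'}(t,k)}$ are integrable, and $$\left|\sum_{n+n'=S}\ \sum_{\boldsymbol\ell,\boldsymbol\ell'}\mathbb E\Big(\mathcal J_{n,\boldsymbol\ell}(t,k)\,\overline{\mathcal J_{n',\boldsymbol\ell'}(t,k)}\Big)\right|\ \le\ C\,\big(\log(2+t)\big)^2\Big(\frac{t}{\sqrt\tau}\Big)^S\,\frac1t .$$ -/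

import Mathlib

open MeasureTheory ProbabilityTheory
open scoped BigOperators ComplexConjugate ContDiff

noncomputable section

namespace FeynmanTree

/-- Labels of wave numbers: `m : ℤ^d` stands for `k = m / L ∈ ℤ_L^d = L⁻¹ ℤ^d`. -/
abbrev Label (d : ℕ) := Fin d → ℤ

/-- The point `m / L` of `ℝ^d` with label `m`. -/
def wave {d : ℕ} (L : ℝ) (m : Label d) : EuclideanSpace ℝ (Fin d) :=
  WithLp.toLp 2 fun i => (m i : ℝ) / L

/-- The quadratic form `Q(x) = ∑ β_i x_i²`. -/
def Q {d : ℕ} (β : Fin d → ℝ) (x : EuclideanSpace ℝ (Fin d)) : ℝ := ∑ i, β i * x i ^ 2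

/-- The initial amplitude `a⁰_k = √φ(k) e^{i θ_k}` for given phases `θ`. -/
def amp {d : ℕ} (φ : EuclideanSpace ℝ (Fin d) → ℝ) (L : ℝ) (θ : Label d → ℝ) (m : Label d) : ℂ :=
  (Real.sqrt (φ (wave L m)) : ℂ) * Complex.exp (Complex.I * (θ m : ℂ))

/-- `a_{k,σ}`: positions are counted from `0`, so an even position has parity `+1` (the amplitude
itself) and an odd position has parity `-1` (its complex conjugate). -/
def signedAmp {d : ℕ} (φ : EuclideanSpace ℝ (Fin d) → ℝ) (L : ℝ) (θ : Label d → ℝ)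
    (pos : ℕ) (m : Label d) : ℂ :=
  if Even pos then amp φ L θ m else conj (amp φ L θ m)

/-- Interaction histories `(ℓ_1, …, ℓ_n)`, `ℓ_{j+1} ∈ {1, …, 2 (n - (j + 1)) + 1}`.  Everything is
shifted to start from `0`: `h j` is `ℓ_{j+1} - 1`, the position on level `j + 1` of the wave
number which has three branches on level `j`. -/
abbrev History (n : ℕ) := ∀ j : Fin n, Fin (2 * (n - ((j : ℕ) + 1)) + 1)

/-- The history as a function on `ℕ` (with a default value for `j ≥ n`, which is never used). -/
def History.idx {n : ℕ} (h : History n) (j : ℕ) : ℕ :=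
  if hj : j < n then (h ⟨j, hj⟩ : ℕ) else 0

/-- The signature `∏_j (-1)^{ℓ_j + 1}` of the tree. -/
def History.sign {n : ℕ} (h : History n) : ℂ := ∏ j : Fin n, (-1 : ℂ) ^ (h j : ℕ)

/-- Transition rule from the wave numbers `k` on one level to those on the next higher level: the
three entries at the positions `l`, `l + 1`, `l + 2` are merged into
`k_l - k_{l+1} + k_{l+2}` at position `l`. -/
def merge {d : ℕ} (l : ℕ) (k : ℕ → Label d) : ℕ → Label d := fun m =>
  if m < l then k m else if m = l then k l - k (l + 1) + k (l + 2) else k (m + 2)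

/-- The wave numbers on level `j` of the tree with history `h` and the wave numbers `k` on
level `0`. Level `j` consists of the positions `0, …, 2 (n - j)`; later entries are not used. -/
def level {d n : ℕ} (h : History n) (k : Fin (2 * n + 1) → Label d) : ℕ → ℕ → Label d
  | 0 => fun m => if hm : m < 2 * n + 1 then k ⟨m, hm⟩ else 0
  | j + 1 => merge (h.idx j) (level h k j)

/-- The frequency `Ω_{j+1}` which the transition between the levels `j + 1` and `j` generates. -/
def freq {d n : ℕ} (β : Fin d → ℝ) (L : ℝ) (h : History n) (k : Fin (2 * n + 1) → Label d)
    (j : ℕ) : ℝ :=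
  (-1 : ℝ) ^ h.idx j *
    (Q β (wave L (level h k (j + 1) (h.idx j)))
      - Q β (wave L (level h k j (h.idx j)))
      + Q β (wave L (level h k j (h.idx j + 1)))
      - Q β (wave L (level h k j (h.idx j + 2))))

/-- The integral of `∏_{m=1}^n e^{-2πi t_m(s) Ω_m} δ(t - s_0 - ⋯ - s_n)` over `s ∈ ℝ_+^{n+1}`, where
`t_m(s) = s_0 + ⋯ + s_{m-1}`. The Dirac delta fixes `s_n = t - (s_0 + ⋯ + s_{n-1})`, which has to
be nonnegative; the integrand does not depend on `s_n`. Here `Ω j` is `Ω_{j+1}`. -/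
def timeIntegral (n : ℕ) (t : ℝ) (Ω : ℕ → ℝ) : ℂ :=
  ∫ s in {s : Fin n → ℝ | (∀ i, 0 ≤ s i) ∧ ∑ i, s i ≤ t},
    ∏ j : Fin n,
      Complex.exp (-(2 * Real.pi * (∑ i ∈ Finset.univ.filter (fun i => i ≤ j), s i) * Ω j : ℝ)
        * Complex.I)

open Classical in
/-- The summand of `𝒥_{n,ℓ}(t,k)` (without the prefactor) which belongs to the wave numbers `k` on
level `0`; `k₀` is the root, and only those `k` contribute whose top level is `k₀`. -/
def summand {d n : ℕ} (β : Fin d → ℝ) (φ : EuclideanSpace ℝ (Fin d) → ℝ) (L t : ℝ)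
    (θ : Label d → ℝ) (h : History n) (k₀ : Label d) (k : Fin (2 * n + 1) → Label d) : ℂ :=
  if level h k n 0 = k₀ then
    (∏ j : Fin (2 * n + 1), signedAmp φ L θ j (k j)) * timeIntegral n t (freq β L h k)
  else 0

/-- The Feynman tree term `𝒥_{n,ℓ}(t,k)`. -/
def J {d n : ℕ} (β : Fin d → ℝ) (φ : EuclideanSpace ℝ (Fin d) → ℝ) (L lam t : ℝ)
    (θ : Label d → ℝ) (h : History n) (k₀ : Label d) : ℂ :=
  (Complex.I * ((lam ^ 2 / L ^ (2 * d) : ℝ) : ℂ)) ^ n * h.sign *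
    ∑' k : Fin (2 * n + 1) → Label d, summand β φ L t θ h k₀ k

/-- The kinetic time scale `τ = L^{2d} / (2 λ⁴)`. -/
def kineticTime (d : ℕ) (L lam : ℝ) : ℝ := L ^ (2 * d) / (2 * lam ^ 4)

end FeynmanTree

end

/-! The gain of `1/t` over the trivial bound `t^S` for the time integrals comes from oscillation in
the latest interaction. Individual pairs of trees may contain degenerate interactions, whose
frequency vanishes identically; these contributions cancel only in the sum over all pairs of trees
of total size `S`.

Ordering the interactions of both trees in time turns the sum over `n + n' = S` into a sum over
forests with two roots, both equal to `k₀` (`sum_forestSum_mul_forestSum`). After averaging over the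
phases, only those assignments of the `2S + 2` leaves survive in which every value occurs at an even
position (`integral_ampProd_eq_zero`), so that there are at most `S + 1` different values. The
averaged weight is also invariant under rotations of the leaves by an even number of places.

The latest interaction sits at position 0 or 1, with opposite signs, and has frequency `± 2 form(U,
V) / L²`, where `U` and `V` are differences of neighbouring wave numbers (`cubicFreq_eq`). If `U =
0` or `V = 0`, part of the contributions of the two positions cancels pointwise (`degenerate_sub`).
The rest is a difference of two terms, each of which factorises into two forests, one with equal
roots and one with both roots `k₀`, in the two possible orders. An even rotation of the leaves
exchanges these orders, so the averages cancel (`tsum_degenerate_eq_zero`).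

If `U` and `V` are nonzero, one integration by parts replaces a factor `t` by the resolvent `(t⁻¹ +
|Ω|)⁻¹` (`norm_iterInt_succ_le`). It remains to sum this resolvent over at most `S + 1` lattice
vectors with one of the roots prescribed (`pairing_sum_le`). If `U` and `V` are independent linear
forms, they serve as summation variables, and the bound reduces to `∑_{U,V} (t⁻¹ + |form(U,V)|/L²)⁻¹
≲ L^{2d} log²(2 + t)`, which is the property `Generic`. If they are proportional, the resolvent is
at most of order `L² / ‖U‖²`, which is summable to the right order because `d ≥ 3`.

Almost every `β` is generic (`ae_generic`). In a box of side `R`, times `t ≤ R` are handled by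
counting lattice points in slabs, for every `β`. For `R < t ≤ R^d` the sum is averaged over `β`: a
first moment suffices for vectors `U` with a vanishing coordinate (`lintegral_thinSum_le`), and a
second moment is used for the others (`lintegral_fullSum_sq_le`). The second moment yields summable
exceptional probabilities over dyadic `R = 2^m` with a loss of only `m²`. -/

namespace FeynmanTree

/-! ### Sums over boxes of lattice points -/

/-- The lattice points in the cube of half side `R`. -/
noncomputable def box (d R : ℕ) : Finset (Label d) := Fintype.piFinset fun _ => Finset.Icc (-(R : ℤ)) R

/-- `max 1 |n|` as a real number. -/
noncomputable def absOne (n : ℤ) : ℝ := max 1 |(n : ℝ)|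

lemma one_le_absOne (n : ℤ) : 1 ≤ absOne n := le_max_left _ _

lemma absOne_pos (n : ℤ) : 0 < absOne n := zero_lt_one.trans_le (one_le_absOne n)

lemma abs_le_absOne (n : ℤ) : |(n : ℝ)| ≤ absOne n := le_max_right _ _

lemma absOne_of_ne_zero {n : ℤ} (h : n ≠ 0) : absOne n = |(n : ℝ)| := by
  rw [absOne, max_eq_right]
  exact_mod_cast Int.one_le_abs h

lemma mem_box {d R : ℕ} {x : Label d} : x ∈ box d R ↔ ∀ i, |x i| ≤ R := by
  simp [box, abs_le]

lemma mem_box_iff_norm {d R : ℕ} {x : Label d} : x ∈ box d R ↔ ‖x‖ ≤ R := by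
  rw [mem_box, pi_norm_le_iff_of_nonneg (Nat.cast_nonneg R)]
  simp only [Int.norm_eq_abs]
  exact forall_congr' fun i => by exact_mod_cast Iff.rfl

lemma sum_Icc_natAbs (f : ℕ → ℝ) (R : ℕ) :
    ∑ n ∈ Finset.Icc (-(R : ℤ)) R, f n.natAbs = f 0 + 2 * ∑ k ∈ Finset.range R, f (k + 1) := by
  induction R with
  | zero => simp
  | succ R ih =>
    have : Finset.Icc (-((R + 1 : ℕ) : ℤ)) ((R + 1 : ℕ) : ℤ) =
        insert (-((R + 1 : ℕ) : ℤ)) (insert ((R + 1 : ℕ) : ℤ) (Finset.Icc (-(R : ℤ)) R)) := by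
      ext x; simp only [Finset.mem_insert, Finset.mem_Icc]; push_cast; omega
    rw [this, Finset.sum_insert, Finset.sum_insert, ih, Finset.sum_range_succ]
    · have h1 : (-((R + 1 : ℕ) : ℤ)).natAbs = R + 1 := by omega
      have h2 : (((R + 1 : ℕ) : ℤ)).natAbs = R + 1 := by omega
      rw [h1, h2]; ring
    · simp only [Finset.mem_Icc]; push_cast; omega
    · simp only [Finset.mem_insert, Finset.mem_Icc]; push_cast; omega

lemma sum_range_rpow_neg_le {α : ℝ} (h0 : 0 ≤ α) (h1 : α < 1) (R : ℕ) :
    ∑ k ∈ Finset.range R, ((k : ℝ) + 1) ^ (-α) ≤ (1 - α)⁻¹ * (R : ℝ) ^ (1 - α) := by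
  have hα : 0 < 1 - α := by linarith
  induction R with
  | zero => simp [Real.zero_rpow hα.ne']
  | succ R ih =>
    rw [Finset.sum_range_succ]
    have hR : (0 : ℝ) < (R : ℝ) + 1 := by positivity
    -- Bernoulli's inequality for the exponent `1 - α ≤ 1`: the increment of `x^(1-α)/(1-α)` from
    -- `R` to `R + 1` dominates the new term `(R+1)^(-α)`.
    have key : (R : ℝ) ^ (1 - α) ≤ ((R : ℝ) + 1) ^ (1 - α) - (1 - α) * ((R : ℝ) + 1) ^ (-α) := by
      have hb := rpow_one_add_le_one_add_mul_self (s := -(1 / ((R : ℝ) + 1)))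
        (by rw [neg_le_neg_iff, div_le_one hR]; linarith [(Nat.cast_nonneg R : (0 : ℝ) ≤ R)])
        hα.le (by linarith)
      have e1 : 1 + -(1 / ((R : ℝ) + 1)) = R / ((R : ℝ) + 1) := by field_simp; ring
      rw [e1, Real.div_rpow (Nat.cast_nonneg R) hR.le, div_le_iff₀ (by positivity)] at hb
      refine hb.trans (le_of_eq ?_)
      have : ((R : ℝ) + 1) ^ (1 - α) = ((R : ℝ) + 1) * ((R : ℝ) + 1) ^ (-α) := by
        rw [sub_eq_add_neg, Real.rpow_add hR, Real.rpow_one]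
      rw [this]; field_simp; ring
    push_cast
    have : ((R : ℝ) + 1) ^ (-α) ≤
        (1 - α)⁻¹ * (((R : ℝ) + 1) ^ (1 - α) - (R : ℝ) ^ (1 - α)) := by
      rw [inv_mul_eq_div, le_div_iff₀ hα]; linarith
    linarith

lemma sum_Icc_absOne_rpow_le {α : ℝ} (h0 : 0 ≤ α) (h1 : α < 1) {R : ℕ} (hR : 1 ≤ R) :
    ∑ n ∈ Finset.Icc (-(R : ℤ)) R, absOne n ^ (-α) ≤ (1 + 2 * (1 - α)⁻¹) * (R : ℝ) ^ (1 - α) := by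
  have := sum_Icc_natAbs (fun k => (max 1 (k : ℝ)) ^ (-α)) R
  have e : ∀ n : ℤ, absOne n = max 1 ((n.natAbs : ℕ) : ℝ) := fun n => by
    rw [absOne, Nat.cast_natAbs, Int.cast_abs]
  simp only [e, this]
  have h2 : ∀ k ∈ Finset.range R, max 1 (((k + 1 : ℕ)) : ℝ) ^ (-α) = ((k : ℝ) + 1) ^ (-α) := by
    intro k _
    rw [max_eq_right]
    · push_cast; rfl
    · push_cast; linarith [(Nat.cast_nonneg k : (0 : ℝ) ≤ k)]
  rw [Finset.sum_congr rfl h2]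
  have h3 := sum_range_rpow_neg_le h0 h1 R
  have h4 : (1 : ℝ) ≤ (R : ℝ) ^ (1 - α) :=
    Real.one_le_rpow (by exact_mod_cast hR) (by linarith)
  simp only [Nat.cast_zero, zero_le_one, sup_of_le_left, Real.one_rpow]
  linarith

lemma sum_Icc_inv_absOne_le {R : ℕ} :
    ∑ n ∈ Finset.Icc (-(R : ℤ)) R, (absOne n)⁻¹ ≤ 3 + 2 * Real.log R := by
  have := sum_Icc_natAbs (fun k => (max 1 (k : ℝ))⁻¹) R
  have e : ∀ n : ℤ, absOne n = max 1 ((n.natAbs : ℕ) : ℝ) := fun n => by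
    rw [absOne, Nat.cast_natAbs, Int.cast_abs]
  simp only [e, this]
  have h2 : ∀ k ∈ Finset.range R, (max 1 (((k + 1 : ℕ)) : ℝ))⁻¹ = ((k : ℝ) + 1)⁻¹ := by
    intro k _
    rw [max_eq_right]
    · push_cast; rfl
    · push_cast; linarith [(Nat.cast_nonneg k : (0 : ℝ) ≤ k)]
  rw [Finset.sum_congr rfl h2]
  have h3 := harmonic_le_one_add_log R
  rw [harmonic] at h3
  push_cast at h3
  simp only [Nat.cast_zero, zero_le_one, sup_of_le_left, inv_one]
  linarith

lemma sum_box_prod {d R : ℕ} (f : Fin d → ℤ → ℝ) :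
    ∑ U ∈ box d R, ∏ i, f i (U i) = ∏ i, ∑ n ∈ Finset.Icc (-(R : ℤ)) R, f i n := by
  rw [box, Finset.prod_univ_sum]

lemma card_box (d R : ℕ) : (box d R).card = (2 * R + 1) ^ d := by
  have : ((R : ℤ) + 1 + R).toNat = 2 * R + 1 := by omega
  simp [box, this]

lemma card_box_le (d : ℕ) {R : ℕ} (hR : 1 ≤ R) : ((box d R).card : ℝ) ≤ 3 ^ d * (R : ℝ) ^ d := by
  rw [card_box, ← mul_pow]
  push_cast
  have : (1 : ℝ) ≤ R := by exact_mod_cast hR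
  gcongr
  linarith

lemma sum_box_prod_absOne_rpow_le {d : ℕ} (α : Fin d → ℝ) (h0 : ∀ i, 0 ≤ α i)
    (h1 : ∀ i, α i < 1) : ∃ C : ℝ, 0 < C ∧ ∀ R : ℕ, 1 ≤ R →
      ∑ U ∈ box d R, ∏ i, absOne (U i) ^ (-α i) ≤ C * (R : ℝ) ^ ((d : ℝ) - ∑ i, α i) := by
  refine ⟨∏ i, (1 + 2 * (1 - α i)⁻¹), Finset.prod_pos fun i _ => ?_, fun R hR => ?_⟩
  · have : 0 < 1 - α i := by linarith [h1 i]
    positivity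
  rw [sum_box_prod fun i n => absOne n ^ (-α i)]
  have hR' : (0 : ℝ) < R := by exact_mod_cast hR
  have : (R : ℝ) ^ ((d : ℝ) - ∑ i, α i) = ∏ i, (R : ℝ) ^ (1 - α i) := by
    rw [← Real.rpow_sum_of_pos hR']
    simp
  rw [this, ← Finset.prod_mul_distrib]
  refine Finset.prod_le_prod (fun i _ => Finset.sum_nonneg fun n _ => ?_) fun i _ =>
    sum_Icc_absOne_rpow_le (h0 i) (h1 i) hR
  exact Real.rpow_nonneg (absOne_pos n).le _

lemma absOne_le_norm {d : ℕ} {W : Label d} (hW : W ≠ 0) (i : Fin d) : absOne (W i) ≤ ‖W‖ := by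
  have h : ∀ j, |(W j : ℝ)| ≤ ‖W‖ := fun j => by
    rw [← Int.norm_eq_abs]; exact norm_le_pi_norm W j
  refine max_le ?_ (h i)
  obtain ⟨j, hj⟩ := Function.ne_iff.mp hW
  refine le_trans ?_ (h j)
  exact_mod_cast Int.one_le_abs hj

lemma one_le_norm {d : ℕ} {W : Label d} (hW : W ≠ 0) : 1 ≤ ‖W‖ := by
  obtain ⟨j, _⟩ := Function.ne_iff.mp hW
  exact (one_le_absOne _).trans (absOne_le_norm hW j)

/-- Every coordinate is at most the norm, so `‖W‖^(-s)` can be shared out evenly as `d`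
one-dimensional factors of exponent `s/d < 1`, whose sums factorise. -/
lemma sum_box_norm_rpow_le {d : ℕ} {s : ℝ} (h0 : 0 ≤ s) (h1 : s < d) :
    ∃ C : ℝ, 0 < C ∧ ∀ R : ℕ, 1 ≤ R →
      ∑ W ∈ (box d R).filter (· ≠ 0), ‖W‖ ^ (-s) ≤ C * (R : ℝ) ^ ((d : ℝ) - s) := by
  have hd : (0 : ℝ) < d := h0.trans_lt h1
  obtain ⟨C, hC, h⟩ := sum_box_prod_absOne_rpow_le (d := d) (fun _ => s / d)
    (fun _ => by positivity) (fun _ => by rwa [div_lt_one hd])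
  refine ⟨C, hC, fun R hR => ?_⟩
  have e : ∑ _i : Fin d, s / d = s := by simp; field_simp
  have := h R hR
  rw [e] at this
  refine le_trans ?_ this
  refine (Finset.sum_le_sum fun W hW => ?_).trans
    (Finset.sum_le_sum_of_subset_of_nonneg (Finset.filter_subset _ _) fun W _ _ =>
      Finset.prod_nonneg fun i _ => Real.rpow_nonneg (absOne_pos _).le _)
  have hW0 := (Finset.mem_filter.mp hW).2
  have hpos : 0 < ‖W‖ := zero_lt_one.trans_le (one_le_norm hW0)
  have e2 : ‖W‖ ^ (-s) = ∏ _i : Fin d, ‖W‖ ^ (-(s / d)) := by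
    rw [Finset.prod_const, Finset.card_univ, Fintype.card_fin, ← Real.rpow_natCast,
      ← Real.rpow_mul hpos.le]
    congr 1
    field_simp
  rw [e2]
  refine Finset.prod_le_prod (fun i _ => by positivity) fun i _ => ?_
  exact Real.rpow_le_rpow_of_nonpos (absOne_pos _) (absOne_le_norm hW0 i)
    (by have : 0 ≤ s / d := by positivity
        linarith)

/-- Sums of `|M n - c| ^ (-α)` along an arithmetic progression. -/
lemma sum_Icc_absOne_progression_le {α : ℝ} (h0 : 0 < α) (h1 : α ≤ 1 / 2) {R : ℕ} {M c : ℤ}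
    (hM : 1 ≤ M) (hMR : M ≤ R) (hc : |c| ≤ M * R) :
    ∑ n ∈ Finset.Icc (-(R : ℤ)) R, absOne (M * n - c) ^ (-α) ≤
      31 * (R : ℝ) ^ (1 - α) * (M : ℝ) ^ (-α) := by
  have hMpos : (0 : ℝ) < M := by exact_mod_cast hM
  have hR1 : 1 ≤ R := by omega
  have hRpos : (0 : ℝ) < R := by exact_mod_cast hR1
  set n₀ : ℤ := c / M with hn₀
  have hc1 : M * n₀ ≤ c := Int.mul_ediv_self_le (by omega)
  have hc2 : c < M * n₀ + M := by
    have := Int.lt_ediv_add_one_mul_self c (show 0 < M by omega)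
    rw [← hn₀] at this
    linarith
  have hn₀R : |n₀| ≤ R := by
    rw [abs_le] at hc ⊢
    constructor
    · rw [hn₀]; exact (Int.le_ediv_iff_mul_le (by omega)).mpr (by linarith [hc.1])
    · rw [hn₀]; exact Int.ediv_le_of_le_mul (by omega) (by linarith [hc.2])
  have hterm : ∀ n : ℤ, absOne (M * n - c) ^ (-α) ≤
      (if n = n₀ ∨ n = n₀ + 1 then 1 else 0) + 2 * ((M : ℝ) ^ (-α) * absOne (n - n₀) ^ (-α)) := by
    intro n
    have hnn : 0 ≤ (M : ℝ) ^ (-α) * absOne (n - n₀) ^ (-α) := by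
      have := absOne_pos (n - n₀)
      positivity
    have hle1 : absOne (M * n - c) ^ (-α) ≤ 1 :=
      Real.rpow_le_one_of_one_le_of_nonpos (one_le_absOne _) (by linarith)
    by_cases hn : n = n₀ ∨ n = n₀ + 1
    · rw [if_pos hn]; linarith
    rw [if_neg hn, zero_add]
    push Not at hn
    -- Apart from the two integers around `c / M`, the distance of `M n` to `c` is at least half of
    -- `M |n - n₀|`, which reduces the progression to the standard sum.
    have hlow : (M : ℝ) * (absOne (n - n₀) / 2) ≤ absOne (M * n - c) := by
      refine le_trans ?_ (abs_le_absOne _)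
      rw [absOne_of_ne_zero (sub_ne_zero.mpr hn.1)]
      have hc1' : (M : ℝ) * n₀ ≤ c := by exact_mod_cast hc1
      have hc2' : (c : ℝ) ≤ M * n₀ + M := by exact_mod_cast hc2.le
      push_cast
      rcases lt_or_gt_of_ne hn.1 with h | h
      · have h' : (n : ℝ) - n₀ ≤ -1 := by
          have : n - n₀ ≤ -1 := by omega
          exact_mod_cast this
        rw [abs_of_nonpos (by linarith)]
        refine le_trans ?_ (neg_le_abs _)
        nlinarith
      · have h' : (2 : ℝ) ≤ (n : ℝ) - n₀ := by
          have : 2 ≤ n - n₀ := by omega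
          exact_mod_cast this
        rw [abs_of_nonneg (by linarith)]
        refine le_trans ?_ (le_abs_self _)
        nlinarith
    have hpos := absOne_pos (n - n₀)
    have := Real.rpow_le_rpow_of_nonpos (by positivity) hlow (by linarith : -α ≤ 0)
    refine this.trans ?_
    rw [Real.mul_rpow hMpos.le (by positivity), Real.div_rpow hpos.le (by norm_num),
      Real.rpow_neg (by norm_num : (0 : ℝ) ≤ 2), div_inv_eq_mul]
    have h2 : (2 : ℝ) ^ α ≤ 2 := by
      calc (2 : ℝ) ^ α ≤ 2 ^ (1 : ℝ) := Real.rpow_le_rpow_of_exponent_le (by norm_num) (by linarith)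
        _ = 2 := by simp
    nlinarith
  have hsub : ∑ n ∈ Finset.Icc (-(R : ℤ)) R, absOne (n - n₀) ^ (-α) ≤
      ∑ n ∈ Finset.Icc (-((2 * R : ℕ) : ℤ)) ((2 * R : ℕ) : ℤ), absOne n ^ (-α) := by
    rw [← Finset.sum_image (f := fun n => absOne n ^ (-α)) (g := fun n => n - n₀)
      (by intro a _ b _ h; simpa using h)]
    refine Finset.sum_le_sum_of_subset_of_nonneg ?_ fun n _ _ =>
      Real.rpow_nonneg (absOne_pos n).le _
    intro x hx
    simp only [Finset.mem_image, Finset.mem_Icc] at hx ⊢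
    rw [abs_le] at hn₀R
    push_cast
    omega
  have hS := hsub.trans (sum_Icc_absOne_rpow_le h0.le (by linarith) (R := 2 * R) (by omega))
  have hcoef : (1 + 2 * (1 - α)⁻¹) ≤ 5 := by
    have : (1 - α)⁻¹ ≤ 2 := by
      rw [inv_le_comm₀ (by linarith) (by norm_num)]; linarith
    linarith
  have h2R : ((2 * R : ℕ) : ℝ) ^ (1 - α) ≤ 2 * (R : ℝ) ^ (1 - α) := by
    push_cast
    rw [Real.mul_rpow (by norm_num) hRpos.le]
    gcongr
    calc (2 : ℝ) ^ (1 - α) ≤ 2 ^ (1 : ℝ) :=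
          Real.rpow_le_rpow_of_exponent_le (by norm_num) (by linarith)
      _ = 2 := by simp
  -- This is where `α ≤ 1/2` enters: the two exceptional terms, each at most 1, are absorbed because
  -- `R^(1-2α) ≥ 1` and `M ≤ R`.
  have hone : 1 ≤ (R : ℝ) ^ (1 - α) * (M : ℝ) ^ (-α) := by
    have hM' : (M : ℝ) ≤ R := by exact_mod_cast hMR
    calc (1 : ℝ) ≤ (R : ℝ) ^ (1 - 2 * α) :=
          Real.one_le_rpow (by exact_mod_cast hR1) (by linarith)
      _ = (R : ℝ) ^ (1 - α) * (R : ℝ) ^ (-α) := by rw [← Real.rpow_add hRpos]; congr 1; ring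
      _ ≤ _ := by
          gcongr ?_ * ?_
          exact Real.rpow_le_rpow_of_nonpos hMpos hM' (by linarith)
  have hind : ∑ n ∈ Finset.Icc (-(R : ℤ)) R, (if n = n₀ ∨ n = n₀ + 1 then (1 : ℝ) else 0) ≤ 2 := by
    rw [← Finset.sum_filter, Finset.sum_const, nsmul_eq_mul, mul_one]
    have : (Finset.Icc (-(R : ℤ)) R).filter (fun n => n = n₀ ∨ n = n₀ + 1) ⊆ {n₀, n₀ + 1} := by
      intro x hx; simpa using (Finset.mem_filter.mp hx).2
    exact_mod_cast (Finset.card_le_card this).trans Finset.card_le_two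
  calc _ ≤ ∑ n ∈ Finset.Icc (-(R : ℤ)) R, ((if n = n₀ ∨ n = n₀ + 1 then (1 : ℝ) else 0) +
          2 * ((M : ℝ) ^ (-α) * absOne (n - n₀) ^ (-α))) := Finset.sum_le_sum fun n _ => hterm n
    _ = (∑ n ∈ Finset.Icc (-(R : ℤ)) R, (if n = n₀ ∨ n = n₀ + 1 then (1 : ℝ) else 0)) +
          2 * ((M : ℝ) ^ (-α) * ∑ n ∈ Finset.Icc (-(R : ℤ)) R, absOne (n - n₀) ^ (-α)) := by
        rw [Finset.sum_add_distrib, ← Finset.mul_sum, ← Finset.mul_sum]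
    _ ≤ 2 + 2 * ((M : ℝ) ^ (-α) * (5 * (2 * (R : ℝ) ^ (1 - α)))) := by
        gcongr
        exact hS.trans (mul_le_mul hcoef h2R (by positivity) (by norm_num))
    _ ≤ _ := by nlinarith

/-! ### Weighted sums -/

open scoped ENNReal

lemma tsum_pi_prod_le {ι κ : Type*} [Fintype ι] (f : ι → κ → ℝ≥0∞) :
    ∑' x : ι → κ, ∏ i, f i (x i) ≤ ∏ i, ∑' y, f i y := by
  classical
  rw [ENNReal.tsum_eq_iSup_sum]
  refine iSup_le fun s => ?_
  calc ∑ x ∈ s, ∏ i, f i (x i) ≤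
        ∑ x ∈ Fintype.piFinset fun i => s.image fun x => x i, ∏ i, f i (x i) :=
        Finset.sum_le_sum_of_subset fun x hx => by
          simp only [Fintype.mem_piFinset, Finset.mem_image]
          exact fun i => ⟨x, hx, rfl⟩
    _ = ∏ i, ∑ y ∈ s.image fun x => x i, f i y := (Finset.prod_univ_sum _ _).symm
    _ ≤ _ := Finset.prod_le_prod' fun i _ => ENNReal.sum_le_tsum _

/-- Bounds on dyadic boxes give bounds on sums with a decaying weight. -/
lemma tsum_mul_decay_le {ι : Type*} (F : ι → ℝ≥0∞) (ν : ι → ℝ) (hν : ∀ z, 0 ≤ ν z) {D N : ℕ}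
    (hN : D + 1 ≤ N) {L : ℝ} (hL : 1 ≤ L) (A : ℝ≥0∞)
    (h : ∀ m : ℕ, 1 ≤ m → L ≤ 2 ^ m →
      ∑' z, (if ν z ≤ 2 ^ m then F z else 0) ≤ A * 2 ^ (m * D)) :
    ∑' z, F z * ENNReal.ofReal (((1 + ν z / L) ^ N)⁻¹) ≤
      2 ^ (N + 1 + 2 * D) * A * ENNReal.ofReal (L ^ D) := by
  have hL0 : 0 < L := by linarith
  obtain ⟨m₀, hm₀, hm1, hm2⟩ : ∃ m : ℕ, 1 ≤ m ∧ L ≤ 2 ^ m ∧ (2 : ℝ) ^ m ≤ 4 * L := by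
    obtain ⟨n, hn, hn'⟩ := exists_nat_pow_near hL (one_lt_two : (1 : ℝ) < 2)
    exact ⟨n + 1, by omega, hn'.le, by rw [pow_succ]; linarith⟩
  have hpt : ∀ z, F z * ENNReal.ofReal (((1 + ν z / L) ^ N)⁻¹) ≤
      ∑' a : ℕ, (if ν z ≤ 2 ^ (m₀ + a) then F z else 0) * (2 ^ N * ((2 : ℝ≥0∞)⁻¹) ^ (a * N)) := by
    intro z
    have hex : ∃ a : ℕ, ν z ≤ 2 ^ (m₀ + a) := by
      obtain ⟨n, hn⟩ := pow_unbounded_of_one_lt (ν z) (one_lt_two : (1 : ℝ) < 2)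
      exact ⟨n, hn.le.trans (pow_le_pow_right₀ (by norm_num) (by omega))⟩
    classical
    -- The first dyadic ball around the origin that contains `z`; by minimality the weight at `z` is
    -- at most `2^N 2^(-aN)`.
    set a := Nat.find hex with ha
    have hza : ν z ≤ 2 ^ (m₀ + a) := Nat.find_spec hex
    refine le_trans ?_ (ENNReal.le_tsum a)
    rw [if_pos hza]
    gcongr
    have h2 : ((1 + ν z / L) ^ N)⁻¹ ≤ 2 ^ N * ((2 : ℝ)⁻¹) ^ (a * N) := by
      have hq : 0 ≤ ν z / L := div_nonneg (hν z) hL0.le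
      rw [pow_mul, ← mul_pow, ← inv_pow]
      refine pow_le_pow_left₀ (by positivity) ?_ N
      rcases Nat.eq_zero_or_pos a with h0 | h0
      · rw [h0, pow_zero, mul_one]
        have : (1 + ν z / L)⁻¹ ≤ 1 := inv_le_one_of_one_le₀ (by linarith)
        linarith
      · have hlt : ¬ ν z ≤ 2 ^ (m₀ + (a - 1)) := Nat.find_min hex (by omega)
        push Not at hlt
        have hstep : (2 : ℝ) ^ (a - 1) ≤ 1 + ν z / L := by
          have : (2 : ℝ) ^ (a - 1) ≤ ν z / L := by
            rw [le_div_iff₀ hL0]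
            calc (2 : ℝ) ^ (a - 1) * L ≤ 2 ^ (a - 1) * 2 ^ m₀ := by gcongr
              _ = 2 ^ (m₀ + (a - 1)) := by rw [← pow_add]; congr 1; omega
              _ ≤ _ := hlt.le
          linarith
        calc (1 + ν z / L)⁻¹ ≤ ((2 : ℝ) ^ (a - 1))⁻¹ := by gcongr
          _ = 2 * (2 : ℝ)⁻¹ ^ a := by
            obtain ⟨b, hb⟩ : ∃ b, a = b + 1 := ⟨a - 1, by omega⟩
            rw [hb, Nat.add_sub_cancel, pow_succ, inv_pow]; field_simp
    calc ENNReal.ofReal (((1 + ν z / L) ^ N)⁻¹) ≤ ENNReal.ofReal (2 ^ N * ((2 : ℝ)⁻¹) ^ (a * N)) :=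
          ENNReal.ofReal_le_ofReal h2
      _ = _ := by
          rw [ENNReal.ofReal_mul (by positivity), ENNReal.ofReal_pow (by norm_num),
            ENNReal.ofReal_pow (by norm_num), ENNReal.ofReal_inv_of_pos (by norm_num)]
          simp
  calc _ ≤ ∑' z, ∑' a : ℕ, (if ν z ≤ 2 ^ (m₀ + a) then F z else 0) *
          (2 ^ N * ((2 : ℝ≥0∞)⁻¹) ^ (a * N)) := ENNReal.tsum_le_tsum hpt
    _ = ∑' a : ℕ, (∑' z, (if ν z ≤ 2 ^ (m₀ + a) then F z else 0)) *
          (2 ^ N * ((2 : ℝ≥0∞)⁻¹) ^ (a * N)) := by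
        rw [ENNReal.tsum_comm]; simp_rw [ENNReal.tsum_mul_right]
    _ ≤ ∑' a : ℕ, (2 ^ (N + 2 * D) * A * ENNReal.ofReal (L ^ D)) * (2 : ℝ≥0∞)⁻¹ ^ a := by
        refine ENNReal.tsum_le_tsum fun a => ?_
        refine (mul_le_mul_left (h (m₀ + a) (by omega)
          (hm1.trans (pow_le_pow_right₀ (by norm_num) (by omega)))) _).trans ?_
        have e1 : (2 : ℝ≥0∞) ^ ((m₀ + a) * D) = 2 ^ (m₀ * D) * 2 ^ (a * D) := by
          rw [← pow_add]; congr 1; ring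
        have e2 : (2 : ℝ≥0∞) ^ (m₀ * D) ≤ 2 ^ (2 * D) * ENNReal.ofReal (L ^ D) := by
          have : (2 : ℝ) ^ (m₀ * D) ≤ 2 ^ (2 * D) * L ^ D := by
            rw [pow_mul, pow_mul, ← mul_pow]
            exact pow_le_pow_left₀ (by positivity) (by linarith) D
          calc (2 : ℝ≥0∞) ^ (m₀ * D) = ENNReal.ofReal (2 ^ (m₀ * D)) := by
                rw [ENNReal.ofReal_pow (by norm_num)]; simp
            _ ≤ ENNReal.ofReal (2 ^ (2 * D) * L ^ D) := ENNReal.ofReal_le_ofReal this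
            _ = _ := by
                rw [ENNReal.ofReal_mul (by positivity), ENNReal.ofReal_pow (by norm_num)]; simp
        -- The ball grows like `2^(aD)` and the weight decays like `2^(-aN)`; since `N ≥ D + 1` a
        -- geometric series is left over.
        have e3 : (2 : ℝ≥0∞) ^ (a * D) * (2 : ℝ≥0∞)⁻¹ ^ (a * N) ≤ (2 : ℝ≥0∞)⁻¹ ^ a := by
          obtain ⟨k, rfl⟩ := Nat.exists_eq_add_of_le hN
          have : a * (D + 1 + k) = a * D + a + a * k := by ring
          rw [this, pow_add, pow_add, ← mul_assoc, ← mul_assoc, ← mul_pow,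
            ENNReal.mul_inv_cancel (by norm_num) (by norm_num), one_pow, one_mul]
          calc (2 : ℝ≥0∞)⁻¹ ^ a * (2 : ℝ≥0∞)⁻¹ ^ (a * k) ≤ (2 : ℝ≥0∞)⁻¹ ^ a * 1 := by
                gcongr
                exact pow_le_one₀ (by simp) (by simp)
            _ = _ := mul_one _
        calc A * 2 ^ ((m₀ + a) * D) * (2 ^ N * (2 : ℝ≥0∞)⁻¹ ^ (a * N))
            = A * 2 ^ N * 2 ^ (m₀ * D) * (2 ^ (a * D) * (2 : ℝ≥0∞)⁻¹ ^ (a * N)) := by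
              rw [e1]; ring
          _ ≤ A * 2 ^ N * (2 ^ (2 * D) * ENNReal.ofReal (L ^ D)) * (2 : ℝ≥0∞)⁻¹ ^ a := by
              gcongr
          _ = _ := by rw [pow_add]; ring
    _ = _ := by
        rw [ENNReal.tsum_mul_left, ENNReal.tsum_geometric, ENNReal.one_sub_inv_two, inv_inv]
        rw [pow_add, pow_add, pow_add]; ring

end FeynmanTree

namespace FeynmanTree

open scoped ENNReal

/-! ### Integrals of the truncated resolvent over the parameters -/

/-- The kernel `(δ + |x| / s)⁻¹`, cut off at `|x| = A`. -/
noncomputable def kerCut (δ s A x : ℝ) : ℝ := if |x| ≤ A then (δ + |x| / s)⁻¹ else 0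

lemma measurable_kerCut (δ s A : ℝ) : Measurable (kerCut δ s A) := by
  unfold kerCut
  exact Measurable.ite (measurableSet_le (by fun_prop) measurable_const) (by fun_prop)
    measurable_const

lemma kerCut_nonneg {δ s : ℝ} (A x : ℝ) (hδ : 0 < δ) (hs : 0 < s) : 0 ≤ kerCut δ s A x := by
  unfold kerCut
  split_ifs <;> positivity

lemma kerCut_le {δ s : ℝ} (A x : ℝ) (hδ : 0 < δ) (hs : 0 < s) : kerCut δ s A x ≤ δ⁻¹ := by
  unfold kerCut
  split_ifs
  · gcongr
    have : 0 ≤ |x| / s := by positivity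
    linarith
  · positivity

/-- The primitive of the kernel is a logarithm. The cut-off keeps the mass over the whole line
finite, so that the range of `β` can be forgotten in changes of variables. -/
lemma lintegral_kerCut_le {δ s A : ℝ} (hδ : 0 < δ) (hs : 0 < s) (hA : 0 ≤ A) :
    ∫⁻ x, ENNReal.ofReal (kerCut δ s A x) ≤ ENNReal.ofReal (2 * (s * Real.log (1 + A / (δ * s)))) := by
  set f : ℝ → ℝ := fun x => (δ + x / s)⁻¹ with hf
  have hpos : ∀ x, 0 ≤ x → 0 < δ + x / s := fun x hx => by positivity
  have hI : ∫ x in (0 : ℝ)..A, f x = s * Real.log (1 + A / (δ * s)) := by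
    have hder : ∀ x ∈ Set.uIcc 0 A, HasDerivAt (fun x => s * Real.log (δ + x / s)) (f x) x := by
      intro x hx
      rw [Set.uIcc_of_le hA] at hx
      have h1 : HasDerivAt (fun x => δ + x / s) (1 / s) x :=
        ((hasDerivAt_id x).div_const s).const_add δ
      have h2 := (h1.log (hpos x hx.1).ne').const_mul s
      refine h2.congr_deriv ?_
      have := (hpos x hx.1).ne'
      simp only [hf]
      field_simp
    have hcont : IntervalIntegrable f volume 0 A := by
      refine ContinuousOn.intervalIntegrable fun x hx => ?_
      rw [Set.uIcc_of_le hA] at hx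
      refine ContinuousAt.continuousWithinAt (ContinuousAt.inv₀ (by fun_prop) (hpos x hx.1).ne')
    rw [intervalIntegral.integral_eq_sub_of_hasDerivAt hder hcont, zero_div, add_zero, ← mul_sub,
      ← Real.log_div (hpos A hA).ne' hδ.ne']
    congr 2
    field_simp
  have hL : ∫⁻ x in Set.Icc 0 A, ENNReal.ofReal (f x) =
      ENNReal.ofReal (s * Real.log (1 + A / (δ * s))) := by
    rw [← hI, intervalIntegral.integral_of_le hA, ← integral_Icc_eq_integral_Ioc,
      ofReal_integral_eq_lintegral_ofReal]
    · refine ContinuousOn.integrableOn_Icc fun x hx => ?_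
      exact ContinuousAt.continuousWithinAt (ContinuousAt.inv₀ (by fun_prop) (hpos x hx.1).ne')
    · exact (ae_restrict_mem measurableSet_Icc).mono fun x hx => (inv_pos.mpr (hpos x hx.1)).le
  set g : ℝ → ℝ≥0∞ := (Set.Icc 0 A).indicator fun x => ENNReal.ofReal (f x) with hg
  have hfm : Measurable f := by rw [hf]; fun_prop
  have hgm : Measurable g := (hfm.ennreal_ofReal).indicator measurableSet_Icc
  have hle : ∀ x, ENNReal.ofReal (kerCut δ s A x) ≤ g x + g (-x) := by
    intro x
    unfold kerCut
    split_ifs with h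
    · rcases le_total 0 x with hx | hx
      · rw [abs_of_nonneg hx] at h ⊢
        refine le_trans ?_ le_self_add
        rw [hg, Set.indicator_of_mem (show x ∈ Set.Icc 0 A from ⟨hx, h⟩)]
      · rw [abs_of_nonpos hx] at h ⊢
        refine le_trans ?_ le_add_self
        rw [hg, Set.indicator_of_mem (show -x ∈ Set.Icc 0 A from ⟨by linarith, h⟩)]
    · simp
  calc _ ≤ ∫⁻ x, (g x + g (-x)) := lintegral_mono hle
    _ = 2 * ∫⁻ x, g x := by
        rw [lintegral_add_left hgm, lintegral_neg_eq_self, two_mul]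
    _ = _ := by
        rw [hg, lintegral_indicator measurableSet_Icc, hL,
          ENNReal.ofReal_mul (p := 2) (by norm_num), ENNReal.ofReal_ofNat]

lemma lintegral_comp_affine (F : ℝ → ℝ≥0∞) (hF : Measurable F) {a : ℝ} (ha : a ≠ 0) (c : ℝ) :
    ∫⁻ x, F (x * a + c) = ENNReal.ofReal |a|⁻¹ * ∫⁻ x, F x := by
  have h1 : ∫⁻ x, F (x * a + c) = ∫⁻ y, F (y + c) ∂(Measure.map (· * a) volume) := by
    rw [lintegral_map (by fun_prop) (by fun_prop)]
  rw [h1, Real.map_volume_mul_right ha, lintegral_smul_measure, lintegral_add_right_eq_self,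
    abs_inv]
  rfl

lemma sum_update_mul {d : ℕ} (x n : Fin d → ℝ) (i : Fin d) (b : ℝ) :
    ∑ k, Function.update x i b k * n k = b * n i + (∑ k, x k * n k - x i * n i) := by
  rw [← Finset.add_sum_erase _ (fun k => Function.update x i b k * n k) (Finset.mem_univ i),
    ← Finset.add_sum_erase _ (fun k => x k * n k) (Finset.mem_univ i)]
  rw [Function.update_self, add_sub_cancel_left]
  congr 1
  refine Finset.sum_congr rfl fun k hk => ?_
  rw [Function.update_of_ne (Finset.ne_of_mem_erase hk)]

/-- The uniform distribution on `[1, 2]^d`. -/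
noncomputable def cubeMeasure (d : ℕ) : Measure (Fin d → ℝ) :=
  Measure.pi fun _ => volume.restrict (Set.Icc (1 : ℝ) 2)

lemma cubeMeasure_eq (d : ℕ) :
    volume.restrict (Set.pi Set.univ fun _ : Fin d => Set.Icc (1 : ℝ) 2) = cubeMeasure d := by
  rw [cubeMeasure, volume_pi, Measure.restrict_pi_pi]

instance : IsProbabilityMeasure (volume.restrict (Set.Icc (1 : ℝ) 2)) :=
  ⟨by simp; norm_num⟩

instance (d : ℕ) : IsProbabilityMeasure (cubeMeasure d) := by
  unfold cubeMeasure; infer_instance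

/-- With all coordinates of `β` but the `i`-th frozen, the argument is affine with slope `n i`.
Enlarging `[1, 2]` to the line makes the bound independent of the frozen coordinates. -/
lemma lintegral_comp_dot_le {d : ℕ} (F : ℝ → ℝ≥0∞) (hF : Measurable F) (n : Fin d → ℝ) (i : Fin d)
    (hi : n i ≠ 0) :
    ∫⁻ β, F (∑ k, β k * n k) ∂(cubeMeasure d) ≤ ENNReal.ofReal |n i|⁻¹ * ∫⁻ x, F x := by
  have hm : Measurable fun β : Fin d → ℝ => F (∑ k, β k * n k) := hF.comp (by fun_prop)
  have := lintegral_le_of_lmarginal_le (μ := fun _ : Fin d => volume.restrict (Set.Icc (1 : ℝ) 2))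
    {i} hm (measurable_const (a := ENNReal.ofReal |n i|⁻¹ * ∫⁻ x, F x)) ?_
  · refine this.trans (le_of_eq ?_)
    rw [lintegral_const, measure_univ, mul_one]
  · intro x
    rw [lmarginal_singleton, lmarginal_singleton]
    simp only [lintegral_const, measure_univ, mul_one, sum_update_mul]
    refine (setLIntegral_le_lintegral _ _).trans ?_
    rw [lintegral_comp_affine F hF hi]

/-- Two coordinates of `β` move the two arguments independently; the constant is the inverse
Jacobian of this change of variables. -/
lemma lintegral_mul_comp_dot_le {d : ℕ} (F : ℝ → ℝ≥0∞) (hF : Measurable F) (n n' : Fin d → ℝ)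
    {i j : Fin d} (hij : i ≠ j) (hi : n i ≠ 0) (hD : n i * n' j - n j * n' i ≠ 0) :
    ∫⁻ β, F (∑ k, β k * n k) * F (∑ k, β k * n' k) ∂(cubeMeasure d) ≤
      ENNReal.ofReal |n i * n' j - n j * n' i|⁻¹ * (∫⁻ x, F x) ^ 2 := by
  have hm : Measurable fun β : Fin d → ℝ => F (∑ k, β k * n k) * F (∑ k, β k * n' k) :=
    (hF.comp (by fun_prop)).mul (hF.comp (by fun_prop))
  set K := ENNReal.ofReal |n i * n' j - n j * n' i|⁻¹ * (∫⁻ x, F x) ^ 2 with hK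
  have := lintegral_le_of_lmarginal_le (μ := fun _ : Fin d => volume.restrict (Set.Icc (1 : ℝ) 2))
    {j, i} hm (measurable_const (a := K)) ?_
  · refine this.trans (le_of_eq ?_)
    rw [lintegral_const, measure_univ, mul_one]
  · intro x
    have hnot : j ∉ ({i} : Finset (Fin d)) := by simpa using hij.symm
    rw [lmarginal_insert _ hm hnot, lmarginal_insert _ measurable_const hnot]
    simp only [lmarginal_singleton, lintegral_const, measure_univ, mul_one, sum_update_mul,
      Function.update_of_ne hij]
    set c := ∑ k, x k * n k - x j * n j - x i * n i with hc
    set c' := ∑ k, x k * n' k - x j * n' j - x i * n' i with hc'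
    have e1 : ∀ a b : ℝ, b * n i + (a * n j + (∑ k, x k * n k - x j * n j) - x i * n i) =
        b * n i + (a * n j + c) := fun a b => by rw [hc]; ring
    -- In terms of the first argument `y`, which replaces `b`, the second argument is affine in `a`
    -- with slope Jacobian over `n i`. Two one-dimensional substitutions, in the right order, then
    -- suffice.
    have e2 : ∀ a b : ℝ, b * n' i + (a * n' j + (∑ k, x k * n' k - x j * n' j) - x i * n' i) =
        (b * n i + (a * n j + c)) * (n' i / n i) +
          (a * ((n i * n' j - n j * n' i) / n i) + (c' - c * (n' i / n i))) := fun a b => by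
      rw [hc']; field_simp; ring
    simp only [e1, e2]
    calc _ ≤ ∫⁻ a, ∫⁻ b, F (b * n i + (a * n j + c)) *
          F ((b * n i + (a * n j + c)) * (n' i / n i) +
          (a * ((n i * n' j - n j * n' i) / n i) + (c' - c * (n' i / n i)))) :=
          (setLIntegral_le_lintegral _ _).trans
            (lintegral_mono fun a => setLIntegral_le_lintegral _ _)
      _ = ∫⁻ a, ENNReal.ofReal |n i|⁻¹ * ∫⁻ y, F y * F (y * (n' i / n i) +
          (a * ((n i * n' j - n j * n' i) / n i) + (c' - c * (n' i / n i)))) := by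
          refine lintegral_congr fun a => ?_
          exact lintegral_comp_affine (fun y => F y * F (y * (n' i / n i) +
            (a * ((n i * n' j - n j * n' i) / n i) + (c' - c * (n' i / n i)))))
            (hF.mul (hF.comp (by fun_prop))) hi _
      _ = ENNReal.ofReal |n i|⁻¹ * ∫⁻ y, ∫⁻ a, F y * F (a * ((n i * n' j - n j * n' i) / n i) +
            (y * (n' i / n i) + (c' - c * (n' i / n i)))) := by
          rw [lintegral_const_mul]
          · rw [lintegral_lintegral_swap]
            · congr 1
              refine lintegral_congr fun y => lintegral_congr fun a => ?_
              congr 2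
              ring
            · refine Measurable.aemeasurable ?_
              exact (hF.comp measurable_snd).mul (hF.comp (by fun_prop))
          · refine Measurable.lintegral_prod_right' (f := fun p : ℝ × ℝ => F p.2 *
              F (p.2 * (n' i / n i) + (p.1 * ((n i * n' j - n j * n' i) / n i) +
                (c' - c * (n' i / n i))))) ?_
            exact (hF.comp measurable_snd).mul (hF.comp (by fun_prop))
      _ = ENNReal.ofReal |n i|⁻¹ * ∫⁻ y, F y * (ENNReal.ofReal
            |(n i * n' j - n j * n' i) / n i|⁻¹ * ∫⁻ x, F x) := by
          congr 1
          refine lintegral_congr fun y => ?_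
          rw [lintegral_const_mul (F y) (f := fun a => F (a * ((n i * n' j - n j * n' i) / n i) +
            (y * (n' i / n i) + (c' - c * (n' i / n i))))) (hF.comp (by fun_prop)),
            lintegral_comp_affine F hF (div_ne_zero hD hi)]
      _ = K := by
          rw [lintegral_mul_const _ hF, hK, abs_div]
          have : |n i * n' j - n j * n' i|⁻¹ =
              |n i|⁻¹ * (|n i * n' j - n j * n' i| / |n i|)⁻¹ := by
            have : |n i| ≠ 0 := abs_ne_zero.mpr hi
            rw [inv_div]
            field_simp
          rw [this, ENNReal.ofReal_mul (by positivity)]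
          ring
      _ ≤ K := le_rfl

end FeynmanTree

namespace FeynmanTree

open scoped ENNReal

/-! ### Two-dimensional correlations of lattice points -/

lemma absOne_neg (n : ℤ) : absOne (-n) = absOne n := by simp [absOne]

lemma exists_abs_eq_norm {d : ℕ} {V : Label d} (hV : V ≠ 0) : ∃ i, |(V i : ℝ)| = ‖V‖ := by
  obtain ⟨j, _⟩ := Function.ne_iff.mp hV
  have : Nonempty (Fin d) := ⟨j⟩
  obtain ⟨i, _, hi⟩ := Finset.exists_max_image Finset.univ (fun i => |(V i : ℝ)|) Finset.univ_nonempty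
  refine ⟨i, le_antisymm ?_ ?_⟩
  · rw [← Int.norm_eq_abs]; exact norm_le_pi_norm V i
  · rw [pi_norm_le_iff_of_nonneg (abs_nonneg _)]
    exact fun j => by rw [Int.norm_eq_abs]; exact hi j (Finset.mem_univ j)

/-- Once the value `a` of the `i`-th coordinate is fixed, the remaining coordinates decouple, even
though every factor depends on `a`. -/
lemma sum_box_le_sum_slices {d R : ℕ} (i : Fin d) (h : ℤ → Fin d → ℤ → ℝ) :
    ∑ V ∈ box d R, ∏ j ∈ Finset.univ.erase i, h (V i) j (V j) ≤
      ∑ a ∈ Finset.Icc (-(R : ℤ)) R, ∏ j ∈ Finset.univ.erase i,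
        ∑ n ∈ Finset.Icc (-(R : ℤ)) R, h a j n := by
  have h1 : ∀ V ∈ box d R, ∏ j ∈ Finset.univ.erase i, h (V i) j (V j) =
      ∑ a ∈ Finset.Icc (-(R : ℤ)) R, ∏ j, if j = i then (if V j = a then 1 else 0)
        else h a j (V j) := by
    intro V hV
    have hmem : V i ∈ Finset.Icc (-(R : ℤ)) R := Fintype.mem_piFinset.mp hV i
    have : ∀ a, (∏ j, if j = i then (if V j = a then (1 : ℝ) else 0) else h a j (V j)) =
        if V i = a then ∏ j ∈ Finset.univ.erase i, h a j (V j) else 0 := by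
      intro a
      rw [← Finset.mul_prod_erase _ _ (Finset.mem_univ i), if_pos rfl]
      have : ∏ j ∈ Finset.univ.erase i, (if j = i then (if V j = a then (1 : ℝ) else 0)
          else h a j (V j)) = ∏ j ∈ Finset.univ.erase i, h a j (V j) :=
        Finset.prod_congr rfl fun j hj => if_neg (Finset.ne_of_mem_erase hj)
      rw [this]
      split_ifs <;> simp
    simp only [this]
    rw [Finset.sum_ite_eq, if_pos hmem]
  rw [Finset.sum_congr rfl h1, Finset.sum_comm]
  refine Finset.sum_le_sum fun a ha => ?_
  rw [sum_box_prod fun j n => if j = i then (if n = a then 1 else 0) else h a j n,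
    ← Finset.mul_prod_erase _ _ (Finset.mem_univ i)]
  simp only [if_true]
  rw [Finset.sum_ite_eq', if_pos ha, one_mul]
  refine le_of_eq (Finset.prod_congr rfl fun j hj => ?_)
  simp only [if_neg (Finset.ne_of_mem_erase hj)]

/-- For fixed `V' i`, each minor runs through an arithmetic progression of step `±‖V‖` in `V' j`.
Hence each of the `d - 1` one-dimensional sums saves a factor `‖V‖^(-1/(d-1))`; the exponent is at
most `1/2` because `d ≥ 3`. -/
lemma sum_box_minors_le {d R : ℕ} (hd : 3 ≤ d) {V : Label d} (hV : V ∈ box d R) (hV0 : V ≠ 0)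
    {i : Fin d} (hi : |(V i : ℝ)| = ‖V‖) :
    ∑ V' ∈ box d R, ∏ j ∈ Finset.univ.erase i,
        absOne (V i * V' j - V j * V' i) ^ (-(1 / ((d : ℝ) - 1))) ≤
      3 * 31 ^ (d - 1) * (R : ℝ) ^ (d - 1) * ‖V‖⁻¹ := by
  set α : ℝ := 1 / ((d : ℝ) - 1) with hα
  have hd' : (2 : ℝ) ≤ (d : ℝ) - 1 := by
    have : (3 : ℝ) ≤ d := by exact_mod_cast hd
    linarith
  have hα0 : 0 < α := by positivity
  have hα1 : α ≤ 1 / 2 := one_div_le_one_div_of_le (by norm_num) hd'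
  have hVR : ‖V‖ ≤ R := mem_box_iff_norm.mp hV
  have hV1 := one_le_norm hV0
  have hVpos : 0 < ‖V‖ := by linarith
  have hR1 : (1 : ℝ) ≤ R := hV1.trans hVR
  have hRpos : (0 : ℝ) < R := by linarith
  refine (sum_box_le_sum_slices i (fun a j n => absOne (V i * n - V j * a) ^ (-α))).trans ?_
  have hinner : ∀ a ∈ Finset.Icc (-(R : ℤ)) R, ∀ j,
      ∑ n ∈ Finset.Icc (-(R : ℤ)) R, absOne (V i * n - V j * a) ^ (-α) ≤
        31 * (R : ℝ) ^ (1 - α) * ‖V‖ ^ (-α) := by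
    intro a ha j
    have hMV : ((|V i| : ℤ) : ℝ) = ‖V‖ := by rw [← hi]; push_cast; rfl
    have hM1 : 1 ≤ |V i| := by
      have : (1 : ℝ) ≤ ((|V i| : ℤ) : ℝ) := by rw [hMV]; exact hV1
      exact_mod_cast this
    have hMR : |V i| ≤ (R : ℤ) := by
      have : ((|V i| : ℤ) : ℝ) ≤ R := by rw [hMV]; exact hVR
      exact_mod_cast this
    -- The coordinate `i` is a largest one of `V`, so the offset of the progression stays in the
    -- admissible range.
    have hja : |V j * a| ≤ |V i| * R := by
      rw [abs_mul]
      refine mul_le_mul ?_ ?_ (abs_nonneg _) (abs_nonneg _)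
      · have : ((|V j| : ℤ) : ℝ) ≤ ((|V i| : ℤ) : ℝ) := by
          rw [hMV, Int.cast_abs, ← Int.norm_eq_abs]; exact norm_le_pi_norm V j
        exact_mod_cast this
      · rw [abs_le]; exact Finset.mem_Icc.mp ha
    rw [← hMV]
    rcases le_total 0 (V i) with hs | hs
    · rw [abs_of_nonneg hs] at hM1 hMR hja ⊢
      exact sum_Icc_absOne_progression_le hα0 hα1 hM1 hMR hja
    · rw [abs_of_nonpos hs] at hM1 hMR hja ⊢
      have := sum_Icc_absOne_progression_le hα0 hα1 hM1 hMR (c := -(V j * a))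
        (by rwa [abs_neg])
      refine le_trans (le_of_eq (Finset.sum_congr rfl fun n _ => ?_)) this
      rw [← absOne_neg]
      congr 2
      ring
  calc _ ≤ ∑ a ∈ Finset.Icc (-(R : ℤ)) R, ∏ j ∈ Finset.univ.erase i,
        31 * (R : ℝ) ^ (1 - α) * ‖V‖ ^ (-α) :=
        Finset.sum_le_sum fun a ha => Finset.prod_le_prod
          (fun j _ => Finset.sum_nonneg fun n _ => Real.rpow_nonneg (absOne_pos _).le _)
          fun j _ => hinner a ha j
    _ = (2 * R + 1) * (31 ^ (d - 1) * (R : ℝ) ^ ((d : ℝ) - 2) * ‖V‖⁻¹) := by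
        rw [Finset.prod_const, Finset.card_erase_of_mem (Finset.mem_univ i), Finset.card_univ,
          Fintype.card_fin, Finset.sum_const, nsmul_eq_mul]
        have hc : ((d - 1 : ℕ) : ℝ) = (d : ℝ) - 1 := by
          rw [Nat.cast_sub (by omega)]; simp
        have hdne : (d : ℝ) - 1 ≠ 0 := by positivity
        congr 1
        · have : ((R : ℤ) + 1 + R).toNat = 2 * R + 1 := by omega
          simp [this]
        · rw [mul_pow, mul_pow, ← Real.rpow_natCast ((R : ℝ) ^ (1 - α)),
            ← Real.rpow_natCast (‖V‖ ^ (-α)), ← Real.rpow_mul hRpos.le, ← Real.rpow_mul hVpos.le,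
            hc]
          have e1 : (1 - α) * ((d : ℝ) - 1) = (d : ℝ) - 2 := by rw [hα]; field_simp; ring
          have e2 : -α * ((d : ℝ) - 1) = -1 := by rw [hα]; field_simp
          rw [e1, e2, Real.rpow_neg_one]
    _ ≤ (3 * R) * (31 ^ (d - 1) * (R : ℝ) ^ ((d : ℝ) - 2) * ‖V‖⁻¹) := by
        gcongr
        linarith
    _ = _ := by
        have : (R : ℝ) ^ (d - 1) = R * (R : ℝ) ^ ((d : ℝ) - 2) := by
          rw [← Real.rpow_natCast, Nat.cast_sub (by omega)]
          nth_rewrite 2 [← Real.rpow_one (R : ℝ)]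
          rw [← Real.rpow_add hRpos]
          congr 1
          push_cast
          ring
        rw [this]; ring

/-- Two lattice vectors are parallel. -/
def Par {d : ℕ} (V V' : Label d) : Prop := ∀ i j, V i * V' j = V j * V' i

lemma par_of_minors {d : ℕ} {V V' : Label d} {i : Fin d} (hi : V i ≠ 0)
    (h : ∀ j, V i * V' j = V j * V' i) : Par V V' := by
  intro k j
  apply mul_left_cancel₀ hi
  linear_combination (V k) * h j - (V j) * h k

/-- Dividing `V i` and `V' i` by their gcd leaves coprime `a`, `b` with `a V' j = b V j`. Then `a`
divides every coordinate of `V`, and the quotient is the common vector. -/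
lemma Par.exists_common {d : ℕ} {V V' : Label d} (hV : V ≠ 0) (h : Par V V') :
    ∃ (W : Label d) (a b : ℤ), V = a • W ∧ V' = b • W := by
  obtain ⟨i, hi⟩ := Function.ne_iff.mp hV
  obtain ⟨g, a, b, hg, hab, ha, hb⟩ : ∃ g a b : ℤ, g ≠ 0 ∧ IsCoprime a b ∧ V i = a * g ∧
      V' i = b * g := by
    obtain ⟨a, b, h1, h2, h3⟩ := extract_gcd (V i) (V' i)
    exact ⟨gcd (V i) (V' i), a, b, fun h0 => hi (by rw [h1, h0]; simp),
      (gcd_isUnit_iff a b).mp h3, by linarith, by linarith⟩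
  have hdiv : ∀ j, a * V' j = V j * b := by
    intro j
    have := h i j
    rw [ha, hb] at this
    apply mul_left_cancel₀ hg
    linear_combination this
  have hane : a ≠ 0 := by rintro rfl; exact hi (by rw [ha]; simp)
  have hd : ∀ j, a ∣ V j := fun j => hab.dvd_of_dvd_mul_right ⟨V' j, (hdiv j).symm⟩
  choose W hW using hd
  refine ⟨W, a, b, funext fun j => by simpa using hW j, funext fun j => ?_⟩
  have := hdiv j
  rw [hW j] at this
  apply mul_left_cancel₀ hane
  simp only [Pi.smul_apply, smul_eq_mul]
  linear_combination this

open Classical in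
lemma sum_le_sum_of_cover {ι κ : Type*} {s : Finset κ} {t : Finset ι} (φ : ι → κ)
    (f : κ → ℝ) (hf : ∀ x ∈ t, 0 ≤ f (φ x)) (h : ∀ y ∈ s, ∃ x ∈ t, φ x = y) :
    ∑ y ∈ s, f y ≤ ∑ x ∈ t, f (φ x) := by
  rcases isEmpty_or_nonempty ι with hι | hι
  · have hs : s = ∅ := Finset.eq_empty_of_forall_notMem fun y hy =>
      let ⟨x, _⟩ := h y hy; hι.elim x
    rw [hs, Finset.sum_empty]
    exact Finset.sum_nonneg hf
  choose! g hg hg' using h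
  have e : ∑ y ∈ s, f y = ∑ y ∈ s, f (φ (g y)) :=
    Finset.sum_congr rfl fun y hy => by rw [hg' y hy]
  rw [e]
  have hinj : Set.InjOn g s := fun a ha b hb hab => by rw [← hg' a ha, ← hg' b hb, hab]
  rw [← Finset.sum_image (f := fun x => f (φ x)) hinj]
  refine Finset.sum_le_sum_of_subset_of_nonneg ?_ fun x hx _ => hf x hx
  intro x hx
  obtain ⟨y, hy, rfl⟩ := Finset.mem_image.mp hx
  exact hg y hy

open Classical in
-- Writing `V = a W` and `V' = b W`, there are at most `3 R / ‖W‖` values of `b`, the sum of `1/|a|`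
-- costs one logarithm, and the remaining sum of `‖W‖^(-2)` is of order `R^(d-2)` since `d ≥ 3`.
lemma sum_box_parallel_le {d : ℕ} (hd : 3 ≤ d) : ∃ C : ℝ, 0 < C ∧ ∀ R : ℕ, 1 ≤ R →
    ∑ V ∈ (box d R).filter (· ≠ 0), ∑ _V' ∈ (box d R).filter (Par V), ‖V‖⁻¹ ≤
      C * (1 + Real.log R) * (R : ℝ) ^ (d - 1) := by
  obtain ⟨C, hC, hsum⟩ := sum_box_norm_rpow_le (d := d) (s := 2) (by norm_num)
    (by exact_mod_cast (by omega : 2 < d))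
  refine ⟨9 * C, by positivity, fun R hR => ?_⟩
  have hRpos : (0 : ℝ) < R := by exact_mod_cast hR
  have hlog : 0 ≤ Real.log R := Real.log_nonneg (by exact_mod_cast hR)
  set I := Finset.Icc (-(R : ℤ)) R with hI
  rw [Finset.sum_sigma' ]
  set T : Finset (Label d × ℤ × ℤ) := ((box d R).filter (· ≠ 0)) ×ˢ
    (I.filter (· ≠ 0)) ×ˢ I with hT
  set T' := T.filter fun p => |(p.2.2 : ℝ)| * ‖p.1‖ ≤ R with hT'
  have hcov := sum_le_sum_of_cover (s := ((box d R).filter (· ≠ 0)).sigma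
      fun V => (box d R).filter (Par V)) (t := T')
    (fun p => (⟨p.2.1 • p.1, p.2.2 • p.1⟩ : Σ _ : Label d, Label d)) (fun q => ‖q.1‖⁻¹)
    (fun _ _ => by positivity) ?_
  · refine hcov.trans ?_
    have h1 : ∑ p ∈ T', ‖p.2.1 • p.1‖⁻¹ ≤ ∑ W ∈ (box d R).filter (· ≠ 0),
        ∑ a ∈ I.filter (· ≠ 0), ∑ b ∈ I.filter (fun b : ℤ => |(b : ℝ)| * ‖W‖ ≤ R),
          ‖a • W‖⁻¹ := by
      rw [hT', Finset.sum_filter, hT, Finset.sum_product]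
      refine Finset.sum_le_sum fun W _ => ?_
      rw [Finset.sum_product]
      exact Finset.sum_le_sum fun a _ => (Finset.sum_filter _ _).ge
    refine h1.trans ?_
    have h2 : ∀ W ∈ (box d R).filter (· ≠ 0), ∑ a ∈ I.filter (· ≠ 0),
        ∑ b ∈ I.filter (fun b : ℤ => |(b : ℝ)| * ‖W‖ ≤ R), ‖a • W‖⁻¹ ≤
          9 * (1 + Real.log R) * R * ‖W‖ ^ (-2 : ℝ) := by
      intro W hW
      obtain ⟨hWb, hW0⟩ := Finset.mem_filter.mp hW
      have hW1 := one_le_norm hW0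
      have hWpos : 0 < ‖W‖ := by linarith
      have hWR : ‖W‖ ≤ R := mem_box_iff_norm.mp hWb
      have hcard : ((I.filter (fun b : ℤ => |(b : ℝ)| * ‖W‖ ≤ R)).card : ℝ) ≤ 3 * (R / ‖W‖) := by
        set n := ⌊(R : ℝ) / ‖W‖⌋₊ with hn
        have hsub : I.filter (fun b : ℤ => |(b : ℝ)| * ‖W‖ ≤ R) ⊆ Finset.Icc (-(n : ℤ)) n := by
          intro b hb
          have hb' := (Finset.mem_filter.mp hb).2
          rw [← le_div_iff₀ hWpos, ← Int.cast_abs, ← Nat.cast_natAbs] at hb'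
          have := Nat.le_floor hb'
          rw [Finset.mem_Icc]
          omega
        have h3 := Finset.card_le_card hsub
        have h4 : (Finset.Icc (-(n : ℤ)) n).card = 2 * n + 1 := by
          have : ((n : ℤ) + 1 + n).toNat = 2 * n + 1 := by omega
          simp [this]
        rw [h4] at h3
        have h5 : (n : ℝ) ≤ R / ‖W‖ := Nat.floor_le (by positivity)
        have h6 : 1 ≤ R / ‖W‖ := by rw [le_div_iff₀ hWpos]; linarith
        have h7 : ((I.filter (fun b : ℤ => |(b : ℝ)| * ‖W‖ ≤ R)).card : ℝ) ≤ 2 * n + 1 := by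
          exact_mod_cast h3
        linarith
      have hinv : ∑ a ∈ I.filter (· ≠ 0), |(a : ℝ)|⁻¹ ≤ 3 * (1 + Real.log R) := by
        calc _ = ∑ a ∈ I.filter (· ≠ 0), (absOne a)⁻¹ :=
              Finset.sum_congr rfl fun a ha => by
                rw [absOne_of_ne_zero (Finset.mem_filter.mp ha).2]
          _ ≤ ∑ a ∈ I, (absOne a)⁻¹ :=
              Finset.sum_le_sum_of_subset_of_nonneg (Finset.filter_subset _ _)
                fun a _ _ => inv_nonneg.mpr (absOne_pos a).le
          _ ≤ _ := sum_Icc_inv_absOne_le.trans (by linarith)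
      calc _ = ((I.filter (fun b : ℤ => |(b : ℝ)| * ‖W‖ ≤ R)).card : ℝ) * ‖W‖⁻¹ *
            ∑ a ∈ I.filter (· ≠ 0), |(a : ℝ)|⁻¹ := by
            rw [Finset.mul_sum]
            refine Finset.sum_congr rfl fun a _ => ?_
            rw [Finset.sum_const, nsmul_eq_mul, norm_smul, Int.norm_eq_abs, mul_inv]
            ring
        _ ≤ (3 * (R / ‖W‖)) * ‖W‖⁻¹ * (3 * (1 + Real.log R)) := by
            gcongr
        _ = _ := by
            rw [Real.rpow_neg hWpos.le, Real.rpow_two]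
            field_simp
            ring
    refine (Finset.sum_le_sum h2).trans ?_
    rw [← Finset.mul_sum]
    calc _ ≤ 9 * (1 + Real.log R) * R * (C * (R : ℝ) ^ ((d : ℝ) - 2)) := by
          gcongr
          exact hsum R hR
      _ = _ := by
          have : (R : ℝ) ^ (d - 1) = R * (R : ℝ) ^ ((d : ℝ) - 2) := by
            rw [← Real.rpow_natCast, Nat.cast_sub (by omega)]
            nth_rewrite 2 [← Real.rpow_one (R : ℝ)]
            rw [← Real.rpow_add hRpos]
            congr 1
            push_cast
            ring
          rw [this]; ring
  · rintro ⟨V, V'⟩ hy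
    simp only [Finset.mem_sigma, Finset.mem_filter] at hy
    obtain ⟨⟨hVb, hV0⟩, hVb', hpar⟩ := hy
    obtain ⟨W, a, b, rfl, rfl⟩ := hpar.exists_common hV0
    have ha : a ≠ 0 := by rintro rfl; simp at hV0
    have hW0 : W ≠ 0 := by rintro rfl; simp at hV0
    have hW1 := one_le_norm hW0
    have ha1 : (1 : ℝ) ≤ |(a : ℝ)| := by exact_mod_cast Int.one_le_abs ha
    rw [mem_box_iff_norm, norm_smul, Int.norm_eq_abs] at hVb hVb'
    have hWR : ‖W‖ ≤ R := by nlinarith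
    have haR : |(a : ℝ)| ≤ R := by nlinarith [abs_nonneg (a : ℝ)]
    have hbR : |(b : ℝ)| ≤ R := by nlinarith [abs_nonneg (b : ℝ)]
    refine ⟨(W, a, b), ?_, rfl⟩
    simp only [hT', hT, hI, Finset.mem_filter, Finset.mem_product, mem_box_iff_norm,
      Finset.mem_Icc, ← abs_le]
    refine ⟨⟨⟨hWR, hW0⟩, ⟨?_, ha⟩, ?_⟩, hVb'⟩
    · exact_mod_cast haR
    · exact_mod_cast hbR

end FeynmanTree

namespace FeynmanTree

open scoped ENNReal

/-! ### Moments of the lattice sums over the parameters -/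

/-- The bilinear form of `Q`, on labels. -/
noncomputable def form {d : ℕ} (β : Fin d → ℝ) (U V : Label d) : ℝ :=
  ∑ k, β k * ((U k : ℝ) * V k)

/-- The kernel `(R⁻ᵈ + |form β U V| / R²)⁻¹`, with a harmless truncation. -/
noncomputable def boxKer {d : ℕ} (R : ℕ) (β : Fin d → ℝ) (U V : Label d) : ℝ :=
  kerCut ((R : ℝ) ^ d)⁻¹ ((R : ℝ) ^ 2) (2 * d * (R : ℝ) ^ 2) (form β U V)

lemma measurable_boxKer {d : ℕ} (R : ℕ) (U V : Label d) :
    Measurable fun β => ENNReal.ofReal (boxKer R β U V) := by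
  unfold boxKer form
  exact ((measurable_kerCut _ _ _).comp (by fun_prop)).ennreal_ofReal

lemma boxKer_nonneg {d R : ℕ} (hR : 1 ≤ R) (β : Fin d → ℝ) (U V : Label d) :
    0 ≤ boxKer R β U V := by
  have : (0 : ℝ) < R := by exact_mod_cast hR
  exact kerCut_nonneg _ _ (by positivity) (by positivity)

lemma boxKer_le {d R : ℕ} (hR : 1 ≤ R) (β : Fin d → ℝ) (U V : Label d) :
    boxKer R β U V ≤ (R : ℝ) ^ d := by
  have : (0 : ℝ) < R := by exact_mod_cast hR
  exact (kerCut_le _ _ (by positivity) (by positivity)).trans (by rw [inv_inv])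

/-- A bound for the total mass of the truncated kernel. -/
noncomputable def kerMass (d R : ℕ) : ℝ :=
  2 * (Real.log (1 + 2 * d) + d) * (1 + Real.log R) * (R : ℝ) ^ 2

lemma kerMass_nonneg {d R : ℕ} (hR : 1 ≤ R) : 0 ≤ kerMass d R := by
  have h1 : 0 ≤ Real.log R := Real.log_nonneg (by exact_mod_cast hR)
  have h2 : 0 ≤ Real.log (1 + 2 * (d : ℝ)) := Real.log_nonneg (by
    linarith [(Nat.cast_nonneg d : (0 : ℝ) ≤ d)])
  unfold kerMass
  positivity

/-- The ratio inside the logarithm of `lintegral_kerCut_le` equals `2 d R^d`, so the mass is `R²` up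
to one factor `1 + log R`. -/
lemma lintegral_kerCut_le_kerMass {d R : ℕ} (hR : 1 ≤ R) :
    ∫⁻ x, ENNReal.ofReal (kerCut ((R : ℝ) ^ d)⁻¹ ((R : ℝ) ^ 2) (2 * d * (R : ℝ) ^ 2) x) ≤
      ENNReal.ofReal (kerMass d R) := by
  have hR1 : (1 : ℝ) ≤ R := by exact_mod_cast hR
  have hRpos : (0 : ℝ) < R := by linarith
  have hlog : 0 ≤ Real.log R := Real.log_nonneg hR1
  have hd0 : (0 : ℝ) ≤ d := Nat.cast_nonneg d
  have hlog2 : 0 ≤ Real.log (1 + 2 * (d : ℝ)) := Real.log_nonneg (by linarith)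
  refine (lintegral_kerCut_le (by positivity) (by positivity) (by positivity)).trans
    (ENNReal.ofReal_le_ofReal ?_)
  have h1 : 2 * d * (R : ℝ) ^ 2 / (((R : ℝ) ^ d)⁻¹ * (R : ℝ) ^ 2) = 2 * d * (R : ℝ) ^ d := by
    field_simp
  have h2 : (1 : ℝ) ≤ (R : ℝ) ^ d := one_le_pow₀ hR1
  have h3 : Real.log (1 + 2 * d * (R : ℝ) ^ d) ≤ Real.log (1 + 2 * d) + d * Real.log R := by
    rw [← Real.log_pow, ← Real.log_mul (by positivity) (by positivity)]
    exact Real.log_le_log (by positivity) (by nlinarith)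
  rw [h1, kerMass]
  have h4 : Real.log (1 + 2 * d) + d * Real.log R ≤
      (Real.log (1 + 2 * d) + d) * (1 + Real.log R) := by nlinarith
  have hR2 : (0 : ℝ) ≤ (R : ℝ) ^ 2 := by positivity
  nlinarith [mul_le_mul_of_nonneg_left (h3.trans h4) hR2]

lemma lintegral_boxKer_le {d R : ℕ} (hR : 1 ≤ R) (U V : Label d) (i : Fin d) (hU : U i ≠ 0)
    (hV : V i ≠ 0) :
    ∫⁻ β, ENNReal.ofReal (boxKer R β U V) ∂(cubeMeasure d) ≤
      ENNReal.ofReal (|(U i : ℝ)|⁻¹ * |(V i : ℝ)|⁻¹ * kerMass d R) := by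
  have hne : ((U i : ℝ) * V i) ≠ 0 := by
    have : (U i : ℝ) ≠ 0 := by exact_mod_cast hU
    have : (V i : ℝ) ≠ 0 := by exact_mod_cast hV
    positivity
  refine (lintegral_comp_dot_le (fun x => ENNReal.ofReal (kerCut ((R : ℝ) ^ d)⁻¹ ((R : ℝ) ^ 2)
    (2 * d * (R : ℝ) ^ 2) x)) (measurable_kerCut _ _ _).ennreal_ofReal
    (fun k => (U k : ℝ) * V k) i hne).trans ?_
  rw [← mul_inv, ← abs_mul, ENNReal.ofReal_mul (by positivity)]
  gcongr
  exact lintegral_kerCut_le_kerMass hR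

lemma sum_box_absOne_single_le {d : ℕ} {a : ℝ} (h0 : 0 ≤ a) (h1 : a < 1) (i : Fin d) :
    ∃ C : ℝ, 0 < C ∧ ∀ R : ℕ, 1 ≤ R →
      ∑ U ∈ box d R, absOne (U i) ^ (-a) ≤ C * (R : ℝ) ^ ((d : ℝ) - a) := by
  obtain ⟨C, hC, h⟩ := sum_box_prod_absOne_rpow_le (fun k : Fin d => if k = i then a else 0)
    (fun k => by split_ifs <;> linarith) (fun k => by split_ifs <;> linarith)
  refine ⟨C, hC, fun R hR => ?_⟩
  have := h R hR
  rw [Finset.sum_ite_eq' Finset.univ i] at this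
  simp only [Finset.mem_univ, if_true] at this
  refine le_trans (le_of_eq (Finset.sum_congr rfl fun U _ => ?_)) this
  rw [← Finset.mul_prod_erase _ _ (Finset.mem_univ i), if_pos rfl, Finset.prod_eq_one, mul_one]
  intro k hk
  rw [if_neg (Finset.ne_of_mem_erase hk), neg_zero, Real.rpow_zero]

lemma sum_box_absOne_pair_le {d : ℕ} {a : ℝ} (h0 : 0 ≤ a) (h1 : a < 1) {i j : Fin d}
    (hij : j ≠ i) : ∃ C : ℝ, 0 < C ∧ ∀ R : ℕ, 1 ≤ R →
      ∑ U ∈ box d R, absOne (U i) ^ (-a) * absOne (U j) ^ (-a) ≤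
        C * (R : ℝ) ^ ((d : ℝ) - 2 * a) := by
  obtain ⟨C, hC, h⟩ := sum_box_prod_absOne_rpow_le
    (fun k : Fin d => if k = i then a else if k = j then a else 0)
    (fun k => by split_ifs <;> linarith) (fun k => by split_ifs <;> linarith)
  refine ⟨C, hC, fun R hR => ?_⟩
  have e : ∑ k : Fin d, (if k = i then a else if k = j then a else 0) = 2 * a := by
    rw [← Finset.add_sum_erase _ _ (Finset.mem_univ i), if_pos rfl,
      ← Finset.add_sum_erase _ _ (Finset.mem_erase.mpr ⟨hij, Finset.mem_univ j⟩), if_neg hij,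
      if_pos rfl, Finset.sum_eq_zero]
    · ring
    · intro k hk
      simp only [Finset.mem_erase] at hk
      rw [if_neg hk.2.1, if_neg hk.1]
  have := h R hR
  rw [e] at this
  refine le_trans (le_of_eq (Finset.sum_congr rfl fun U _ => ?_)) this
  rw [← Finset.mul_prod_erase _ _ (Finset.mem_univ i), if_pos rfl,
    ← Finset.mul_prod_erase _ _ (Finset.mem_erase.mpr ⟨hij, Finset.mem_univ j⟩), if_neg hij,
    if_pos rfl, Finset.prod_eq_one, mul_one]
  intro k hk
  simp only [Finset.mem_erase] at hk
  rw [if_neg hk.2.1, if_neg hk.1, neg_zero, Real.rpow_zero]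

open Classical in
/-- The contribution of those `U` which have a vanishing coordinate. -/
noncomputable def thinSum {d : ℕ} (R : ℕ) (β : Fin d → ℝ) : ℝ≥0∞ :=
  ∑ U ∈ box d R, ∑ V ∈ box d R,
    if (∃ j, U j = 0) ∧ ∃ i, U i ≠ 0 ∧ V i ≠ 0 then ENNReal.ofReal (boxKer R β U V) else 0

lemma measurable_thinSum {d : ℕ} (R : ℕ) : Measurable (thinSum (d := d) R) := by
  unfold thinSum
  refine Finset.measurable_sum _ fun U _ => Finset.measurable_sum _ fun V _ => ?_
  split_ifs
  · exact measurable_boxKer R U V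
  · exact measurable_const

lemma inv_le_rpow {x : ℝ} (hx : 1 ≤ x) : x⁻¹ ≤ x ^ (-(3 / 4) : ℝ) := by
  rw [← Real.rpow_neg_one]
  exact Real.rpow_le_rpow_of_exponent_le hx (by norm_num)

/-- Weakening `|n|⁻¹` to `|n|^(-3/4)` avoids logarithms in the one-dimensional sums. The vanishing
coordinate `U j` supplies a third such factor for free, as it equals 1 there. The sums are then of
order `R^(2d - 9/4)`, which beats the kernel mass `R²` by `R^(-1/4)`; therefore a first moment
suffices. -/
lemma lintegral_thinSum_le (d : ℕ) : ∃ C : ℝ, 0 < C ∧ ∀ R : ℕ, 1 ≤ R →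
    ∫⁻ β, thinSum R β ∂(cubeMeasure d) ≤
      ENNReal.ofReal (C * (1 + Real.log R) * (R : ℝ) ^ (2 * (d : ℝ) - 1 / 4)) := by
  choose C1 hC1 h1 using fun i : Fin d =>
    sum_box_absOne_single_le (d := d) (a := 3 / 4) (by norm_num) (by norm_num) i
  choose C2 hC2 h2 using fun (i : Fin d) (j : {j // j ≠ i}) =>
    sum_box_absOne_pair_le (d := d) (a := 3 / 4) (by norm_num) (by norm_num) j.2
  set c := 2 * (Real.log (1 + 2 * d) + d) with hc
  have hd0 : (0 : ℝ) ≤ d := Nat.cast_nonneg d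
  have hc0 : 0 ≤ c := by
    have : 0 ≤ Real.log (1 + 2 * (d : ℝ)) := Real.log_nonneg (by linarith)
    positivity
  set C := ∑ i : Fin d, ∑ j : {j // j ≠ i}, C2 i j * C1 i with hC
  have hC0 : 0 ≤ C := Finset.sum_nonneg fun i _ => Finset.sum_nonneg fun j _ =>
    mul_nonneg (hC2 i j).le (hC1 i).le
  refine ⟨C * c + 1, by positivity, fun R hR => ?_⟩
  have hRpos : (0 : ℝ) < R := by exact_mod_cast hR
  have hlog : 0 ≤ Real.log R := Real.log_nonneg (by exact_mod_cast hR)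
  have hK := kerMass_nonneg (d := d) hR
  have hp : ∀ (n : ℤ), 0 ≤ absOne n ^ (-(3 / 4) : ℝ) := fun n =>
    Real.rpow_nonneg (absOne_pos n).le _
  set B : Label d → Label d → ℝ := fun U V => ∑ i : Fin d, ∑ j : {j // j ≠ i},
    (absOne (U i) ^ (-(3 / 4) : ℝ) * absOne (U j) ^ (-(3 / 4) : ℝ)) *
      absOne (V i) ^ (-(3 / 4) : ℝ) * kerMass d R with hB
  have hBterm : ∀ (U V : Label d), ∀ i : Fin d, ∀ j : {j // j ≠ i},
      0 ≤ (absOne (U i) ^ (-(3 / 4) : ℝ) * absOne (U j) ^ (-(3 / 4) : ℝ)) *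
      absOne (V i) ^ (-(3 / 4) : ℝ) * kerMass d R := fun U V i j => by
    have := hp (U i); have := hp (U j); have := hp (V i); positivity
  have hB0 : ∀ U V, 0 ≤ B U V := fun U V =>
    Finset.sum_nonneg fun i _ => Finset.sum_nonneg fun j _ => hBterm U V i j
  unfold thinSum
  rw [lintegral_finsetSum]
  swap
  · intro U _
    refine Finset.measurable_sum _ fun V _ => ?_
    split_ifs
    · exact measurable_boxKer R U V
    · exact measurable_const
  calc _ ≤ ∑ U ∈ box d R, ∑ V ∈ box d R, ENNReal.ofReal (B U V) := by
        refine Finset.sum_le_sum fun U _ => ?_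
        rw [lintegral_finsetSum]
        swap
        · intro V _
          split_ifs
          · exact measurable_boxKer R U V
          · exact measurable_const
        refine Finset.sum_le_sum fun V _ => ?_
        split_ifs with h
        · obtain ⟨⟨j, hj⟩, i, hUi, hVi⟩ := h
          refine (lintegral_boxKer_le hR U V i hUi hVi).trans (ENNReal.ofReal_le_ofReal ?_)
          have hji : j ≠ i := by rintro rfl; exact hUi hj
          refine le_trans ?_ (Finset.single_le_sum (f := fun i => ∑ j : {j // j ≠ i},
            (absOne (U i) ^ (-(3 / 4) : ℝ) * absOne (U j) ^ (-(3 / 4) : ℝ)) *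
            absOne (V i) ^ (-(3 / 4) : ℝ) * kerMass d R)
            (fun i _ => Finset.sum_nonneg fun j _ => hBterm U V i j) (Finset.mem_univ i))
          refine le_trans ?_ (Finset.single_le_sum (f := fun j : {j // j ≠ i} =>
            (absOne (U i) ^ (-(3 / 4) : ℝ) * absOne (U j) ^ (-(3 / 4) : ℝ)) *
            absOne (V i) ^ (-(3 / 4) : ℝ) * kerMass d R)
            (fun j _ => hBterm U V i j) (Finset.mem_univ ⟨j, hji⟩))
          simp only [hj]
          have e : absOne 0 = 1 := by simp [absOne]
          rw [e, Real.one_rpow, mul_one, ← absOne_of_ne_zero hUi, ← absOne_of_ne_zero hVi]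
          have := hp (U i)
          have := absOne_pos (V i)
          gcongr
          · exact inv_le_rpow (one_le_absOne _)
          · exact inv_le_rpow (one_le_absOne _)
        · simp
    _ = ENNReal.ofReal (∑ U ∈ box d R, ∑ V ∈ box d R, B U V) := by
        rw [ENNReal.ofReal_sum_of_nonneg fun U _ => Finset.sum_nonneg fun V _ => hB0 U V]
        exact Finset.sum_congr rfl fun U _ =>
          (ENNReal.ofReal_sum_of_nonneg fun V _ => hB0 U V).symm
    _ ≤ _ := by
        refine ENNReal.ofReal_le_ofReal ?_
        have e : ∑ U ∈ box d R, ∑ V ∈ box d R, B U V = ∑ i : Fin d, ∑ j : {j // j ≠ i},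
            (∑ U ∈ box d R, absOne (U i) ^ (-(3 / 4) : ℝ) * absOne (U j) ^ (-(3 / 4) : ℝ)) *
            (∑ V ∈ box d R, absOne (V i) ^ (-(3 / 4) : ℝ)) * kerMass d R := by
          simp only [hB, Finset.mul_sum, Finset.sum_mul]
          calc _ = ∑ U ∈ box d R, ∑ i : Fin d, ∑ V ∈ box d R, ∑ j : {j // j ≠ i},
                (absOne (U i) ^ (-(3 / 4) : ℝ) * absOne (U j) ^ (-(3 / 4) : ℝ)) *
                absOne (V i) ^ (-(3 / 4) : ℝ) * kerMass d R :=
                Finset.sum_congr rfl fun U _ => Finset.sum_comm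
            _ = _ := by
                rw [Finset.sum_comm]
                refine Finset.sum_congr rfl fun i _ => ?_
                calc _ = ∑ U ∈ box d R, ∑ j : {j // j ≠ i}, ∑ V ∈ box d R,
                      (absOne (U i) ^ (-(3 / 4) : ℝ) * absOne (U j) ^ (-(3 / 4) : ℝ)) *
                      absOne (V i) ^ (-(3 / 4) : ℝ) * kerMass d R :=
                      Finset.sum_congr rfl fun U _ => Finset.sum_comm
                  _ = _ := by
                      rw [Finset.sum_comm]
                      exact Finset.sum_congr rfl fun j _ => Finset.sum_comm
        rw [e]
        calc _ ≤ ∑ i : Fin d, ∑ j : {j // j ≠ i}, (C2 i j * (R : ℝ) ^ ((d : ℝ) - 2 * (3 / 4))) *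
              (C1 i * (R : ℝ) ^ ((d : ℝ) - 3 / 4)) * kerMass d R := by
              refine Finset.sum_le_sum fun i _ => Finset.sum_le_sum fun j _ => ?_
              have := h1 i R hR
              have := h2 i j R hR
              have := (hC2 i j).le
              have : 0 ≤ ∑ V ∈ box d R, absOne (V i) ^ (-(3 / 4) : ℝ) :=
                Finset.sum_nonneg fun V _ => hp _
              gcongr
          _ = C * ((R : ℝ) ^ ((d : ℝ) - 2 * (3 / 4)) * (R : ℝ) ^ ((d : ℝ) - 3 / 4) *
                kerMass d R) := by
              simp only [hC, Finset.sum_mul]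
              refine Finset.sum_congr rfl fun i _ => Finset.sum_congr rfl fun j _ => ?_
              ring
          _ = (C * c) * (1 + Real.log R) * (R : ℝ) ^ (2 * (d : ℝ) - 1 / 4) := by
              have : (R : ℝ) ^ (2 * (d : ℝ) - 1 / 4) = (R : ℝ) ^ ((d : ℝ) - 2 * (3 / 4)) *
                  (R : ℝ) ^ ((d : ℝ) - 3 / 4) * (R : ℝ) ^ 2 := by
                rw [← Real.rpow_natCast (R : ℝ) 2, ← Real.rpow_add hRpos, ← Real.rpow_add hRpos]
                congr 1
                push_cast
                ring
              rw [this, kerMass]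
              ring
          _ ≤ _ := by
              gcongr
              linarith

/-- A weight on the vectors `U` with nonvanishing coordinates. -/
noncomputable def pairWeight {d : ℕ} (U : Label d) : ℝ :=
  ∑ i, ∑ j : {j // j ≠ i}, absOne (U i) ^ (-(1 / 2) : ℝ) * absOne (U j) ^ (-(1 / 2) : ℝ)

lemma pairWeight_sq_ge {d : ℕ} {U : Label d} {i j : Fin d} (hij : j ≠ i) :
    (absOne (U i) * absOne (U j))⁻¹ ≤ pairWeight U ^ 2 := by
  have hp : ∀ (n : ℤ), 0 ≤ absOne n ^ (-(1 / 2) : ℝ) := fun n =>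
    Real.rpow_nonneg (absOne_pos n).le _
  have h1 : absOne (U i) ^ (-(1 / 2) : ℝ) * absOne (U j) ^ (-(1 / 2) : ℝ) ≤ pairWeight U := by
    refine le_trans ?_ (Finset.single_le_sum (f := fun i => ∑ j : {j // j ≠ i},
      (absOne (U i) ^ (-(1 / 2) : ℝ) * absOne (U j) ^ (-(1 / 2) : ℝ)))
      (fun i _ => Finset.sum_nonneg fun j _ => mul_nonneg (hp _) (hp _)) (Finset.mem_univ i))
    exact Finset.single_le_sum (f := fun j : {j // j ≠ i} =>
      (absOne (U i) ^ (-(1 / 2) : ℝ) * absOne (U j) ^ (-(1 / 2) : ℝ)))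
      (fun j _ => mul_nonneg (hp _) (hp _)) (Finset.mem_univ ⟨j, hij⟩)
  have hsq : ∀ n : ℤ, (absOne n ^ (-(1 / 2) : ℝ)) ^ 2 = (absOne n)⁻¹ := fun n => by
    rw [← Real.rpow_natCast, ← Real.rpow_mul (absOne_pos n).le, ← Real.rpow_neg_one]
    norm_num
  calc _ = (absOne (U i) ^ (-(1 / 2) : ℝ) * absOne (U j) ^ (-(1 / 2) : ℝ)) ^ 2 := by
        rw [mul_pow, hsq, hsq, mul_inv]
    _ ≤ _ := pow_le_pow_left₀ (mul_nonneg (hp _) (hp _)) h1 2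

lemma pairWeight_pos {d : ℕ} (hd : 2 ≤ d) (U : Label d) : 0 < pairWeight U := by
  have hp : ∀ (n : ℤ), 0 < absOne n ^ (-(1 / 2) : ℝ) := fun n =>
    Real.rpow_pos_of_pos (absOne_pos n) _
  have h0 : 0 ≤ pairWeight U := Finset.sum_nonneg fun i _ => Finset.sum_nonneg fun j _ =>
    mul_nonneg (hp _).le (hp _).le
  have h1 := pairWeight_sq_ge (U := U) (i := ⟨0, by omega⟩) (j := ⟨1, by omega⟩) (by simp)
  have h2 := absOne_pos (U ⟨0, by omega⟩)
  have h3 := absOne_pos (U ⟨1, by omega⟩)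
  have h4 : 0 < pairWeight U ^ 2 := lt_of_lt_of_le (by positivity) h1
  rcases h0.lt_or_eq with h | h
  · exact h
  · rw [← h] at h4; norm_num at h4

lemma sum_box_pairWeight_le (d : ℕ) : ∃ C : ℝ, 0 < C ∧ ∀ R : ℕ, 1 ≤ R →
    ∑ U ∈ box d R, pairWeight U ≤ C * (R : ℝ) ^ ((d : ℝ) - 1) := by
  choose C2 hC2 h2 using fun (i : Fin d) (j : {j // j ≠ i}) =>
    sum_box_absOne_pair_le (d := d) (a := 1 / 2) (by norm_num) (by norm_num) j.2
  refine ⟨(∑ i, ∑ j, C2 i j) + 1, ?_, fun R hR => ?_⟩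
  · have : 0 ≤ ∑ i, ∑ j, C2 i j :=
      Finset.sum_nonneg fun i _ => Finset.sum_nonneg fun j _ => (hC2 i j).le
    linarith
  have hRpos : (0 : ℝ) < R := by exact_mod_cast hR
  unfold pairWeight
  rw [Finset.sum_comm]
  calc _ = ∑ i : Fin d, ∑ j : {j // j ≠ i}, ∑ U ∈ box d R,
        absOne (U i) ^ (-(1 / 2) : ℝ) * absOne (U j) ^ (-(1 / 2) : ℝ) :=
        Finset.sum_congr rfl fun i _ => Finset.sum_comm
    _ ≤ ∑ i : Fin d, ∑ j : {j // j ≠ i}, C2 i j * (R : ℝ) ^ ((d : ℝ) - 2 * (1 / 2)) :=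
        Finset.sum_le_sum fun i _ => Finset.sum_le_sum fun j _ => h2 i j R hR
    _ = (∑ i, ∑ j, C2 i j) * (R : ℝ) ^ ((d : ℝ) - 1) := by
        simp only [Finset.sum_mul]
        norm_num
    _ ≤ _ := by
        gcongr
        linarith

end FeynmanTree

/-! ### Second moments over the parameters for vectors without vanishing coordinates -/

namespace FeynmanTree

open scoped ENNReal

/-- If `V` and `V'` are not parallel, the Jacobian is `U i * U j` times a minor of `V`, `V'`, and
`j` is chosen to make the minor largest. If they are parallel, the two forms are completely
correlated, so one kernel is replaced by its maximum `R^d` and only a first moment is taken. -/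
lemma lintegral_boxKer_mul_le {d R : ℕ} (hd : 3 ≤ d) (hR : 1 ≤ R) {U V V' : Label d}
    (hUb : U ∈ box d R) (hU : ∀ i, U i ≠ 0) (hV0 : V ≠ 0) {i : Fin d}
    (hi : |(V i : ℝ)| = ‖V‖) :
    ∫⁻ β, ENNReal.ofReal (boxKer R β U V) * ENNReal.ofReal (boxKer R β U V') ∂(cubeMeasure d) ≤
      ENNReal.ofReal (kerMass d R ^ 2 * pairWeight U ^ 2 * ∏ j ∈ Finset.univ.erase i,
        absOne (V i * V' j - V j * V' i) ^ (-(1 / ((d : ℝ) - 1)))) +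
      (open Classical in if Par V V' then
        ENNReal.ofReal ((R : ℝ) ^ d * (R * pairWeight U ^ 2 * kerMass d R) * ‖V‖⁻¹) else 0) := by
  have hV1 := one_le_norm hV0
  have hVpos : 0 < ‖V‖ := by linarith
  have hVi : V i ≠ 0 := by
    rintro h
    rw [h] at hi
    simp at hi
    linarith
  have hRpos : (0 : ℝ) < R := by exact_mod_cast hR
  have hK := kerMass_nonneg (d := d) hR
  by_cases hpar : Par V V'
  · rw [if_pos hpar]
    refine le_trans ?_ le_add_self
    calc _ ≤ ∫⁻ β, ENNReal.ofReal (boxKer R β U V) * ENNReal.ofReal ((R : ℝ) ^ d)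
          ∂(cubeMeasure d) := by
          refine lintegral_mono fun β => ?_
          gcongr
          exact boxKer_le hR β U V'
      _ = (∫⁻ β, ENNReal.ofReal (boxKer R β U V) ∂(cubeMeasure d)) *
          ENNReal.ofReal ((R : ℝ) ^ d) := lintegral_mul_const _ (measurable_boxKer R U V)
      _ ≤ ENNReal.ofReal (|(U i : ℝ)|⁻¹ * |(V i : ℝ)|⁻¹ * kerMass d R) *
          ENNReal.ofReal ((R : ℝ) ^ d) := by
          gcongr
          exact lintegral_boxKer_le hR U V i (hU i) hVi
      _ ≤ _ := by
          rw [← ENNReal.ofReal_mul (by positivity), hi]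
          refine ENNReal.ofReal_le_ofReal ?_
          obtain ⟨j, hj⟩ : ∃ j : Fin d, j ≠ i := by
            by_cases h0 : (⟨0, by omega⟩ : Fin d) = i
            · exact ⟨⟨1, by omega⟩, by rw [← h0]; simp⟩
            · exact ⟨_, h0⟩
          have hw := pairWeight_sq_ge (U := U) hj
          rw [absOne_of_ne_zero (hU i), absOne_of_ne_zero (hU j)] at hw
          have hUj : |(U j : ℝ)| ≤ R := by exact_mod_cast (mem_box.mp hUb j)
          have hUi0 : 0 < |(U i : ℝ)| := abs_pos.mpr (by exact_mod_cast hU i)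
          have hUj0 : 0 < |(U j : ℝ)| := abs_pos.mpr (by exact_mod_cast hU j)
          -- Spending one power of `R` gives the parallel case the same dependence on `U` as the
          -- other one.
          have h1 : |(U i : ℝ)|⁻¹ ≤ R * pairWeight U ^ 2 := by
            calc |(U i : ℝ)|⁻¹ = |(U j : ℝ)| * (|(U i : ℝ)| * |(U j : ℝ)|)⁻¹ := by field_simp
              _ ≤ R * pairWeight U ^ 2 := by gcongr
          calc _ ≤ (R * pairWeight U ^ 2) * ‖V‖⁻¹ * kerMass d R * (R : ℝ) ^ d := by gcongr
            _ = _ := by ring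
  · rw [if_neg hpar, add_zero]
    have hex : ∃ j, V i * V' j - V j * V' i ≠ 0 := by
      by_contra! h
      exact hpar (par_of_minors hVi fun j => by linarith [h j])
    obtain ⟨j₁, hj₁⟩ := hex
    obtain ⟨j, -, hj⟩ := Finset.exists_max_image Finset.univ
      (fun j => |V i * V' j - V j * V' i|) ⟨j₁, Finset.mem_univ _⟩
    have hjne : V i * V' j - V j * V' i ≠ 0 := by
      have := hj j₁ (Finset.mem_univ _)
      exact abs_pos.mp ((abs_pos.mpr hj₁).trans_le this)
    have hji : j ≠ i := by
      rintro rfl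
      exact hjne (by ring)
    set D : ℤ := V i * V' j - V j * V' i with hD
    have hDR : (0 : ℝ) < |(D : ℝ)| := abs_pos.mpr (by exact_mod_cast hjne)
    have hUi0 : (U i : ℝ) ≠ 0 := by exact_mod_cast hU i
    have hUj0 : (U j : ℝ) ≠ 0 := by exact_mod_cast hU j
    have hVi0 : (V i : ℝ) ≠ 0 := by exact_mod_cast hVi
    have hdet : (U i : ℝ) * V i * ((U j : ℝ) * V' j) - (U j : ℝ) * V j * ((U i : ℝ) * V' i) =
        U i * U j * D := by rw [hD]; push_cast; ring
    have hmain := lintegral_mul_comp_dot_le (fun x => ENNReal.ofReal (kerCut ((R : ℝ) ^ d)⁻¹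
      ((R : ℝ) ^ 2) (2 * d * (R : ℝ) ^ 2) x)) (measurable_kerCut _ _ _).ennreal_ofReal
      (fun k => (U k : ℝ) * V k) (fun k => (U k : ℝ) * V' k) hji.symm
      (mul_ne_zero hUi0 hVi0) (by
        rw [hdet]
        exact mul_ne_zero (mul_ne_zero hUi0 hUj0) (by exact_mod_cast hjne))
    refine hmain.trans ?_
    rw [hdet]
    -- The inverse of the largest minor is spread evenly over all `d - 1` minors with the index `i`;
    -- this makes the later sum over `V'` factorise without having to know which minor is the
    -- largest.
    have hprod : |(D : ℝ)|⁻¹ ≤ ∏ j ∈ Finset.univ.erase i,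
        absOne (V i * V' j - V j * V' i) ^ (-(1 / ((d : ℝ) - 1))) := by
      have hd1 : (0 : ℝ) < (d : ℝ) - 1 := by
        have : (3 : ℝ) ≤ d := by exact_mod_cast hd
        linarith
      have e : |(D : ℝ)|⁻¹ = ∏ _j ∈ Finset.univ.erase i, |(D : ℝ)| ^ (-(1 / ((d : ℝ) - 1))) := by
        rw [Finset.prod_const, Finset.card_erase_of_mem (Finset.mem_univ i), Finset.card_univ,
          Fintype.card_fin, ← Real.rpow_natCast, ← Real.rpow_mul hDR.le, Nat.cast_sub (by omega),
          ← Real.rpow_neg_one]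
        congr 1
        push_cast
        field_simp
      rw [e]
      refine Finset.prod_le_prod (fun k _ => by positivity) fun k _ => ?_
      refine Real.rpow_le_rpow_of_nonpos (absOne_pos _) ?_ (by
        have : 0 < 1 / ((d : ℝ) - 1) := by positivity
        linarith)
      refine max_le ?_ ?_
      · exact_mod_cast Int.one_le_abs hjne
      · exact_mod_cast hj k (Finset.mem_univ k)
    calc _ ≤ ENNReal.ofReal |(U i : ℝ) * U j * D|⁻¹ * ENNReal.ofReal (kerMass d R) ^ 2 := by
          gcongr
          exact lintegral_kerCut_le_kerMass hR
      _ = ENNReal.ofReal (kerMass d R ^ 2 * (|(U i : ℝ)| * |(U j : ℝ)|)⁻¹ * |(D : ℝ)|⁻¹) := by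
          rw [← ENNReal.ofReal_pow hK, ← ENNReal.ofReal_mul (by positivity), abs_mul, abs_mul,
            mul_inv]
          congr 1
          ring
      _ ≤ _ := by
          refine ENNReal.ofReal_le_ofReal ?_
          have hw := pairWeight_sq_ge (U := U) hji
          rw [absOne_of_ne_zero (hU i), absOne_of_ne_zero (hU j)] at hw
          gcongr

open Classical in
/-- The contribution of a vector `U` without vanishing coordinates. -/
noncomputable def rowSum {d : ℕ} (R : ℕ) (β : Fin d → ℝ) (U : Label d) : ℝ :=
  ∑ V ∈ (box d R).filter (· ≠ 0), boxKer R β U V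

lemma rowSum_nonneg {d R : ℕ} (hR : 1 ≤ R) (β : Fin d → ℝ) (U : Label d) : 0 ≤ rowSum R β U :=
  Finset.sum_nonneg fun V _ => boxKer_nonneg hR β U V

/-- Expanding the square leads to pairs `V`, `V'`. Up to logarithms and the weight of `U`, the
nonparallel pairs give `R^4 · R^(d-1) · R^(d-1)` and the parallel ones `R^d · R · R² · R^(d-1)`:
both are `(R^(d+1))²`, with two logarithms each. -/
lemma lintegral_rowSum_sq_le {d : ℕ} (hd : 3 ≤ d) : ∃ C : ℝ, 0 < C ∧ ∀ R : ℕ, 1 ≤ R →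
    ∀ U ∈ box d R, (∀ i, U i ≠ 0) →
    ∫⁻ β, ENNReal.ofReal (rowSum R β U ^ 2) ∂(cubeMeasure d) ≤
      ENNReal.ofReal (C * ((1 + Real.log R) * (R : ℝ) ^ (d + 1) * pairWeight U) ^ 2) := by
  classical
  obtain ⟨C1, hC1, h1⟩ := sum_box_norm_rpow_le (d := d) (s := 1) (by norm_num)
    (by exact_mod_cast (by omega : 1 < d))
  obtain ⟨C2, hC2, h2⟩ := sum_box_parallel_le hd
  set c := 2 * (Real.log (1 + 2 * d) + d) with hc
  have hd0 : (0 : ℝ) ≤ d := Nat.cast_nonneg d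
  have hc0 : 0 ≤ c := by
    have : 0 ≤ Real.log (1 + 2 * (d : ℝ)) := Real.log_nonneg (by linarith)
    positivity
  refine ⟨c ^ 2 * (3 * 31 ^ (d - 1)) * C1 + c * C2 + 1, by positivity, fun R hR U hUb hU => ?_⟩
  have hRpos : (0 : ℝ) < R := by exact_mod_cast hR
  have hlog : 0 ≤ Real.log R := Real.log_nonneg (by exact_mod_cast hR)
  have hK := kerMass_nonneg (d := d) hR
  have hi : ∀ V : Label d, ∃ i, V ≠ 0 → |(V i : ℝ)| = ‖V‖ := fun V => by
    by_cases hV : V = 0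
    · exact ⟨⟨0, by omega⟩, fun h => (h hV).elim⟩
    · obtain ⟨i, hi⟩ := exists_abs_eq_norm hV
      exact ⟨i, fun _ => hi⟩
  choose ι hι using hi
  set P : Label d → Label d → ℝ := fun V V' => kerMass d R ^ 2 * pairWeight U ^ 2 *
    ∏ j ∈ Finset.univ.erase (ι V),
        absOne (V (ι V) * V' j - V j * V' (ι V)) ^ (-(1 / ((d : ℝ) - 1))) with hP
  have hP0 : ∀ V V', 0 ≤ P V V' := fun V V' =>
    mul_nonneg (by positivity) (Finset.prod_nonneg fun j _ => Real.rpow_nonneg (absOne_pos _).le _)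
  set B := (R : ℝ) ^ d * (R * pairWeight U ^ 2 * kerMass d R) with hB
  have hB0 : 0 ≤ B := by positivity
  set S := (box d R).filter (· ≠ 0) with hS
  calc _ = ∫⁻ β, ∑ V ∈ S, ∑ V' ∈ S, ENNReal.ofReal (boxKer R β U V) *
          ENNReal.ofReal (boxKer R β U V') ∂(cubeMeasure d) := by
        refine lintegral_congr fun β => ?_
        rw [rowSum, ENNReal.ofReal_pow (Finset.sum_nonneg fun V _ => boxKer_nonneg hR β U V),
          ENNReal.ofReal_sum_of_nonneg (fun V _ => boxKer_nonneg hR β U V), sq,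
          Finset.sum_mul_sum]
    _ = ∑ V ∈ S, ∑ V' ∈ S, ∫⁻ β, ENNReal.ofReal (boxKer R β U V) *
          ENNReal.ofReal (boxKer R β U V') ∂(cubeMeasure d) := by
        have hm : ∀ V V', Measurable fun β => ENNReal.ofReal (boxKer R β U V) *
            ENNReal.ofReal (boxKer R β U V') := fun V V' =>
          (measurable_boxKer R U V).mul (measurable_boxKer R U V')
        rw [lintegral_finsetSum _ fun V _ => Finset.measurable_sum _ fun V' _ => hm V V']
        exact Finset.sum_congr rfl fun V _ => lintegral_finsetSum _ fun V' _ => hm V V'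
    _ ≤ ∑ V ∈ S, ∑ V' ∈ box d R, (ENNReal.ofReal (P V V') +
          if Par V V' then ENNReal.ofReal (B * ‖V‖⁻¹) else 0) := by
        refine Finset.sum_le_sum fun V hV => ?_
        refine (Finset.sum_le_sum fun V' _ => ?_).trans
          (Finset.sum_le_sum_of_subset (Finset.filter_subset _ _))
        have hV0 := (Finset.mem_filter.mp hV).2
        convert lintegral_boxKer_mul_le hd hR hUb hU hV0 (hι V hV0) using 2
    _ = ENNReal.ofReal (∑ V ∈ S, ∑ V' ∈ box d R, P V V') +
          ENNReal.ofReal (∑ V ∈ S, ∑ _V' ∈ (box d R).filter (Par V), B * ‖V‖⁻¹) := by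
        simp only [Finset.sum_add_distrib]
        rw [ENNReal.ofReal_sum_of_nonneg fun V _ => Finset.sum_nonneg fun V' _ => hP0 V V',
          ENNReal.ofReal_sum_of_nonneg fun V _ => Finset.sum_nonneg fun V' _ => by positivity]
        congr 1
        · exact Finset.sum_congr rfl fun V _ =>
            (ENNReal.ofReal_sum_of_nonneg fun V' _ => hP0 V V').symm
        · refine Finset.sum_congr rfl fun V _ => ?_
          rw [← Finset.sum_filter, ENNReal.ofReal_sum_of_nonneg fun V' _ => by positivity]
    _ ≤ _ := by
        rw [← ENNReal.ofReal_add (Finset.sum_nonneg fun V _ => Finset.sum_nonneg fun V' _ =>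
          hP0 V V') (Finset.sum_nonneg fun V _ => Finset.sum_nonneg fun V' _ => by positivity)]
        refine ENNReal.ofReal_le_ofReal ?_
        have hA1 : ∑ V ∈ S, ∑ V' ∈ box d R, P V V' ≤ kerMass d R ^ 2 * pairWeight U ^ 2 *
            (3 * 31 ^ (d - 1) * (R : ℝ) ^ (d - 1) * (C1 * (R : ℝ) ^ (d - 1))) := by
          calc _ ≤ ∑ V ∈ S, kerMass d R ^ 2 * pairWeight U ^ 2 *
                (3 * 31 ^ (d - 1) * (R : ℝ) ^ (d - 1) * ‖V‖ ^ (-1 : ℝ)) := by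
                refine Finset.sum_le_sum fun V hV => ?_
                obtain ⟨hVb, hV0⟩ := Finset.mem_filter.mp hV
                simp only [hP]
                rw [← Finset.mul_sum, Real.rpow_neg_one]
                gcongr
                exact sum_box_minors_le hd hVb hV0 (hι V hV0)
            _ = kerMass d R ^ 2 * pairWeight U ^ 2 *
                (3 * 31 ^ (d - 1) * (R : ℝ) ^ (d - 1) * ∑ V ∈ S, ‖V‖ ^ (-1 : ℝ)) := by
                rw [Finset.mul_sum, Finset.mul_sum]
            _ ≤ _ := by
                gcongr
                have := h1 R hR
                rw [← Real.rpow_natCast, Nat.cast_sub (by omega)]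
                simpa using this
        have hA2 : ∑ V ∈ S, ∑ _V' ∈ (box d R).filter (Par V), B * ‖V‖⁻¹ ≤
            B * (C2 * (1 + Real.log R) * (R : ℝ) ^ (d - 1)) := by
          simp only [← Finset.mul_sum]
          gcongr
          exact h2 R hR
        have hRd : (R : ℝ) ^ d = R * (R : ℝ) ^ (d - 1) := by
          rw [← pow_succ']; congr 1; omega
        have hRd1 : (R : ℝ) ^ (d + 1) = (R : ℝ) ^ 2 * (R : ℝ) ^ (d - 1) := by
          rw [← pow_add]; congr 1; omega
        have hKe : kerMass d R = c * (1 + Real.log R) * (R : ℝ) ^ 2 := rfl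
        calc _ ≤ _ := add_le_add hA1 hA2
          _ = (c ^ 2 * (3 * 31 ^ (d - 1)) * C1 + c * C2) *
              ((1 + Real.log R) * (R : ℝ) ^ (d + 1) * pairWeight U) ^ 2 := by
              rw [hB, hRd1, hRd, hKe]; ring
          _ ≤ _ := mul_le_mul_of_nonneg_right (by linarith) (sq_nonneg _)

open Classical in
/-- The contribution of all `U` without vanishing coordinates. -/
noncomputable def fullSum {d : ℕ} (R : ℕ) (β : Fin d → ℝ) : ℝ :=
  ∑ U ∈ (box d R).filter (fun U => ∀ i, U i ≠ 0), rowSum R β U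

lemma measurable_rowSum {d : ℕ} (R : ℕ) (U : Label d) :
    Measurable fun β => rowSum R β U := by
  unfold rowSum
  refine Finset.measurable_sum _ fun V _ => ?_
  unfold boxKer form
  exact (measurable_kerCut _ _ _).comp (by fun_prop)

lemma measurable_fullSum {d : ℕ} (R : ℕ) : Measurable (fullSum (d := d) R) := by
  unfold fullSum
  exact Finset.measurable_sum _ fun U _ => measurable_rowSum R U

/-- Cauchy–Schwarz with the weights `pairWeight U`: the second moment of a row is of order
`pairWeight U ^ 2`, so both resulting sums are `∑ pairWeight U`, which is of order `R^(d-1)` without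
a further logarithm. -/
lemma lintegral_fullSum_sq_le {d : ℕ} (hd : 3 ≤ d) : ∃ C : ℝ, 0 < C ∧ ∀ R : ℕ, 1 ≤ R →
    ∫⁻ β : Fin d → ℝ, ENNReal.ofReal (fullSum R β ^ 2) ∂(cubeMeasure d) ≤
      ENNReal.ofReal (C * ((1 + Real.log R) * (R : ℝ) ^ (2 * d)) ^ 2) := by
  classical
  obtain ⟨C1, hC1, h1⟩ := lintegral_rowSum_sq_le hd
  obtain ⟨C2, hC2, h2⟩ := sum_box_pairWeight_le d
  refine ⟨C1 * C2 ^ 2, by positivity, fun R hR => ?_⟩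
  have hRpos : (0 : ℝ) < R := by exact_mod_cast hR
  have hlog : 0 ≤ Real.log R := Real.log_nonneg (by exact_mod_cast hR)
  set S := (box d R).filter (fun U => ∀ i, U i ≠ 0) with hS
  have hw : ∀ U : Label d, 0 < pairWeight U := pairWeight_pos (by omega)
  set w := ∑ U ∈ S, pairWeight U with hwdef
  have hw0 : 0 ≤ w := Finset.sum_nonneg fun U _ => (hw U).le
  have hwle : w ≤ C2 * (R : ℝ) ^ (d - 1) := by
    have := h2 R hR
    rw [← Real.rpow_natCast, Nat.cast_sub (by omega)]
    refine le_trans ?_ (by simpa using this)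
    exact Finset.sum_le_sum_of_subset_of_nonneg (Finset.filter_subset _ _) fun U _ _ => (hw U).le
  set A := C1 * ((1 + Real.log R) * (R : ℝ) ^ (d + 1)) ^ 2 with hA
  have hA0 : 0 ≤ A := by positivity
  have hpt : ∀ β : Fin d → ℝ, fullSum R β ^ 2 ≤
      w * ∑ U ∈ S, (pairWeight U)⁻¹ * rowSum R β U ^ 2 := by
    intro β
    rw [Finset.mul_sum, fullSum, ← hS, ← Finset.mul_sum]
    refine Finset.sum_sq_le_sum_mul_sum_of_sq_le_mul S (fun U _ => (hw U).le)
      (fun U _ => by have := hw U; positivity) fun U _ => le_of_eq ?_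
    have := (hw U).ne'
    field_simp
  calc _ ≤ ∫⁻ β, ENNReal.ofReal w * ∑ U ∈ S, ENNReal.ofReal (pairWeight U)⁻¹ *
          ENNReal.ofReal (rowSum R β U ^ 2) ∂(cubeMeasure d) := by
        refine lintegral_mono fun β => (ENNReal.ofReal_le_ofReal (hpt β)).trans (le_of_eq ?_)
        have h0 : ∀ U ∈ S, 0 ≤ (pairWeight U)⁻¹ * rowSum R β U ^ 2 := fun U _ => by
          have := hw U; positivity
        rw [ENNReal.ofReal_mul hw0, ENNReal.ofReal_sum_of_nonneg h0]
        congr 1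
        exact Finset.sum_congr rfl fun U _ => ENNReal.ofReal_mul (inv_nonneg.mpr (hw U).le)
    _ = ENNReal.ofReal w * ∑ U ∈ S, ENNReal.ofReal (pairWeight U)⁻¹ *
          ∫⁻ β, ENNReal.ofReal (rowSum R β U ^ 2) ∂(cubeMeasure d) := by
        have hm : ∀ U : Label d, Measurable fun β => ENNReal.ofReal (rowSum R β U ^ 2) := fun U =>
          ((measurable_rowSum R U).pow_const 2).ennreal_ofReal
        rw [lintegral_const_mul _ (Finset.measurable_sum _ fun U _ => (hm U).const_mul _),
          lintegral_finsetSum _ fun U _ => (hm U).const_mul _]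
        congr 1
        exact Finset.sum_congr rfl fun U _ => lintegral_const_mul _ (hm U)
    _ ≤ ENNReal.ofReal w * ∑ U ∈ S, ENNReal.ofReal (pairWeight U)⁻¹ *
          ENNReal.ofReal (A * pairWeight U ^ 2) := by
        gcongr with U hU
        obtain ⟨hUb, hU0⟩ := Finset.mem_filter.mp hU
        refine (h1 R hR U hUb hU0).trans (le_of_eq ?_)
        rw [hA]
        congr 1
        ring
    _ = ENNReal.ofReal (w * (A * w)) := by
        have h0 : ∀ U ∈ S, 0 ≤ A * pairWeight U := fun U _ => mul_nonneg hA0 (hw U).le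
        rw [ENNReal.ofReal_mul hw0, show A * w = ∑ U ∈ S, A * pairWeight U from
          Finset.mul_sum _ _ _, ENNReal.ofReal_sum_of_nonneg h0]
        congr 1
        refine Finset.sum_congr rfl fun U _ => ?_
        have := hw U
        rw [← ENNReal.ofReal_mul (by positivity)]
        congr 1
        field_simp
    _ ≤ _ := by
        refine ENNReal.ofReal_le_ofReal ?_
        have hRd : (R : ℝ) ^ (2 * d) = (R : ℝ) ^ (d + 1) * (R : ℝ) ^ (d - 1) := by
          rw [← pow_add]; congr 1; omega
        calc w * (A * w) = A * w ^ 2 := by ring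
          _ ≤ A * (C2 * (R : ℝ) ^ (d - 1)) ^ 2 := by gcongr
          _ = _ := by rw [hA, hRd]; ring

end FeynmanTree

namespace FeynmanTree

open scoped ENNReal

/-! ### Lattice sums of the resolvent -/

lemma ae_cubeMeasure_mem (d : ℕ) :
    ∀ᵐ β ∂(cubeMeasure d), ∀ k, β k ∈ Set.Icc (1 : ℝ) 2 := by
  rw [← cubeMeasure_eq]
  filter_upwards [ae_restrict_mem (MeasurableSet.univ_pi fun _ => measurableSet_Icc)] with β hβ k
  exact hβ k (Set.mem_univ k)

lemma abs_form_le {d R : ℕ} {β : Fin d → ℝ} (hβ : ∀ k, β k ∈ Set.Icc (1 : ℝ) 2) {U V : Label d}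
    (hU : U ∈ box d R) (hV : V ∈ box d R) : |form β U V| ≤ 2 * d * (R : ℝ) ^ 2 := by
  calc |form β U V| ≤ ∑ k, |β k * ((U k : ℝ) * V k)| := Finset.abs_sum_le_sum_abs _ _
    _ ≤ ∑ _k : Fin d, 2 * ((R : ℝ) * R) := by
        refine Finset.sum_le_sum fun k _ => ?_
        have h1 : |(U k : ℝ)| ≤ R := by exact_mod_cast mem_box.mp hU k
        have h2 : |(V k : ℝ)| ≤ R := by exact_mod_cast mem_box.mp hV k
        rw [abs_mul, abs_mul, abs_of_nonneg (by linarith [(hβ k).1])]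
        have := (hβ k).2
        gcongr
    _ = _ := by simp; ring

lemma boxKer_eq {d R : ℕ} {β : Fin d → ℝ} (hβ : ∀ k, β k ∈ Set.Icc (1 : ℝ) 2) {U V : Label d}
    (hU : U ∈ box d R) (hV : V ∈ box d R) :
    boxKer R β U V = (((R : ℝ) ^ d)⁻¹ + |form β U V| / (R : ℝ) ^ 2)⁻¹ :=
  if_pos (abs_form_le hβ hU hV)

open Classical in
-- For vectors with disjoint supports the form vanishes whatever `β` is, and the kernel takes its
-- maximal value `R^d`. The count factorises over the coordinates and shows that there are only
-- `O(R^d)` such pairs.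
lemma sum_box_disjoint_le {d R : ℕ} (hR : 1 ≤ R) :
    ∑ U ∈ box d R, ∑ V ∈ box d R, (if ∀ k, U k = 0 ∨ V k = 0 then (1 : ℝ) else 0) ≤
      (6 * R) ^ d := by
  have hR1 : (1 : ℝ) ≤ R := by exact_mod_cast hR
  have e : ∀ U V : Label d, (if ∀ k, U k = 0 ∨ V k = 0 then (1 : ℝ) else 0) =
      ∏ k, if U k = 0 ∨ V k = 0 then 1 else 0 := fun U V => by
    rw [Finset.prod_ite_zero]; simp
  simp only [e]
  rw [Finset.sum_congr rfl fun U _ =>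
    sum_box_prod (fun k n => if U k = 0 ∨ n = 0 then (1 : ℝ) else 0)]
  rw [sum_box_prod fun _ a => ∑ n ∈ Finset.Icc (-(R : ℤ)) R, if a = 0 ∨ n = 0 then (1 : ℝ) else 0,
    Finset.prod_const, Finset.card_univ, Fintype.card_fin]
  have hcard : ((Finset.Icc (-(R : ℤ)) R).card : ℝ) ≤ 3 * R := by
    have : (Finset.Icc (-(R : ℤ)) R).card = 2 * R + 1 := by
      have : ((R : ℤ) + 1 + R).toNat = 2 * R + 1 := by omega
      simp [this]
    rw [this]; push_cast; linarith
  have hmem : (0 : ℤ) ∈ Finset.Icc (-(R : ℤ)) R := by simp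
  refine pow_le_pow_left₀ (Finset.sum_nonneg fun _ _ => Finset.sum_nonneg fun _ _ => by
    split_ifs <;> norm_num) ?_ d
  calc _ ≤ ∑ a ∈ Finset.Icc (-(R : ℤ)) R, ∑ n ∈ Finset.Icc (-(R : ℤ)) R,
        ((if a = 0 then (1 : ℝ) else 0) + if n = 0 then 1 else 0) := by
        refine Finset.sum_le_sum fun a _ => Finset.sum_le_sum fun n _ => ?_
        by_cases ha : a = 0 <;> by_cases hn : n = 0 <;> simp [ha, hn]
    _ = 2 * (Finset.Icc (-(R : ℤ)) R).card := by
        simp only [Finset.sum_add_distrib, Finset.sum_ite_eq', if_pos hmem, Finset.sum_const,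
          nsmul_eq_mul]
        rw [← Finset.mul_sum, Finset.sum_ite_eq', if_pos hmem]
        ring
    _ ≤ _ := by linarith

open Classical in
-- The pairs are sorted into those with disjoint supports, those with a common nonzero coordinate
-- but some `U j = 0`, and those where `U` has no vanishing coordinate.
lemma sum_ker_le {d R : ℕ} (hR : 1 ≤ R) {β : Fin d → ℝ} (hβ : ∀ k, β k ∈ Set.Icc (1 : ℝ) 2) :
    ∑ U ∈ (box d R).filter (· ≠ 0), ∑ V ∈ (box d R).filter (· ≠ 0),
      ENNReal.ofReal ((((R : ℝ) ^ d)⁻¹ + |form β U V| / (R : ℝ) ^ 2)⁻¹) ≤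
      ENNReal.ofReal (6 ^ d * (R : ℝ) ^ (2 * d)) + thinSum R β + ENNReal.ofReal (fullSum R β) := by
  have h1 : ∀ U ∈ (box d R).filter (· ≠ 0), ∀ V ∈ (box d R).filter (· ≠ 0),
      ENNReal.ofReal ((((R : ℝ) ^ d)⁻¹ + |form β U V| / (R : ℝ) ^ 2)⁻¹) ≤
      ENNReal.ofReal ((R : ℝ) ^ d * if ∀ k, U k = 0 ∨ V k = 0 then (1 : ℝ) else 0) +
      (if (∃ j, U j = 0) ∧ ∃ i, U i ≠ 0 ∧ V i ≠ 0 then ENNReal.ofReal (boxKer R β U V) else 0) +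
      (if ∀ i, U i ≠ 0 then ENNReal.ofReal (boxKer R β U V) else 0) := by
    intro U hU V hV
    rw [← boxKer_eq hβ (Finset.mem_filter.mp hU).1 (Finset.mem_filter.mp hV).1]
    by_cases hz : ∀ k, U k = 0 ∨ V k = 0
    · rw [if_pos hz, mul_one]
      exact (ENNReal.ofReal_le_ofReal (boxKer_le hR β U V)).trans
        (le_self_add.trans le_self_add)
    · push Not at hz
      by_cases hf : ∀ i, U i ≠ 0
      · rw [if_pos hf]; exact le_add_self
      · push Not at hf
        rw [if_pos (show (∃ j, U j = 0) ∧ ∃ i, U i ≠ 0 ∧ V i ≠ 0 from ⟨hf, hz⟩)]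
        exact le_add_self.trans le_self_add
  refine (Finset.sum_le_sum fun U hU => Finset.sum_le_sum fun V hV => h1 U hU V hV).trans ?_
  simp only [Finset.sum_add_distrib]
  refine add_le_add (add_le_add ?_ ?_) ?_
  · have hnn : ∀ U V : Label d, (0 : ℝ) ≤ (R : ℝ) ^ d *
        if ∀ k, U k = 0 ∨ V k = 0 then (1 : ℝ) else 0 := fun U V => by
      split_ifs <;> positivity
    calc _ ≤ ∑ U ∈ box d R, ∑ V ∈ box d R,
          ENNReal.ofReal ((R : ℝ) ^ d * if ∀ k, U k = 0 ∨ V k = 0 then (1 : ℝ) else 0) :=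
          (Finset.sum_le_sum fun U _ =>
            Finset.sum_le_sum_of_subset (Finset.filter_subset _ _)).trans
            (Finset.sum_le_sum_of_subset (Finset.filter_subset _ _))
      _ = ENNReal.ofReal ((R : ℝ) ^ d * ∑ U ∈ box d R, ∑ V ∈ box d R,
            if ∀ k, U k = 0 ∨ V k = 0 then (1 : ℝ) else 0) := by
          simp only [Finset.mul_sum]
          rw [ENNReal.ofReal_sum_of_nonneg fun U _ => Finset.sum_nonneg fun V _ => hnn U V]
          exact Finset.sum_congr rfl fun U _ =>
            (ENNReal.ofReal_sum_of_nonneg fun V _ => hnn U V).symm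
      _ ≤ _ := by
          refine ENNReal.ofReal_le_ofReal ?_
          calc _ ≤ (R : ℝ) ^ d * (6 * R) ^ d := by
                gcongr
                exact sum_box_disjoint_le hR
            _ = _ := by rw [mul_pow, two_mul, pow_add]; ring
  · exact (Finset.sum_le_sum fun U _ =>
      Finset.sum_le_sum_of_subset (Finset.filter_subset _ _)).trans
        (Finset.sum_le_sum_of_subset (Finset.filter_subset _ _))
  · rw [fullSum, ENNReal.ofReal_sum_of_nonneg fun U _ => rowSum_nonneg hR β U,
      Finset.sum_filter (fun U : Label d => ∀ i, U i ≠ 0)]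
    refine le_trans (Finset.sum_le_sum_of_subset (Finset.filter_subset _ _)) ?_
    refine Finset.sum_le_sum fun U _ => ?_
    split_ifs
    · rw [rowSum, ENNReal.ofReal_sum_of_nonneg fun V _ => boxKer_nonneg hR β U V]
    · simp

/-- Almost every `β` admits the optimal bound, up to logarithms, at the scale `R⁻ᵈ`. -/
lemma ae_sum_ker_le {d : ℕ} (hd : 3 ≤ d) : ∀ᵐ β ∂(cubeMeasure d), ∃ C : ℝ, 0 < C ∧
    ∀ m : ℕ, 1 ≤ m → (open Classical in
      ∑ U ∈ (box d (2 ^ m)).filter (· ≠ 0), ∑ V ∈ (box d (2 ^ m)).filter (· ≠ 0),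
      ENNReal.ofReal (((((2 ^ m : ℕ) : ℝ) ^ d)⁻¹ + |form β U V| / ((2 ^ m : ℕ) : ℝ) ^ 2)⁻¹)) ≤
      ENNReal.ofReal (C * (m : ℝ) ^ 2 * ((2 ^ m : ℕ) : ℝ) ^ (2 * d)) := by
  obtain ⟨C1, hC1, h1⟩ := lintegral_thinSum_le d
  obtain ⟨C2, hC2, h2⟩ := lintegral_fullSum_sq_le hd
  -- The scale is shifted by one, so that `m + 1`, which is comparable to `1 + log R`, never
  -- vanishes in a denominator.
  set R : ℕ → ℕ := fun m => 2 ^ (m + 1) with hRdef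
  have hR : ∀ m, 1 ≤ R m := fun m => Nat.one_le_two_pow
  have hRpos : ∀ m, (0 : ℝ) < R m := fun m => by exact_mod_cast hR m
  have hlog : ∀ m, 1 + Real.log (R m) ≤ 2 * ((m : ℝ) + 1) := fun m => by
    simp only [hRdef]
    push_cast
    rw [Real.log_pow]
    push_cast
    have := Real.log_two_lt_d9
    nlinarith [(Nat.cast_nonneg m : (0 : ℝ) ≤ m)]
  have hlog0 : ∀ m, 0 ≤ 1 + Real.log (R m) := fun m => by
    have := Real.log_nonneg (show (1 : ℝ) ≤ R m by exact_mod_cast hR m)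
    linarith
  -- The two parts are normalised so that their expectations are summable in `m`: the first is
  -- geometrically small, and the second is of order `(m+1)² / (m+1)⁴`. Finiteness of the sum for
  -- almost every `β` then bounds all scales at once.
  set H : ℕ → (Fin d → ℝ) → ℝ≥0∞ := fun m β =>
    thinSum (R m) β * ENNReal.ofReal (((R m : ℝ) ^ (2 * d))⁻¹) +
    ENNReal.ofReal (fullSum (R m) β ^ 2) *
      ENNReal.ofReal ((((m : ℝ) + 1) ^ 2 * (R m : ℝ) ^ (2 * d)) ^ 2)⁻¹ with hH
  have hm1 : ∀ m, Measurable fun β : Fin d → ℝ =>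
      thinSum (R m) β * ENNReal.ofReal (((R m : ℝ) ^ (2 * d))⁻¹) := fun m =>
    (measurable_thinSum _).mul_const _
  have hm2 : ∀ m, Measurable fun β : Fin d → ℝ => ENNReal.ofReal (fullSum (R m) β ^ 2) *
      ENNReal.ofReal ((((m : ℝ) + 1) ^ 2 * (R m : ℝ) ^ (2 * d)) ^ 2)⁻¹ := fun m =>
    ((measurable_fullSum _).pow_const 2).ennreal_ofReal.mul_const _
  have hHm : ∀ m, Measurable (H m) := fun m => (hm1 m).add (hm2 m)
  set r : ℝ := (2 : ℝ) ^ (-(1 / 4) : ℝ) with hr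
  have hr0 : 0 ≤ r := by positivity
  have hr1 : r < 1 := Real.rpow_lt_one_of_one_lt_of_neg (by norm_num) (by norm_num)
  set b : ℕ → ℝ := fun m => 2 * C1 * (((m + 1 : ℕ) : ℝ) ^ 1 * r ^ (m + 1)) +
    4 * C2 * (1 / ((m + 1 : ℕ) : ℝ) ^ 2) with hb
  have hbsum : Summable b := by
    refine Summable.add (Summable.mul_left _ ?_) (Summable.mul_left _ ?_)
    · exact (summable_nat_add_iff (f := fun m : ℕ => (m : ℝ) ^ 1 * r ^ m) 1).mpr
        (summable_pow_mul_geometric_of_norm_lt_one 1 (by rwa [Real.norm_of_nonneg hr0]))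
    · exact (summable_nat_add_iff (f := fun m : ℕ => 1 / (m : ℝ) ^ 2) 1).mpr
        (Real.summable_one_div_nat_pow.mpr (by norm_num))
  have hHint : ∀ m, ∫⁻ β, H m β ∂(cubeMeasure d) ≤ ENNReal.ofReal (b m) := by
    intro m
    have hp := hRpos m
    simp only [hH]
    rw [lintegral_add_left (hm1 m), lintegral_mul_const _ (measurable_thinSum _),
      lintegral_mul_const _ ((measurable_fullSum _).pow_const 2).ennreal_ofReal, hb,
      ENNReal.ofReal_add (by positivity) (by positivity)]
    refine add_le_add ?_ ?_
    · refine (mul_le_mul_left (h1 (R m) (hR m)) _).trans ?_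
      rw [← ENNReal.ofReal_mul (mul_nonneg (mul_nonneg hC1.le (hlog0 m)) (by positivity))]
      refine ENNReal.ofReal_le_ofReal ?_
      have e : (R m : ℝ) ^ (2 * (d : ℝ) - 1 / 4) * ((R m : ℝ) ^ (2 * d))⁻¹ = r ^ (m + 1) := by
        rw [← Real.rpow_natCast (R m : ℝ), ← Real.rpow_neg hp.le, ← Real.rpow_add hp, hr,
          ← Real.rpow_natCast, ← Real.rpow_mul (by norm_num)]
        simp only [hRdef]
        push_cast
        rw [← Real.rpow_natCast, ← Real.rpow_mul (by norm_num)]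
        congr 1
        push_cast
        ring
      rw [mul_assoc, e]
      have := hlog m
      have : C1 * (1 + Real.log (R m)) ≤ C1 * (2 * ((m : ℝ) + 1)) := by gcongr
      push_cast
      nlinarith [pow_nonneg hr0 (m + 1)]
    · refine (mul_le_mul_left (h2 (R m) (hR m)) _).trans ?_
      rw [← ENNReal.ofReal_mul (by positivity)]
      refine ENNReal.ofReal_le_ofReal ?_
      have hl := hlog m
      have hl0 := hlog0 m
      have : (0 : ℝ) < (m : ℝ) + 1 := by positivity
      rw [← div_eq_mul_inv, div_le_iff₀ (by positivity)]
      calc _ ≤ C2 * ((2 * ((m : ℝ) + 1)) * (R m : ℝ) ^ (2 * d)) ^ 2 := by gcongr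
        _ = _ := by push_cast; field_simp; ring
  have hfin : ∫⁻ β, ∑' m, H m β ∂(cubeMeasure d) ≠ ⊤ := by
    rw [lintegral_tsum fun m => (hHm m).aemeasurable]
    exact ne_top_of_le_ne_top hbsum.tsum_ofReal_ne_top (ENNReal.tsum_le_tsum hHint)
  filter_upwards [ae_lt_top (Measurable.tsum hHm) hfin, ae_cubeMeasure_mem d] with β hβ hβ'
  set h := (∑' m, H m β).toReal with hh
  have hh0 : 0 ≤ h := ENNReal.toReal_nonneg
  have hHle : ∀ m, H m β ≤ ENNReal.ofReal h := fun m => by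
    rw [hh, ENNReal.ofReal_toReal hβ.ne]; exact ENNReal.le_tsum m
  refine ⟨6 ^ d + h + √h, by positivity, fun m hm => ?_⟩
  obtain ⟨n, rfl⟩ : ∃ n, m = n + 1 := ⟨m - 1, by omega⟩
  have hp := hRpos n
  refine (sum_ker_le (hR n) hβ').trans ?_
  have hn1 : (1 : ℝ) ≤ ((n : ℝ) + 1) ^ 2 := by
    have := (Nat.cast_nonneg n : (0 : ℝ) ≤ n); nlinarith
  have hthin : thinSum (R n) β ≤ ENNReal.ofReal (h * (R n : ℝ) ^ (2 * d)) := by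
    have h3 : thinSum (R n) β * ENNReal.ofReal (((R n : ℝ) ^ (2 * d))⁻¹) ≤ ENNReal.ofReal h :=
      le_self_add.trans (hHle n)
    calc thinSum (R n) β = thinSum (R n) β * ENNReal.ofReal (((R n : ℝ) ^ (2 * d))⁻¹) *
          ENNReal.ofReal ((R n : ℝ) ^ (2 * d)) := by
          rw [mul_assoc, ← ENNReal.ofReal_mul (by positivity), inv_mul_cancel₀ (by positivity)]
          simp
      _ ≤ _ := by
          rw [ENNReal.ofReal_mul hh0]
          gcongr
  -- Taking the root of the second moment bound turns `h` into `√h`; the loss over `R^(2d)` is the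
  -- square of the scale index, which later becomes `log²(2 + t)`.
  have hfull : fullSum (R n) β ≤ √h * (((n : ℝ) + 1) ^ 2 * (R n : ℝ) ^ (2 * d)) := by
    have h3 : ENNReal.ofReal (fullSum (R n) β ^ 2) *
      ENNReal.ofReal ((((n : ℝ) + 1) ^ 2 * (R n : ℝ) ^ (2 * d)) ^ 2)⁻¹ ≤ ENNReal.ofReal h :=
      le_add_self.trans (hHle n)
    rw [← ENNReal.ofReal_mul (sq_nonneg _), ENNReal.ofReal_le_ofReal_iff hh0,
      ← div_eq_mul_inv, ← div_pow] at h3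
    have h4 := Real.le_sqrt_of_sq_le h3
    rwa [div_le_iff₀ (by positivity)] at h4
  calc _ ≤ ENNReal.ofReal (6 ^ d * (R n : ℝ) ^ (2 * d)) +
        ENNReal.ofReal (h * (R n : ℝ) ^ (2 * d)) +
        ENNReal.ofReal (√h * (((n : ℝ) + 1) ^ 2 * (R n : ℝ) ^ (2 * d))) := by
        gcongr
    _ = ENNReal.ofReal (6 ^ d * (R n : ℝ) ^ (2 * d) + h * (R n : ℝ) ^ (2 * d) +
        √h * (((n : ℝ) + 1) ^ 2 * (R n : ℝ) ^ (2 * d))) := by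
        rw [ENNReal.ofReal_add (by positivity) (by positivity),
          ENNReal.ofReal_add (by positivity) (by positivity)]
    _ ≤ _ := by
        refine ENNReal.ofReal_le_ofReal ?_
        have hA : 0 ≤ (6 ^ d + h) * (R n : ℝ) ^ (2 * d) := by positivity
        have := mul_le_mul_of_nonneg_right hn1 hA
        have e : ((2 ^ (n + 1) : ℕ) : ℝ) = R n := rfl
        rw [e]
        push_cast
        nlinarith

end FeynmanTree

/-! ### Genericity of the parameters and weighted sums of the resolvent -/

namespace FeynmanTree

open scoped ENNReal

/-- The number of dyadic scales below `t`. -/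
noncomputable def scales (t : ℝ) : ℕ := Nat.log 2 ⌊t⌋₊ + 1

lemma log_two_add_ge {t : ℝ} (ht : 0 < t) : 1 / 2 ≤ Real.log (2 + t) := by
  have h := Real.log_two_gt_d9
  have : Real.log 2 ≤ Real.log (2 + t) := Real.log_le_log (by norm_num) (by linarith)
  linarith

lemma scales_le {t : ℝ} (ht : 0 < t) : (scales t : ℝ) ≤ 4 * Real.log (2 + t) := by
  have h2 := Real.log_two_gt_d9
  have h3 := log_two_add_ge ht
  have hle : Real.log 2 ≤ Real.log (2 + t) := Real.log_le_log (by norm_num) (by linarith)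
  have hk : (Nat.log 2 ⌊t⌋₊ : ℝ) * Real.log 2 ≤ Real.log (2 + t) := by
    rcases Nat.eq_zero_or_pos ⌊t⌋₊ with h0 | h0
    · simp [h0]; linarith
    · rw [← Real.log_pow]
      refine Real.log_le_log (by positivity) ?_
      have h4 : 2 ^ Nat.log 2 ⌊t⌋₊ ≤ ⌊t⌋₊ := Nat.pow_log_le_self 2 h0.ne'
      have h5 : ((2 ^ Nat.log 2 ⌊t⌋₊ : ℕ) : ℝ) ≤ ⌊t⌋₊ := by exact_mod_cast h4
      push_cast at h5
      have := Nat.floor_le ht.le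
      linarith
  unfold scales
  push_cast
  nlinarith [(Nat.cast_nonneg (Nat.log 2 ⌊t⌋₊) : (0 : ℝ) ≤ _)]

lemma two_pow_le_of_lt_scales {t : ℝ} (ht : 0 < t) {j : ℕ} (hj : j < scales t) :
    (2 : ℝ) ^ j ≤ max 1 t := by
  unfold scales at hj
  rcases Nat.eq_zero_or_pos ⌊t⌋₊ with h0 | h0
  · rw [h0] at hj
    have : j = 0 := by simpa using hj
    simp [this]
  · refine le_max_of_le_right ?_
    have h4 : 2 ^ Nat.log 2 ⌊t⌋₊ ≤ ⌊t⌋₊ := Nat.pow_log_le_self 2 h0.ne'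
    have h6 : 2 ^ j ≤ 2 ^ Nat.log 2 ⌊t⌋₊ := Nat.pow_le_pow_right (by norm_num) (by omega)
    have h5 : ((2 ^ j : ℕ) : ℝ) ≤ ⌊t⌋₊ := by exact_mod_cast h6.trans h4
    push_cast at h5
    exact h5.trans (Nat.floor_le ht.le)

open Classical in
-- A kernel value `v` in `[2^j, 2^(j+1))` forces `|x| ≤ s / v ≤ s / 2^j`, and `v ≤ t` limits the
-- number of scales. This reduces sums of the kernel to counting points in slabs.
lemma ker_le_sum_scales {t s x : ℝ} (ht : 0 < t) (hs : 0 < s) :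
    (t⁻¹ + |x| / s)⁻¹ ≤
      1 + ∑ j ∈ Finset.range (scales t), (2 : ℝ) ^ (j + 1) * if |x| ≤ s / 2 ^ j then 1 else 0 := by
  set v := (t⁻¹ + |x| / s)⁻¹ with hv
  have hxs : 0 ≤ |x| / s := by positivity
  have hti : 0 < t⁻¹ := inv_pos.mpr ht
  have hvpos : 0 < v := by positivity
  have hnn : ∀ j ∈ Finset.range (scales t),
      (0 : ℝ) ≤ (2 : ℝ) ^ (j + 1) * if |x| ≤ s / 2 ^ j then 1 else 0 := fun j _ => by
    split_ifs <;> positivity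
  rcases le_or_gt v 1 with h1 | h1
  · linarith [Finset.sum_nonneg hnn]
  obtain ⟨j, hj, hj'⟩ := exists_nat_pow_near h1.le (one_lt_two : (1 : ℝ) < 2)
  have hvt : v ≤ t := by
    rw [hv, inv_le_comm₀ (by positivity) ht]; linarith
  have hxv : |x| ≤ s / v := by
    rw [hv, div_inv_eq_mul, mul_add, mul_div_cancel₀ _ hs.ne']
    have : 0 < s * t⁻¹ := by positivity
    linarith
  have hxj : |x| ≤ s / 2 ^ j := hxv.trans (by gcongr)
  have hjs : j ∈ Finset.range (scales t) := by
    rw [Finset.mem_range, scales, Nat.lt_succ_iff]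
    refine Nat.le_log_of_pow_le (by norm_num) (Nat.le_floor ?_)
    push_cast
    linarith
  have := Finset.single_le_sum hnn hjs
  rw [if_pos hxj, mul_one] at this
  linarith

lemma card_progression_le (s : Finset ℤ) {a c X A : ℝ} (hA : 0 < A) (ha : A ≤ |a|) (hX : 0 ≤ X)
    (h : ∀ n ∈ s, |a * n + c| ≤ X) : (s.card : ℝ) ≤ 1 + 2 * X / A := by
  rcases s.eq_empty_or_nonempty with rfl | hne
  · simp; positivity
  have hsub : s ⊆ Finset.Icc (s.min' hne) (s.max' hne) := fun n hn =>
    Finset.mem_Icc.mpr ⟨s.min'_le n hn, s.le_max' n hn⟩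
  have hcard := Finset.card_le_card hsub
  rw [Int.card_Icc] at hcard
  have hmm : s.min' hne ≤ s.max' hne := s.min'_le _ (s.max'_mem hne)
  have h1 := h _ (s.min'_mem hne)
  have h2 := h _ (s.max'_mem hne)
  set p := s.min' hne
  set q := s.max' hne
  have h3 : |a| * ((q : ℝ) - p) ≤ 2 * X := by
    have hpq : (0 : ℝ) ≤ (q : ℝ) - p := by
      have : (p : ℝ) ≤ q := by exact_mod_cast hmm
      linarith
    calc |a| * ((q : ℝ) - p) = |(a * q + c) - (a * p + c)| := by
          nth_rewrite 1 [← abs_of_nonneg hpq]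
          rw [← abs_mul]; congr 1; ring
      _ ≤ |a * q + c| + |a * p + c| := abs_sub _ _
      _ ≤ _ := by linarith
  have h4 : (q : ℝ) - p ≤ 2 * X / A := by
    rw [le_div_iff₀ hA]
    have hpq : (0 : ℝ) ≤ (q : ℝ) - p := by
      have : (p : ℝ) ≤ q := by exact_mod_cast hmm
      linarith
    nlinarith
  have h5 : (s.card : ℝ) ≤ (q + 1 - p : ℤ) := by
    have : (s.card : ℤ) ≤ q + 1 - p := by omega
    exact_mod_cast this
  push_cast at h5
  linarith

lemma form_update_right {d : ℕ} (β : Fin d → ℝ) (U V : Label d) (i : Fin d) :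
    form β U V = β i * U i * V i + ∑ k ∈ Finset.univ.erase i, β k * ((U k : ℝ) * V k) := by
  rw [form, ← Finset.add_sum_erase _ _ (Finset.mem_univ i)]
  ring

open Classical in
-- Freezing all coordinates of `V` except one where `|U i|` is largest, the form becomes affine in
-- `V i` with slope at least `‖U‖`, so each fibre has at most `1 + 2X/‖U‖` points.
lemma card_slab_le {d R : ℕ} (hR : 1 ≤ R) {β : Fin d → ℝ}
    (hβ : ∀ k, β k ∈ Set.Icc (1 : ℝ) 2) {U : Label d} (hU : U ≠ 0) {X : ℝ} (hX : 0 ≤ X) :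
    (((box d R).filter fun V => |form β U V| ≤ X).card : ℝ) ≤
      (3 * R) ^ (d - 1) * (1 + 2 * X / ‖U‖) := by
  have hR1 : (1 : ℝ) ≤ R := by exact_mod_cast hR
  obtain ⟨i, hi⟩ := exists_abs_eq_norm hU
  have hUpos : 0 < ‖U‖ := by linarith [one_le_norm hU]
  set T : Finset (Label d) :=
    Fintype.piFinset fun k => if k = i then {0} else Finset.Icc (-(R : ℤ)) R with hT
  have hTcard : (T.card : ℝ) ≤ (3 * R) ^ (d - 1) := by
    rw [hT, Fintype.card_piFinset, ← Finset.mul_prod_erase _ _ (Finset.mem_univ i), if_pos rfl,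
      Finset.card_singleton, one_mul]
    have : ∀ k ∈ Finset.univ.erase i, (if k = i then ({0} : Finset ℤ)
        else Finset.Icc (-(R : ℤ)) R).card = 2 * R + 1 := by
      intro k hk
      rw [if_neg (Finset.ne_of_mem_erase hk)]
      have : ((R : ℤ) + 1 + R).toNat = 2 * R + 1 := by omega
      simp [this]
    rw [Finset.prod_congr rfl this, Finset.prod_const, Finset.card_erase_of_mem
      (Finset.mem_univ i), Finset.card_univ, Fintype.card_fin]
    push_cast
    gcongr
    linarith
  have hmaps : ∀ V ∈ (box d R).filter fun V => |form β U V| ≤ X, Function.update V i 0 ∈ T := by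
    intro V hV
    rw [hT, Fintype.mem_piFinset]
    intro k
    by_cases hk : k = i
    · subst hk; simp
    · rw [Function.update_of_ne hk, if_neg hk]
      exact Fintype.mem_piFinset.mp (Finset.mem_filter.mp hV).1 k
  rw [Finset.card_eq_sum_card_fiberwise (f := fun V => Function.update V i 0) hmaps]
  push_cast
  calc _ ≤ ∑ _W ∈ T, (1 + 2 * X / ‖U‖) := by
        refine Finset.sum_le_sum fun W _ => ?_
        set F := ((box d R).filter fun V => |form β U V| ≤ X).filter
          (fun V => Function.update V i 0 = W) with hF
        have hinj : Set.InjOn (fun V : Label d => V i) F := by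
          intro V hV V' hV' hVV
          have e1 := (Finset.mem_filter.mp hV).2
          have e2 := (Finset.mem_filter.mp hV').2
          funext k
          by_cases hk : k = i
          · subst hk; exact hVV
          · have := congrFun (e1.trans e2.symm) k
            rwa [Function.update_of_ne hk, Function.update_of_ne hk] at this
        rw [← Finset.card_image_of_injOn hinj]
        refine card_progression_le _ (a := β i * U i)
          (c := ∑ k ∈ Finset.univ.erase i, β k * ((U k : ℝ) * W k)) hUpos ?_ hX ?_
        · rw [abs_mul, hi, abs_of_nonneg (by linarith [(hβ i).1])]
          nlinarith [(hβ i).1]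
        · intro n hn
          obtain ⟨V, hV, rfl⟩ := Finset.mem_image.mp hn
          obtain ⟨hV1, hV2⟩ := Finset.mem_filter.mp hV
          have h3 := (Finset.mem_filter.mp hV1).2
          rw [form_update_right β U V i] at h3
          convert h3 using 3
          refine Finset.sum_congr rfl fun k hk => ?_
          rw [← hV2, Function.update_of_ne (Finset.ne_of_mem_erase hk)]
    _ = T.card * (1 + 2 * X / ‖U‖) := by rw [Finset.sum_const, nsmul_eq_mul]
    _ ≤ _ := by gcongr

open Classical in
-- For `t ≤ R` no averaging over `β` is required: the relevant slabs are wide enough to contain the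
-- expected number of points, so each of the `O(log(2 + t))` scales contributes `R^(d+1) / ‖U‖`.
lemma sum_ker_le_of_le {d : ℕ} (hd : 3 ≤ d) : ∃ C : ℝ, 0 < C ∧ ∀ R : ℕ, 1 ≤ R →
    ∀ β : Fin d → ℝ, (∀ k, β k ∈ Set.Icc (1 : ℝ) 2) → ∀ t : ℝ, 0 < t → t ≤ R →
    ∑ U ∈ (box d R).filter (· ≠ 0), ∑ V ∈ (box d R).filter (· ≠ 0),
      (t⁻¹ + |form β U V| / (R : ℝ) ^ 2)⁻¹ ≤ C * (R : ℝ) ^ (2 * d) * Real.log (2 + t) := by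
  obtain ⟨C1, hC1, h1⟩ := sum_box_norm_rpow_le (d := d) (s := 1) (by norm_num)
    (by exact_mod_cast (by omega : 1 < d))
  refine ⟨3 ^ d * 26 * C1, by positivity, fun R hR β hβ t ht htR => ?_⟩
  have hR1 : (1 : ℝ) ≤ R := by exact_mod_cast hR
  have hRpos : (0 : ℝ) < R := by linarith
  have hlog := log_two_add_ge ht
  have hRd : (R : ℝ) ^ d = R * (R : ℝ) ^ (d - 1) := by rw [← pow_succ']; congr 1; omega
  have h3d : (3 : ℝ) ^ d = 3 * (3 : ℝ) ^ (d - 1) := by rw [← pow_succ']; congr 1; omega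
  have hrow : ∀ U ∈ (box d R).filter (· ≠ 0), ∑ V ∈ (box d R).filter (· ≠ 0),
      (t⁻¹ + |form β U V| / (R : ℝ) ^ 2)⁻¹ ≤
        3 ^ d * 26 * Real.log (2 + t) * ((R : ℝ) ^ (d + 1)) * ‖U‖ ^ (-1 : ℝ) := by
    intro U hU
    obtain ⟨hUb, hU0⟩ := Finset.mem_filter.mp hU
    have hUpos : 0 < ‖U‖ := by linarith [one_le_norm hU0]
    have hUR : ‖U‖ ≤ R := mem_box_iff_norm.mp hUb
    have hq : 1 ≤ R / ‖U‖ := by rw [le_div_iff₀ hUpos]; linarith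
    have hcount : ∀ j ∈ Finset.range (scales t), (2 : ℝ) ^ (j + 1) *
        (((box d R).filter fun V => |form β U V| ≤ (R : ℝ) ^ 2 / 2 ^ j).card : ℝ) ≤
        6 * 3 ^ (d - 1) * (R : ℝ) ^ (d + 1) / ‖U‖ := by
      intro j hj
      have h2j : (2 : ℝ) ^ j ≤ R := (two_pow_le_of_lt_scales ht (Finset.mem_range.mp hj)).trans
        (max_le hR1 htR)
      -- Since `2^j ≤ R`, the slab width dominates `‖U‖`, and the 1 in the slab count is absorbed by
      -- the main term.
      have hX : ‖U‖ ≤ (R : ℝ) ^ 2 / 2 ^ j := by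
        rw [le_div_iff₀ (by positivity)]
        calc ‖U‖ * 2 ^ j ≤ R * R := by gcongr
          _ = _ := by ring
      have hX1 : 1 ≤ (R : ℝ) ^ 2 / 2 ^ j / ‖U‖ := by rw [le_div_iff₀ hUpos]; linarith
      calc _ ≤ (2 : ℝ) ^ (j + 1) * ((3 * R) ^ (d - 1) * (1 + 2 * ((R : ℝ) ^ 2 / 2 ^ j) / ‖U‖)) := by
            gcongr
            exact card_slab_le hR hβ hU0 (by positivity)
        _ ≤ (2 : ℝ) ^ (j + 1) * ((3 * R) ^ (d - 1) * (3 * ((R : ℝ) ^ 2 / 2 ^ j / ‖U‖))) := by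
            gcongr
            rw [mul_div_assoc]
            linarith
        _ = _ := by
            have : (R : ℝ) ^ (d + 1) = (R : ℝ) ^ 2 * (R : ℝ) ^ (d - 1) := by
              rw [← pow_add]; congr 1; omega
            rw [this, mul_pow, pow_succ]
            field_simp
            ring
    calc _ ≤ ∑ V ∈ box d R, (t⁻¹ + |form β U V| / (R : ℝ) ^ 2)⁻¹ :=
          Finset.sum_le_sum_of_subset_of_nonneg (Finset.filter_subset _ _) fun V _ _ => by positivity
      _ ≤ ∑ V ∈ box d R, (1 + ∑ j ∈ Finset.range (scales t), (2 : ℝ) ^ (j + 1) *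
            if |form β U V| ≤ (R : ℝ) ^ 2 / 2 ^ j then 1 else 0) :=
          Finset.sum_le_sum fun V _ => ker_le_sum_scales ht (by positivity)
      _ = (box d R).card + ∑ j ∈ Finset.range (scales t), (2 : ℝ) ^ (j + 1) *
            (((box d R).filter fun V => |form β U V| ≤ (R : ℝ) ^ 2 / 2 ^ j).card : ℝ) := by
          rw [Finset.sum_add_distrib, Finset.sum_comm]
          congr 1
          · simp
          · refine Finset.sum_congr rfl fun j _ => ?_
            rw [← Finset.mul_sum, Finset.sum_boole]
      _ ≤ 3 ^ d * (R : ℝ) ^ d + ∑ _j ∈ Finset.range (scales t),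
            6 * 3 ^ (d - 1) * (R : ℝ) ^ (d + 1) / ‖U‖ :=
          add_le_add (card_box_le d hR) (Finset.sum_le_sum hcount)
      _ ≤ 3 ^ d * (2 * Real.log (2 + t)) * ((R : ℝ) ^ d * (R / ‖U‖)) +
            (4 * Real.log (2 + t)) * (6 * 3 ^ d * (R : ℝ) ^ (d + 1) / ‖U‖) := by
          rw [Finset.sum_const, Finset.card_range, nsmul_eq_mul]
          refine add_le_add ?_ ?_
          · calc (3 : ℝ) ^ d * (R : ℝ) ^ d = 3 ^ d * 1 * ((R : ℝ) ^ d * 1) := by ring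
              _ ≤ _ := by gcongr; linarith
          · gcongr
            · exact scales_le ht
            · norm_num
            · omega
      _ = _ := by
          rw [Real.rpow_neg_one, pow_succ (R : ℝ) d]
          ring
  refine (Finset.sum_le_sum hrow).trans ?_
  rw [← Finset.mul_sum]
  have h5 : ∑ U ∈ (box d R).filter (· ≠ 0), ‖U‖ ^ (-1 : ℝ) ≤ C1 * (R : ℝ) ^ (d - 1) := by
    have := h1 R hR
    rw [← Real.rpow_natCast, Nat.cast_sub (by omega)]
    simpa using this
  calc _ ≤ 3 ^ d * 26 * Real.log (2 + t) * ((R : ℝ) ^ (d + 1)) * (C1 * (R : ℝ) ^ (d - 1)) := by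
        gcongr
    _ = _ := by
        have : (R : ℝ) ^ (2 * d) = (R : ℝ) ^ (d + 1) * (R : ℝ) ^ (d - 1) := by
          rw [← pow_add]; congr 1; omega
        rw [this]; ring

/-- The decaying weight at scale `L`. -/
noncomputable def decay {d : ℕ} (N : ℕ) (L : ℝ) (x : Label d) : ℝ := ((1 + ‖x‖ / L) ^ N)⁻¹

/-- The property of `β` on which the estimates rest: the resolvent of the quadratic form has the
expected lattice sums, up to logarithms. -/
def Generic {d : ℕ} (β : Fin d → ℝ) : Prop :=
  (∀ k, β k ∈ Set.Icc (1 : ℝ) 2) ∧ ∃ C : ℝ, 0 < C ∧ ∀ m : ℕ, 1 ≤ m →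
    ∀ t : ℝ, 0 < t → t ≤ (2 ^ m : ℝ) ^ d →
      (open Classical in
      ∑ U ∈ (box d (2 ^ m)).filter (· ≠ 0), ∑ V ∈ (box d (2 ^ m)).filter (· ≠ 0),
        ENNReal.ofReal ((t⁻¹ + |form β U V| / (2 ^ m : ℝ) ^ 2)⁻¹)) ≤
      ENNReal.ofReal (C * (2 ^ m : ℝ) ^ (2 * d) * Real.log (2 + t) ^ 2)

/-- For `t ≤ 2^m` the deterministic count applies. For larger `t`, still at most `2^(md)`, the
kernel is dominated by the one of width `2^(-md)`, and `m ≤ 2 log(2 + t)` converts the factor `m²`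
into `log²(2 + t)`. -/
lemma ae_generic {d : ℕ} (hd : 3 ≤ d) : ∀ᵐ β ∂(cubeMeasure d), Generic β := by
  classical
  obtain ⟨C2, hC2, h2⟩ := sum_ker_le_of_le hd
  filter_upwards [ae_sum_ker_le hd, ae_cubeMeasure_mem d] with β hβ hβ'
  obtain ⟨C1, hC1, h1⟩ := hβ
  refine ⟨hβ', 4 * C1 + 2 * C2, by positivity, fun m hm t ht htR => ?_⟩
  have hlog := log_two_add_ge ht
  have hm2 : ((2 ^ m : ℕ) : ℝ) = 2 ^ m := by push_cast; rfl
  rcases le_or_gt t (2 ^ m) with hle | hlt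
  · have h3 := h2 (2 ^ m) Nat.one_le_two_pow β hβ' t ht (by rw [hm2]; exact hle)
    rw [hm2] at h3
    have hnn : ∀ U V : Label d, 0 ≤ (t⁻¹ + |form β U V| / (2 ^ m : ℝ) ^ 2)⁻¹ := fun U V => by
      positivity
    calc _ = ENNReal.ofReal (∑ U ∈ (box d (2 ^ m)).filter (· ≠ 0),
          ∑ V ∈ (box d (2 ^ m)).filter (· ≠ 0), (t⁻¹ + |form β U V| / (2 ^ m : ℝ) ^ 2)⁻¹) := by
          rw [ENNReal.ofReal_sum_of_nonneg fun U _ => Finset.sum_nonneg fun V _ => hnn U V]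
          exact Finset.sum_congr rfl fun U _ =>
            (ENNReal.ofReal_sum_of_nonneg fun V _ => hnn U V).symm
      _ ≤ _ := ENNReal.ofReal_le_ofReal (h3.trans ?_)
    have hA : 0 ≤ C2 * (2 ^ m : ℝ) ^ (2 * d) * Real.log (2 + t) := by positivity
    have hB : 0 ≤ 4 * C1 * (2 ^ m : ℝ) ^ (2 * d) * Real.log (2 + t) ^ 2 := by positivity
    nlinarith
  · have h3 := h1 m hm
    rw [hm2] at h3
    have hml : (m : ℝ) ≤ 2 * Real.log (2 + t) := by
      have h4 : (m : ℝ) * Real.log 2 ≤ Real.log (2 + t) := by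
        rw [← Real.log_pow]
        exact Real.log_le_log (by positivity) (by linarith)
      have := Real.log_two_gt_d9
      nlinarith [(Nat.cast_nonneg m : (0 : ℝ) ≤ m)]
    calc _ ≤ _ := Finset.sum_le_sum fun U _ => Finset.sum_le_sum fun V _ => ?_
      _ ≤ _ := h3
      _ ≤ _ := ENNReal.ofReal_le_ofReal ?_
    · refine ENNReal.ofReal_le_ofReal ?_
      gcongr
    · calc C1 * (m : ℝ) ^ 2 * (2 ^ m : ℝ) ^ (2 * d) ≤
            C1 * (2 * Real.log (2 + t)) ^ 2 * (2 ^ m : ℝ) ^ (2 * d) := by gcongr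
        _ = 4 * C1 * (2 ^ m : ℝ) ^ (2 * d) * Real.log (2 + t) ^ 2 := by ring
        _ ≤ _ := by gcongr; linarith

lemma one_le_one_add_norm_div {d : ℕ} {L : ℝ} (hL : 1 ≤ L) (x : Label d) : 1 ≤ 1 + ‖x‖ / L := by
  have : 0 ≤ ‖x‖ / L := by positivity
  linarith

lemma decay_pos {d : ℕ} (N : ℕ) {L : ℝ} (hL : 1 ≤ L) (x : Label d) : 0 < decay N L x := by
  have := one_le_one_add_norm_div hL x
  unfold decay
  positivity

lemma tsum_ite_box {d : ℕ} (F : Label d → ℝ≥0∞) (m : ℕ) :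
    ∑' x, (if ‖x‖ ≤ 2 ^ m then F x else 0) = ∑ x ∈ box d (2 ^ m), F x := by
  rw [tsum_eq_sum (s := box d (2 ^ m))]
  · refine Finset.sum_congr rfl fun x hx => if_pos ?_
    have := mem_box_iff_norm.mp hx
    push_cast at this
    exact this
  · intro x hx
    refine if_neg fun h => hx (mem_box_iff_norm.mpr ?_)
    push_cast
    exact h

lemma tsum_decay_le (d : ℕ) : ∃ C : ℝ, 0 < C ∧ ∀ L : ℝ, 1 ≤ L →
    ∑' x : Label d, ENNReal.ofReal (decay (2 * d + 1) L x) ≤ ENNReal.ofReal (C * L ^ d) := by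
  refine ⟨2 ^ (2 * d + 1 + 1 + 2 * d) * 3 ^ d, by positivity, fun L hL => ?_⟩
  have := tsum_mul_decay_le (ι := Label d) (fun _ => 1) (fun x => ‖x‖) (fun x => norm_nonneg x)
    (D := d) (N := 2 * d + 1) (by omega) hL (3 ^ d) fun m hm hLm => by
      rw [tsum_ite_box]
      simp only [Finset.sum_const, nsmul_eq_mul, mul_one]
      rw [card_box, pow_mul, ← mul_pow]
      push_cast
      gcongr
      have : (1 : ℝ≥0∞) ≤ 2 ^ m := one_le_pow₀ (by norm_num)
      calc (2 : ℝ≥0∞) * 2 ^ m + 1 ≤ 2 * 2 ^ m + 2 ^ m := by gcongr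
        _ = _ := by ring
  simp only [one_mul] at this
  refine this.trans (le_of_eq ?_)
  rw [ENNReal.ofReal_mul (by positivity), ENNReal.ofReal_mul (by positivity),
    ENNReal.ofReal_pow (p := 2) (by norm_num), ENNReal.ofReal_pow (p := 3) (by norm_num)]
  simp

open Classical in
lemma tsum_inv_sq_decay_le {d : ℕ} (hd : 3 ≤ d) : ∃ C : ℝ, 0 < C ∧ ∀ L : ℝ, 1 ≤ L →
    ∑' x : Label d, (if x ≠ 0 then ENNReal.ofReal ((‖x‖ / L) ^ 2)⁻¹ else 0) *
      ENNReal.ofReal (decay (2 * d + 1) L x) ≤ ENNReal.ofReal (C * L ^ d) := by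
  obtain ⟨C1, hC1, h1⟩ := sum_box_norm_rpow_le (d := d) (s := 2) (by norm_num)
    (by exact_mod_cast (by omega : 2 < d))
  refine ⟨2 ^ (2 * d + 1 + 1 + 2 * d) * C1, by positivity, fun L hL => ?_⟩
  have := tsum_mul_decay_le (ι := Label d)
    (fun x => if x ≠ 0 then ENNReal.ofReal ((‖x‖ / L) ^ 2)⁻¹ else 0)
    (fun x => ‖x‖) (fun x => norm_nonneg x)
    (D := d) (N := 2 * d + 1) (by omega) hL (ENNReal.ofReal C1) fun m hm hLm => by
      rw [tsum_ite_box, ← Finset.sum_filter,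
        ← ENNReal.ofReal_sum_of_nonneg fun x _ => by positivity]
      have e : ENNReal.ofReal C1 * 2 ^ (m * d) = ENNReal.ofReal (C1 * 2 ^ (m * d)) := by
        rw [ENNReal.ofReal_mul hC1.le, ENNReal.ofReal_pow (by norm_num)]; simp
      rw [e]
      refine ENNReal.ofReal_le_ofReal ?_
      have h3 := h1 (2 ^ m) Nat.one_le_two_pow
      have e2 : ∀ x : Label d, ((‖x‖ / L) ^ 2)⁻¹ = L ^ 2 * ‖x‖ ^ (-2 : ℝ) := fun x => by
        rw [Real.rpow_neg (norm_nonneg x), Real.rpow_two]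
        field_simp
      simp only [e2]
      rw [← Finset.mul_sum]
      have h4 : ((2 ^ m : ℕ) : ℝ) ^ ((d : ℝ) - 2) = ((2 : ℝ) ^ m) ^ (d - 2) := by
        rw [← Real.rpow_natCast ((2 : ℝ) ^ m), Nat.cast_sub (by omega)]
        push_cast
        rfl
      rw [h4] at h3
      calc _ ≤ (2 ^ m) ^ 2 * (C1 * ((2 : ℝ) ^ m) ^ (d - 2)) := by gcongr
        _ = C1 * ((2 ^ m) ^ 2 * ((2 : ℝ) ^ m) ^ (d - 2)) := by ring
        _ = _ := by
            rw [← pow_add, ← pow_mul]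
            congr 3
            omega
  refine this.trans (le_of_eq ?_)
  rw [ENNReal.ofReal_mul (by positivity), ENNReal.ofReal_mul (by positivity),
    ENNReal.ofReal_pow (p := 2) (by norm_num)]
  simp

open Classical in
/-- The weighted sum of the resolvent over pairs of lattice vectors. -/
lemma Generic.tsum_ker_le {d : ℕ} {β : Fin d → ℝ} (hβ : Generic β) : ∃ C : ℝ, 0 < C ∧
    ∀ L : ℝ, 1 ≤ L → ∀ t : ℝ, 0 < t → t ≤ L ^ d →
    ∑' p : Label d × Label d, (if p.1 ≠ 0 ∧ p.2 ≠ 0 then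
        ENNReal.ofReal ((t⁻¹ + |form β p.1 p.2| / L ^ 2)⁻¹) else 0) *
      ENNReal.ofReal (decay (2 * d + 1) L p.1 * decay (2 * d + 1) L p.2) ≤
      ENNReal.ofReal (C * L ^ (2 * d) * Real.log (2 + t) ^ 2) := by
  obtain ⟨hβ1, C1, hC1, h1⟩ := hβ
  refine ⟨2 ^ (2 * d + 1 + 1 + 2 * (2 * d)) * C1, by positivity, fun L hL t ht htL => ?_⟩
  have hL0 : 0 < L := by linarith
  set F : Label d × Label d → ℝ≥0∞ := fun p => if p.1 ≠ 0 ∧ p.2 ≠ 0 then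
        ENNReal.ofReal ((t⁻¹ + |form β p.1 p.2| / L ^ 2)⁻¹) else 0 with hF
  have h2 := tsum_mul_decay_le F (fun p => ‖p‖) (fun p => norm_nonneg p)
    (D := 2 * d) (N := 2 * d + 1) le_rfl hL (ENNReal.ofReal (C1 * Real.log (2 + t) ^ 2))
    fun m hm hLm => by
      -- Passing from `L` to a dyadic `2^m ≥ L` enlarges both the range of times and the kernel, so
      -- genericity at dyadic scales is enough.
      have htm : t ≤ (2 ^ m : ℝ) ^ d := htL.trans (by gcongr)
      have h3 := h1 m hm t ht htm
      calc _ = ∑' (U : Label d) (V : Label d), if ‖U‖ ≤ 2 ^ m then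
            (if ‖V‖ ≤ 2 ^ m then F (U, V) else 0) else 0 := by
            rw [ENNReal.tsum_prod']
            refine tsum_congr fun U => tsum_congr fun V => ?_
            rw [Prod.norm_mk]
            by_cases hU : ‖U‖ ≤ 2 ^ m <;> by_cases hV : ‖V‖ ≤ 2 ^ m <;> simp [hU, hV]
        _ = ∑ U ∈ box d (2 ^ m), ∑ V ∈ box d (2 ^ m), F (U, V) := by
            rw [← tsum_ite_box (fun U => ∑ V ∈ box d (2 ^ m), F (U, V)) m]
            refine tsum_congr fun U => ?_
            split_ifs
            · rw [tsum_ite_box]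
            · simp
        _ ≤ ∑ U ∈ (box d (2 ^ m)).filter (· ≠ 0), ∑ V ∈ (box d (2 ^ m)).filter (· ≠ 0),
              ENNReal.ofReal ((t⁻¹ + |form β U V| / (2 ^ m : ℝ) ^ 2)⁻¹) := by
            rw [Finset.sum_filter]
            refine Finset.sum_le_sum fun U _ => ?_
            by_cases hU : U = 0
            · simp [hF, hU]
            · rw [if_pos hU, Finset.sum_filter]
              refine Finset.sum_le_sum fun V _ => ?_
              by_cases hV : V = 0
              · simp [hF, hV]
              · simp only [hF]
                rw [if_pos hV, if_pos ⟨hU, hV⟩]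
                refine ENNReal.ofReal_le_ofReal ?_
                gcongr
        _ ≤ _ := h3
        _ = _ := by
            have e : (2 : ℝ≥0∞) ^ (m * (2 * d)) = ENNReal.ofReal (2 ^ (m * (2 * d))) := by
              rw [ENNReal.ofReal_pow (by norm_num)]; simp
            rw [e, ← ENNReal.ofReal_mul (by positivity), ← pow_mul]
            congr 1
            ring
  refine le_trans (ENNReal.tsum_le_tsum fun p => ?_) (h2.trans (le_of_eq ?_))
  · gcongr
    have hp1 := one_le_one_add_norm_div hL p.1
    have hp2 := one_le_one_add_norm_div hL p.2
    rw [decay, decay, ← mul_inv, ← mul_pow]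
    gcongr
    rcases max_cases ‖p.1‖ ‖p.2‖ with h | h <;> rw [Prod.norm_def, h.1] <;> nlinarith
  · rw [mul_assoc, ← ENNReal.ofReal_mul (by positivity)]
    have : (2 : ℝ≥0∞) ^ (2 * d + 1 + 1 + 2 * (2 * d)) =
        ENNReal.ofReal (2 ^ (2 * d + 1 + 1 + 2 * (2 * d))) := by
      rw [ENNReal.ofReal_pow (by norm_num)]; simp
    rw [this, ← ENNReal.ofReal_mul (by positivity)]
    congr 1
    ring

end FeynmanTree

namespace FeynmanTree

open scoped ENNReal

/-! ### Linear forms in lattice vectors -/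

/-- Linearly independent forms can be completed by coordinates. -/
lemma exists_complementary_coordinates {s r : ℕ} (f : Fin s → Fin r → ℚ)
    (hf : LinearIndependent ℚ f) : ∃ I : Finset (Fin r), I.card + s = r ∧
      ∀ x : Fin r → ℚ, (∀ j, ∑ i, f j i * x i = 0) → (∀ i ∈ I, x i = 0) → x = 0 := by
  classical
  -- Steinitz exchange: the given forms are extended to a basis by coordinate forms, and `I`
  -- collects the coordinates used.
  set v : Fin s ⊕ Fin r → (Fin r → ℚ) := Sum.elim f fun i => Pi.single i 1 with hv
  have hs : LinearIndepOn ℚ v (Set.range Sum.inl) := by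
    rw [linearIndepOn_range_iff Sum.inl_injective]
    exact hf
  obtain ⟨b, -, hsb, hspan, hb⟩ := exists_linearIndepOn_extension hs (Set.subset_univ _)
  have htop : Submodule.span ℚ (v '' b) = ⊤ := by
    rw [eq_top_iff, ← (Pi.basisFun ℚ (Fin r)).span_eq, Submodule.span_le]
    rintro _ ⟨i, rfl⟩
    refine hspan ⟨Sum.inr i, Set.mem_univ _, ?_⟩
    simp [hv]
  set I : Finset (Fin r) := Finset.univ.filter fun i => Sum.inr i ∈ b with hI
  refine ⟨I, ?_, fun x hx hxI => ?_⟩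
  · have h1 := finrank_span_eq_card hb
    rw [← Set.image_eq_range, htop, finrank_top, Module.finrank_pi, Fintype.card_fin] at h1
    refine Eq.trans ?_ h1.symm
    rw [Fintype.card_subtype]
    have : (Finset.univ.filter fun x => x ∈ b) =
        (Finset.univ : Finset (Fin s)).disjSum I := by
      ext x
      rcases x with j | i
      · simpa using hsb ⟨j, rfl⟩
      · simp [hI]
    rw [this, Finset.card_disjSum, Finset.card_univ, Fintype.card_fin, add_comm]
  -- The forms that annihilate `x` form a subspace. It contains the basis just found, hence all
  -- coordinate forms, so `x = 0`.
  · let W : Submodule ℚ (Fin r → ℚ) := LinearMap.ker (Fintype.linearCombination ℚ x)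
    have hW : Submodule.span ℚ (v '' b) ≤ W := by
      rw [Submodule.span_le]
      rintro _ ⟨j | i, hj, rfl⟩
      · simpa [W, LinearMap.mem_ker, Fintype.linearCombination_apply, hv] using hx j
      · have := hxI i (by simp [hI, hj])
        simp [W, LinearMap.mem_ker, Fintype.linearCombination_apply, hv, Pi.single_apply, this]
    funext i
    have : (Pi.single i 1 : Fin r → ℚ) ∈ W := hW (htop ▸ Submodule.mem_top)
    simpa [W, LinearMap.mem_ker, Fintype.linearCombination_apply, Pi.single_apply] using this

/-- An integer combination of lattice vectors. -/
def comb {d r : ℕ} (c : Fin r → ℤ) (x : Fin r → Label d) : Label d := ∑ i, c i • x i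

lemma comb_apply {d r : ℕ} (c : Fin r → ℤ) (x : Fin r → Label d) (k : Fin d) :
    comb c x k = ∑ i, c i * x i k := by simp [comb]

/-- The rational vector of the coefficients. -/
def ratVec {r : ℕ} (c : Fin r → ℤ) : Fin r → ℚ := fun i => c i

/-- The values of `s` independent combinations, together with `r - s` of the vectors themselves,
determine all `r` vectors. Each prescribed combination therefore removes one free summation. -/
lemma exists_coordinates_injective {d s r : ℕ} (c : Fin s → Fin r → ℤ)
    (hc : LinearIndependent ℚ fun j => ratVec (c j)) : ∃ I : Finset (Fin r), I.card + s = r ∧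
      ∀ x y : Fin r → Label d, (∀ j, comb (c j) x = comb (c j) y) → (∀ i ∈ I, x i = y i) →
        x = y := by
  obtain ⟨I, hI, h⟩ := exists_complementary_coordinates _ hc
  refine ⟨I, hI, fun x y hxy hxI => ?_⟩
  funext i k
  have := h (fun i => ((x i k - y i k : ℤ) : ℚ)) (fun j => ?_) fun i hi => ?_
  · have h2 := congrFun this i
    simp only [Pi.zero_apply, Int.cast_eq_zero] at h2
    linarith
  · have h3 := congrFun (hxy j) k
    rw [comb_apply, comb_apply] at h3
    have h4 : ∑ i, c j i * (x i k - y i k) = 0 := by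
      simp only [mul_sub, Finset.sum_sub_distrib, h3, sub_self]
    unfold ratVec
    exact_mod_cast h4
  · simp [hxI i hi]

lemma one_le_prod_real {ι : Type*} (s : Finset ι) (f : ι → ℝ) (hf : ∀ i ∈ s, 1 ≤ f i) :
    1 ≤ ∏ i ∈ s, f i := by
  simpa using Finset.prod_le_prod (f := fun _ => (1 : ℝ)) (g := f) (fun _ _ => zero_le_one) hf

lemma single_le_prod_real {ι : Type*} (s : Finset ι) (f : ι → ℝ) (hf : ∀ i ∈ s, 1 ≤ f i) {i : ι}
    (hi : i ∈ s) : f i ≤ ∏ i ∈ s, f i := by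
  classical
  rw [← Finset.mul_prod_erase s f hi]
  exact le_mul_of_one_le_right (zero_le_one.trans (hf i hi))
    (one_le_prod_real _ _ fun j hj => hf j (Finset.mem_of_mem_erase hj))

lemma one_add_norm_comb_le {d r : ℕ} (c : Fin r → ℤ) {L : ℝ} (hL : 1 ≤ L) (x : Fin r → Label d) :
    1 + ‖comb c x‖ / L ≤ (1 + ∑ i, |(c i : ℝ)|) * ∏ i, (1 + ‖x i‖ / L) := by
  have hL0 : 0 < L := by linarith
  have h1 : ∀ i, 1 ≤ 1 + ‖x i‖ / L := fun i => one_le_one_add_norm_div hL _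
  have hP1 : 1 ≤ ∏ i, (1 + ‖x i‖ / L) := one_le_prod_real _ _ fun i _ => h1 i
  have hi : ∀ i, ‖x i‖ / L ≤ ∏ i, (1 + ‖x i‖ / L) := fun i => by
    have := single_le_prod_real Finset.univ (fun i => 1 + ‖x i‖ / L)
      (fun j _ => h1 j) (Finset.mem_univ i)
    linarith
  have h2 : ‖comb c x‖ / L ≤ ∑ i, |(c i : ℝ)| * ∏ i, (1 + ‖x i‖ / L) := by
    calc ‖comb c x‖ / L ≤ (∑ i, ‖c i • x i‖) / L := by
          gcongr
          exact norm_sum_le _ _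
      _ = ∑ i, |(c i : ℝ)| * (‖x i‖ / L) := by
          rw [Finset.sum_div]
          refine Finset.sum_congr rfl fun i _ => ?_
          rw [norm_smul, Int.norm_eq_abs]; ring
      _ ≤ _ := Finset.sum_le_sum fun i _ => mul_le_mul_of_nonneg_left (hi i) (abs_nonneg _)
  rw [add_mul, one_mul, Finset.sum_mul]
  linarith

lemma prod_decay_le {d r : ℕ} (c : Fin r → ℤ) (N : ℕ) {L : ℝ} (hL : 1 ≤ L) (x : Fin r → Label d) :
    ∏ i, decay N L (x i) ≤ (1 + ∑ i, |(c i : ℝ)|) ^ N * decay N L (comb c x) := by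
  have hc : 0 < 1 + ∑ i, |(c i : ℝ)| := by
    have : 0 ≤ ∑ i, |(c i : ℝ)| := Finset.sum_nonneg fun i _ => abs_nonneg _
    linarith
  have hU := one_le_one_add_norm_div hL (comb c x)
  have hP : 1 ≤ ∏ i, (1 + ‖x i‖ / L) :=
    one_le_prod_real _ _ fun i _ => one_le_one_add_norm_div hL _
  have h := one_add_norm_comb_le c hL x
  simp only [decay, Finset.prod_inv_distrib, Finset.prod_pow]
  rw [← div_eq_mul_inv, le_div_iff₀ (by positivity), inv_mul_le_iff₀ (by positivity), ← mul_pow]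
  refine pow_le_pow_left₀ (by positivity) ?_ N
  linarith

lemma decay_le_one {d : ℕ} (N : ℕ) {L : ℝ} (hL : 1 ≤ L) (x : Label d) : decay N L x ≤ 1 :=
  inv_le_one_of_one_le₀ (one_le_pow₀ (one_le_one_add_norm_div hL x))

lemma decay_pow {d : ℕ} (N k : ℕ) (L : ℝ) (x : Label d) : decay (N * k) L x = decay N L x ^ k := by
  rw [decay, decay, inv_pow, pow_mul]

/-- The decay is available three times: one copy is spent on each of the two combinations, and the
third on the vectors that remain as summation variables. -/
lemma prod_decay_three_le {d r : ℕ} (u v : Fin r → ℤ) (N : ℕ) {L : ℝ} (hL : 1 ≤ L)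
    (I : Finset (Fin r)) (x : Fin r → Label d) :
    ∏ i, decay (N * 3) L (x i) ≤
      ((1 + ∑ i, |(u i : ℝ)|) ^ N * (1 + ∑ i, |(v i : ℝ)|) ^ N) *
      ((decay N L (comb u x) * decay N L (comb v x)) * ∏ i : I, decay N L (x i)) := by
  have hp : ∀ i, 0 ≤ decay N L (x i) := fun i => (decay_pos N hL _).le
  have hu := prod_decay_le u N hL x
  have hv := prod_decay_le v N hL x
  have hI : ∏ i, decay N L (x i) ≤ ∏ i : I, decay N L (x i) := by
    rw [Finset.prod_coe_sort I fun i => decay N L (x i),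
      ← Finset.prod_sdiff (Finset.subset_univ I)]
    exact mul_le_of_le_one_left (Finset.prod_nonneg fun i _ => hp i)
      (Finset.prod_le_one (fun i _ => hp i) fun i _ => decay_le_one N hL _)
  have h0 : 0 ≤ ∏ i, decay N L (x i) := Finset.prod_nonneg fun i _ => hp i
  have h1 : 0 ≤ (1 + ∑ i, |(u i : ℝ)|) ^ N * decay N L (comb u x) := h0.trans hu
  have h2 : 0 ≤ (1 + ∑ i, |(v i : ℝ)|) ^ N * decay N L (comb v x) := h0.trans hv
  simp only [decay_pow, Finset.prod_pow]
  calc (∏ i, decay N L (x i)) ^ 3 =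
        (∏ i, decay N L (x i)) * (∏ i, decay N L (x i)) * ∏ i, decay N L (x i) := by ring
    _ ≤ ((1 + ∑ i, |(u i : ℝ)|) ^ N * decay N L (comb u x)) *
        ((1 + ∑ i, |(v i : ℝ)|) ^ N * decay N L (comb v x)) * ∏ i : I, decay N L (x i) := by
        gcongr
    _ = _ := by ring

lemma tsum_prod_decay_le (d : ℕ) : ∃ C : ℝ, 0 < C ∧ ∀ L : ℝ, 1 ≤ L → ∀ (ι : Type) [Fintype ι],
    ∑' y : ι → Label d, ENNReal.ofReal (∏ i, decay (2 * d + 1) L (y i)) ≤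
      ENNReal.ofReal ((C * L ^ d) ^ Fintype.card ι) := by
  obtain ⟨C, hC, h⟩ := tsum_decay_le d
  refine ⟨C, hC, fun L hL ι _ => ?_⟩
  have hL0 : 0 < L := by linarith
  simp only [ENNReal.ofReal_prod_of_nonneg fun i _ => (decay_pos (2 * d + 1) hL _).le]
  refine (tsum_pi_prod_le fun _ y => ENNReal.ofReal (decay (2 * d + 1) L y)).trans ?_
  rw [Finset.prod_const, Finset.card_univ, ENNReal.ofReal_pow (by positivity)]
  gcongr
  exact h L hL

lemma sum_ratVec_eq {r : ℕ} (c : Fin r → ℤ) : ∑ i, ratVec c i = ((∑ i, c i : ℤ) : ℚ) := by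
  simp [ratVec]

open Classical in
-- On the set where the root is prescribed, `U`, `V` and `r - 3` of the vectors form a complete set
-- of coordinates. The pair `(U, V)` contributes the generic bound `L^(2d) log²(2 + t)`, and each
-- other vector `L^d`.
lemma pairing_sum_le_of_linearIndependent {d : ℕ} {β : Fin d → ℝ} (hβ : Generic β) {r : ℕ}
    (κ u v : Fin r → ℤ) (hκ : ∑ i, κ i = 1) (hu : ∑ i, u i = 0) (hv : ∑ i, v i = 0)
    (huv : LinearIndependent ℚ ![ratVec u, ratVec v]) :
    ∃ C : ℝ, 0 < C ∧ ∀ L : ℝ, 1 ≤ L → ∀ t : ℝ, 0 < t → t ≤ L ^ d → ∀ k₀ : Label d,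
      ∑' x : Fin r → Label d, (if comb κ x = k₀ ∧ comb u x ≠ 0 ∧ comb v x ≠ 0 then
        ENNReal.ofReal ((t⁻¹ + |form β (comb u x) (comb v x)| / L ^ 2)⁻¹ *
          ∏ i, decay ((2 * d + 1) * 3) L (x i)) else 0) ≤
      ENNReal.ofReal (C * L ^ (d * (r - 1)) * Real.log (2 + t) ^ 2) := by
  have hind : LinearIndependent ℚ fun j => ratVec (![κ, u, v] j) := by
    rw [Fintype.linearIndependent_iff]
    intro g hg
    rw [Fin.sum_univ_three] at hg
    change g 0 • ratVec κ + g 1 • ratVec u + g 2 • ratVec v = 0 at hg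
    -- Adding up all coefficients isolates `κ`, whose coefficients sum to 1 whereas those of `u` and
    -- `v` sum to 0. So `κ` is independent of the other two.
    have hsum : g 0 = 0 := by
      have := congrArg (fun w : Fin r → ℚ => ∑ i, w i) hg
      simp only [Pi.add_apply, Pi.smul_apply, smul_eq_mul, Finset.sum_add_distrib,
        ← Finset.mul_sum, Pi.zero_apply, Finset.sum_const_zero] at this
      rw [sum_ratVec_eq, hκ] at this
      rw [sum_ratVec_eq, sum_ratVec_eq, hu, hv] at this
      simpa using this
    rw [hsum, zero_smul, zero_add] at hg
    have := LinearIndependent.pair_iff.mp huv (g 1) (g 2) (by simpa using hg)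
    intro i
    fin_cases i
    · exact hsum
    · exact this.1
    · exact this.2
  obtain ⟨I, hI, hinj⟩ := exists_coordinates_injective (d := d) ![κ, u, v] hind
  obtain ⟨C1, hC1, h1⟩ := hβ.tsum_ker_le
  obtain ⟨C2, hC2, h2⟩ := tsum_prod_decay_le d
  set c := (1 + ∑ i, |(u i : ℝ)|) ^ (2 * d + 1) * (1 + ∑ i, |(v i : ℝ)|) ^ (2 * d + 1) with hc
  have hc0 : 0 < c := by
    have h3 : 0 ≤ ∑ i, |(u i : ℝ)| := Finset.sum_nonneg fun i _ => abs_nonneg _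
    have h4 : 0 ≤ ∑ i, |(v i : ℝ)| := Finset.sum_nonneg fun i _ => abs_nonneg _
    positivity
  refine ⟨c * C1 * C2 ^ I.card, by positivity, fun L hL t ht htL k₀ => ?_⟩
  have hL0 : 0 < L := by linarith
  set G : Label d × Label d → ℝ≥0∞ := fun p => (if p.1 ≠ 0 ∧ p.2 ≠ 0 then
        ENNReal.ofReal ((t⁻¹ + |form β p.1 p.2| / L ^ 2)⁻¹) else 0) *
      ENNReal.ofReal (decay (2 * d + 1) L p.1 * decay (2 * d + 1) L p.2) with hG
  set E : (I → Label d) → ℝ≥0∞ := fun y => ENNReal.ofReal (∏ i, decay (2 * d + 1) L (y i)) with hE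
  set Φ : {x : Fin r → Label d // comb κ x = k₀} → (Label d × Label d) × (I → Label d) :=
    fun x => ((comb u x.1, comb v x.1), fun i => x.1 i) with hΦ
  have hΦinj : Function.Injective Φ := by
    rintro ⟨x, hx⟩ ⟨y, hy⟩ hxy
    simp only [hΦ, Prod.mk.injEq] at hxy
    refine Subtype.ext (hinj x y (fun j => ?_) fun i hi => congrFun hxy.2 ⟨i, hi⟩)
    fin_cases j
    · exact hx.trans hy.symm
    · exact hxy.1.1
    · exact hxy.1.2
  calc _ ≤ ∑' x : Fin r → Label d, {x | comb κ x = k₀}.indicator (fun x => ENNReal.ofReal c *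
          (G (comb u x, comb v x) * E fun i : I => x i)) x := by
        refine ENNReal.tsum_le_tsum fun x => ?_
        split_ifs with h
        · rw [Set.indicator_of_mem (show x ∈ {x | comb κ x = k₀} from h.1)]
          simp only [hG, hE]
          rw [if_pos h.2, ← ENNReal.ofReal_mul (by positivity)]
          have hd1 := (decay_pos (2 * d + 1) hL (comb u x)).le
          have hd2 := (decay_pos (2 * d + 1) hL (comb v x)).le
          rw [← ENNReal.ofReal_mul (by positivity), ← ENNReal.ofReal_mul hc0.le]
          refine ENNReal.ofReal_le_ofReal ?_
          calc _ ≤ (t⁻¹ + |form β (comb u x) (comb v x)| / L ^ 2)⁻¹ * (c * _) :=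
                mul_le_mul_of_nonneg_left (prod_decay_three_le u v (2 * d + 1) hL I x)
                  (by positivity)
            _ = _ := by ring
        · exact zero_le
    _ = ∑' x : {x : Fin r → Label d // comb κ x = k₀}, ENNReal.ofReal c *
          (G (Φ x).1 * E (Φ x).2) := (tsum_subtype _ _).symm
    _ ≤ ∑' q : (Label d × Label d) × (I → Label d), ENNReal.ofReal c * (G q.1 * E q.2) :=
        ENNReal.tsum_comp_le_tsum_of_injective hΦinj _
    _ = ENNReal.ofReal c * ((∑' p, G p) * ∑' y, E y) := by
        rw [ENNReal.tsum_mul_left, ENNReal.tsum_prod']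
        simp only [ENNReal.tsum_mul_left, ENNReal.tsum_mul_right]
    _ ≤ ENNReal.ofReal c * (ENNReal.ofReal (C1 * L ^ (2 * d) * Real.log (2 + t) ^ 2) *
          ENNReal.ofReal ((C2 * L ^ d) ^ Fintype.card I)) := by
        gcongr
        · exact h1 L hL t ht htL
        · exact h2 L hL I
    _ = _ := by
        rw [← ENNReal.ofReal_mul (by positivity), ← ENNReal.ofReal_mul hc0.le, Fintype.card_coe]
        congr 1
        have : d * (r - 1) = 2 * d + d * I.card := by
          have hI' : I.card + 3 = r := hI
          rw [show r - 1 = I.card + 2 by omega]; ring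
        rw [this, pow_add, mul_pow, ← pow_mul]
        ring

lemma norm_sq_le_form {d : ℕ} {β : Fin d → ℝ} (hβ : ∀ k, β k ∈ Set.Icc (1 : ℝ) 2) (U : Label d) :
    ‖U‖ ^ 2 ≤ form β U U := by
  have hnn : ∀ k, 0 ≤ β k * ((U k : ℝ) * U k) := fun k =>
    mul_nonneg (by linarith [(hβ k).1]) (mul_self_nonneg _)
  by_cases hU : U = 0
  · simp [hU, form]
  obtain ⟨i, hi⟩ := exists_abs_eq_norm hU
  rw [← hi, sq_abs]
  refine le_trans ?_ (Finset.single_le_sum (fun k _ => hnn k) (Finset.mem_univ i))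
  nlinarith [(hβ i).1, mul_self_nonneg (U i : ℝ)]

open Classical in
-- Here `form β U V` is a nonzero multiple of the positive definite `form β U U`, so the resolvent
-- is at most a constant times `(L / ‖U‖)²`. This is summable at the scale `L` to order `L^d`
-- because `d ≥ 3`, uniformly in `t`.
lemma pairing_sum_le_of_proportional {d : ℕ} (hd : 3 ≤ d) {β : Fin d → ℝ} (hβ : Generic β) {r : ℕ}
    (κ u v : Fin r → ℤ) (hκ : ∑ i, κ i = 1) (hu : ∑ i, u i = 0) (hu0 : u ≠ 0)
    {a b : ℤ} (ha : a ≠ 0) (hb : b ≠ 0) (huv : ∀ i, a * v i = b * u i) :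
    ∃ C : ℝ, 0 < C ∧ ∀ L : ℝ, 1 ≤ L → ∀ t : ℝ, 0 < t → ∀ k₀ : Label d,
      ∑' x : Fin r → Label d, (if comb κ x = k₀ ∧ comb u x ≠ 0 ∧ comb v x ≠ 0 then
        ENNReal.ofReal ((t⁻¹ + |form β (comb u x) (comb v x)| / L ^ 2)⁻¹ *
          ∏ i, decay ((2 * d + 1) * 3) L (x i)) else 0) ≤
      ENNReal.ofReal (C * L ^ (d * (r - 1)) * Real.log (2 + t) ^ 2) := by
  have hind : LinearIndependent ℚ fun j => ratVec (![κ, u] j) := by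
    rw [Fintype.linearIndependent_iff]
    intro g hg
    simp only [Fin.sum_univ_two, Matrix.cons_val_zero, Matrix.cons_val_one] at hg
    have hsum : g 0 = 0 := by
      have := congrArg (fun w : Fin r → ℚ => ∑ i, w i) hg
      simp only [Pi.add_apply, Pi.smul_apply, smul_eq_mul, Finset.sum_add_distrib,
        ← Finset.mul_sum, Pi.zero_apply, Finset.sum_const_zero] at this
      rw [sum_ratVec_eq, sum_ratVec_eq, hκ, hu] at this
      simpa using this
    rw [hsum, zero_smul, zero_add] at hg
    have hune : ratVec u ≠ 0 := fun h => hu0 (funext fun i => by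
      have := congrFun h i
      simpa [ratVec] using this)
    have hg1 := (smul_eq_zero.mp hg).resolve_right hune
    intro i
    fin_cases i
    · exact hsum
    · exact hg1
  obtain ⟨I, hI, hinj⟩ := exists_coordinates_injective (d := d) ![κ, u] hind
  obtain ⟨C1, hC1, h1⟩ := tsum_inv_sq_decay_le hd
  obtain ⟨C2, hC2, h2⟩ := tsum_prod_decay_le d
  set q : ℝ := |(a : ℝ)| / |(b : ℝ)| with hq
  have ha' : 0 < |(a : ℝ)| := abs_pos.mpr (by exact_mod_cast ha)
  have hb' : 0 < |(b : ℝ)| := abs_pos.mpr (by exact_mod_cast hb)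
  have hq0 : 0 < q := by positivity
  set c := (1 + ∑ i, |(u i : ℝ)|) ^ (2 * d + 1) * (1 + ∑ i, |(u i : ℝ)|) ^ (2 * d + 1) with hc
  have hc0 : 0 < c := by
    have h3 : 0 ≤ ∑ i, |(u i : ℝ)| := Finset.sum_nonneg fun i _ => abs_nonneg _
    positivity
  refine ⟨4 * (q * c * C1 * C2 ^ I.card), by positivity, fun L hL t ht k₀ => ?_⟩
  have hL0 : 0 < L := by linarith
  set G : Label d → ℝ≥0∞ := fun p => (if p ≠ 0 then ENNReal.ofReal ((‖p‖ / L) ^ 2)⁻¹ else 0) *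
      ENNReal.ofReal (decay (2 * d + 1) L p) with hG
  set E : (I → Label d) → ℝ≥0∞ := fun y => ENNReal.ofReal (∏ i, decay (2 * d + 1) L (y i)) with hE
  set Φ : {x : Fin r → Label d // comb κ x = k₀} → Label d × (I → Label d) :=
    fun x => (comb u x.1, fun i => x.1 i) with hΦ
  have hΦinj : Function.Injective Φ := by
    rintro ⟨x, hx⟩ ⟨y, hy⟩ hxy
    simp only [hΦ, Prod.mk.injEq] at hxy
    refine Subtype.ext (hinj x y (fun j => ?_) fun i hi => congrFun hxy.2 ⟨i, hi⟩)
    fin_cases j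
    · exact hx.trans hy.symm
    · exact hxy.1
  have hform : ∀ x : Fin r → Label d,
      ‖comb u x‖ ^ 2 ≤ q * |form β (comb u x) (comb v x)| := by
    intro x
    have h3 : (a : ℝ) * form β (comb u x) (comb v x) = b * form β (comb u x) (comb u x) := by
      simp only [form, Finset.mul_sum]
      refine Finset.sum_congr rfl fun k _ => ?_
      have h4 : a * comb v x k = b * comb u x k := by
        rw [comb_apply, comb_apply, Finset.mul_sum, Finset.mul_sum]
        refine Finset.sum_congr rfl fun i _ => ?_
        rw [← mul_assoc, ← mul_assoc, huv]
      have h5 : (a : ℝ) * comb v x k = b * comb u x k := by exact_mod_cast h4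
      linear_combination (β k * comb u x k) * h5
    have h6 := norm_sq_le_form hβ.1 (comb u x)
    have h7 : |(a : ℝ)| * |form β (comb u x) (comb v x)| =
        |(b : ℝ)| * form β (comb u x) (comb u x) := by
      rw [← abs_mul, h3, abs_mul, abs_of_nonneg ((sq_nonneg _).trans h6)]
    rw [hq, div_mul_eq_mul_div, h7, mul_div_assoc, mul_div_cancel₀ _ hb'.ne']
    exact h6
  calc _ ≤ ∑' x : Fin r → Label d, {x | comb κ x = k₀}.indicator (fun x => ENNReal.ofReal (q * c) *
          (G (comb u x) * E fun i : I => x i)) x := by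
        refine ENNReal.tsum_le_tsum fun x => ?_
        split_ifs with h
        · rw [Set.indicator_of_mem (show x ∈ {x | comb κ x = k₀} from h.1)]
          simp only [hG, hE]
          rw [if_pos h.2.1, ← ENNReal.ofReal_mul (by positivity)]
          have hd1 := (decay_pos (2 * d + 1) hL (comb u x)).le
          rw [← ENNReal.ofReal_mul (by positivity), ← ENNReal.ofReal_mul (by positivity)]
          refine ENNReal.ofReal_le_ofReal ?_
          have hn := one_le_norm h.2.1
          have hk : (t⁻¹ + |form β (comb u x) (comb v x)| / L ^ 2)⁻¹ ≤
              q * ((‖comb u x‖ / L) ^ 2)⁻¹ := by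
            have hpos : 0 < |form β (comb u x) (comb v x)| := by
              refine pos_of_mul_pos_right (lt_of_lt_of_le ?_ (hform x)) hq0.le
              positivity
            calc _ ≤ (|form β (comb u x) (comb v x)| / L ^ 2)⁻¹ := by
                  gcongr
                  have := inv_pos.mpr ht
                  linarith
              _ = L ^ 2 / |form β (comb u x) (comb v x)| := by rw [inv_div]
              _ ≤ q * (L ^ 2 / ‖comb u x‖ ^ 2) := by
                  rw [← mul_div_assoc, div_le_div_iff₀ hpos (by positivity)]
                  nlinarith [hform x, sq_nonneg L]
              _ = _ := by rw [div_pow, inv_div]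
          have hpd := prod_decay_three_le u u (2 * d + 1) hL I x
          have hpd0 : 0 ≤ ∏ i, decay ((2 * d + 1) * 3) L (x i) :=
            Finset.prod_nonneg fun i _ => (decay_pos _ hL _).le
          have hEnn : 0 ≤ ∏ i : I, decay (2 * d + 1) L (x i) :=
            Finset.prod_nonneg fun i _ => (decay_pos _ hL _).le
          have hpd' := hpd.trans (mul_le_mul_of_nonneg_left (mul_le_mul_of_nonneg_right
            (mul_le_mul_of_nonneg_left (decay_le_one (2 * d + 1) hL (comb u x)) hd1) hEnn) hc0.le)
          calc _ ≤ (q * ((‖comb u x‖ / L) ^ 2)⁻¹) * (c * ((decay (2 * d + 1) L (comb u x) * 1) *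
                ∏ i : I, decay (2 * d + 1) L (x i))) :=
                mul_le_mul hk hpd' hpd0 (by positivity)
            _ = _ := by ring
        · exact zero_le
    _ = ∑' x : {x : Fin r → Label d // comb κ x = k₀}, ENNReal.ofReal (q * c) *
          (G (Φ x).1 * E (Φ x).2) := (tsum_subtype _ _).symm
    _ ≤ ∑' p : Label d × (I → Label d), ENNReal.ofReal (q * c) * (G p.1 * E p.2) :=
        ENNReal.tsum_comp_le_tsum_of_injective hΦinj _
    _ = ENNReal.ofReal (q * c) * ((∑' p, G p) * ∑' y, E y) := by
        rw [ENNReal.tsum_mul_left, ENNReal.tsum_prod']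
        simp only [ENNReal.tsum_mul_left, ENNReal.tsum_mul_right]
    _ ≤ ENNReal.ofReal (q * c) * (ENNReal.ofReal (C1 * L ^ d) *
          ENNReal.ofReal ((C2 * L ^ d) ^ Fintype.card I)) := by
        gcongr
        · exact h1 L hL
        · exact h2 L hL I
    _ ≤ _ := by
        rw [← ENNReal.ofReal_mul (by positivity), ← ENNReal.ofReal_mul (by positivity),
          Fintype.card_coe]
        refine ENNReal.ofReal_le_ofReal ?_
        have : d * (r - 1) = d + d * I.card := by
          have hI' : I.card + 2 = r := hI
          rw [show r - 1 = I.card + 1 by omega]; ring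
        -- As `log(2 + t) ≥ 1/2`, a bound without logarithms can be brought to the form shared with
        -- the independent case.
        have hlog : 1 ≤ 4 * Real.log (2 + t) ^ 2 := by nlinarith [log_two_add_ge ht]
        rw [this, pow_add, mul_pow, ← pow_mul]
        calc _ = q * c * C1 * C2 ^ I.card * (L ^ d * L ^ (d * I.card)) * 1 := by ring
          _ ≤ q * c * C1 * C2 ^ I.card * (L ^ d * L ^ (d * I.card)) *
                (4 * Real.log (2 + t) ^ 2) := by gcongr
          _ = _ := by ring

open Classical in
/-- The sum over the wave numbers of a pairing, with the resolvent of one frequency. -/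
lemma pairing_sum_le {d : ℕ} (hd : 3 ≤ d) {β : Fin d → ℝ} (hβ : Generic β) {r : ℕ}
    (κ u v : Fin r → ℤ) (hκ : ∑ i, κ i = 1) (hu : ∑ i, u i = 0) (hv : ∑ i, v i = 0) :
    ∃ C : ℝ, 0 < C ∧ ∀ L : ℝ, 1 ≤ L → ∀ t : ℝ, 0 < t → t ≤ L ^ d → ∀ k₀ : Label d,
      ∑' x : Fin r → Label d, (if comb κ x = k₀ ∧ comb u x ≠ 0 ∧ comb v x ≠ 0 then
        ENNReal.ofReal ((t⁻¹ + |form β (comb u x) (comb v x)| / L ^ 2)⁻¹ *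
          ∏ i, decay ((2 * d + 1) * 3) L (x i)) else 0) ≤
      ENNReal.ofReal (C * L ^ (d * (r - 1)) * Real.log (2 + t) ^ 2) := by
  have hcomb0 : ∀ x : Fin r → Label d, comb (0 : Fin r → ℤ) x = 0 := fun x => by simp [comb]
  -- Then `U` vanishes identically and the condition `U ≠ 0` empties the sum; any constant works.
  by_cases hu0 : u = 0
  · exact ⟨1, one_pos, fun L hL t ht htL k₀ => by simp [hu0, hcomb0]⟩
  by_cases hv0 : v = 0
  · exact ⟨1, one_pos, fun L hL t ht htL k₀ => by simp [hv0, hcomb0]⟩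
  by_cases huv : LinearIndependent ℚ ![ratVec u, ratVec v]
  · exact pairing_sum_le_of_linearIndependent hβ κ u v hκ hu hv huv
  · obtain ⟨i₀, hi₀⟩ := Function.ne_iff.mp hu0
    have hprop : ∀ i, u i₀ * v i = v i₀ * u i := by
      rw [LinearIndependent.pair_iff] at huv
      push Not at huv
      obtain ⟨p, q, hpq, h⟩ := huv
      have hc : ∀ i, p * u i + q * v i = 0 := fun i => by
        have := congrFun hpq i
        simpa [ratVec] using this
      have hq : q ≠ 0 := by
        rintro rfl
        have h1 := hc i₀
        have h2 : (u i₀ : ℚ) ≠ 0 := by exact_mod_cast hi₀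
        have hp : p = 0 := by simpa [h2] using h1
        exact h hp rfl
      intro i
      have : (u i₀ : ℚ) * v i = v i₀ * u i := by
        apply mul_left_cancel₀ hq
        linear_combination (u i₀ : ℚ) * hc i - (u i : ℚ) * hc i₀
      exact_mod_cast this
    have hvi : v i₀ ≠ 0 := by
      intro h
      apply hv0
      funext i
      have := hprop i
      rw [h, zero_mul] at this
      exact (mul_eq_zero.mp this).resolve_left hi₀
    obtain ⟨C, hC, h⟩ := pairing_sum_le_of_proportional hd hβ κ u v hκ hu hu0 hi₀ hvi hprop
    exact ⟨C, hC, fun L hL t ht _ k₀ => h L hL t ht k₀⟩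

end FeynmanTree

namespace FeynmanTree

/-! ### Iterated time integrals -/

/-- The phase `e^{-2πi s w}`. -/
noncomputable def phase (s w : ℝ) : ℂ := Complex.exp (-(2 * Real.pi * s * w : ℝ) * Complex.I)

lemma norm_phase (s w : ℝ) : ‖phase s w‖ = 1 := by
  rw [phase, ← Complex.ofReal_neg, Complex.norm_exp_ofReal_mul_I]

lemma continuous_phase (w : ℝ) : Continuous fun s => phase s w := by
  unfold phase; fun_prop

lemma conj_phase (s w : ℝ) : conj (phase s w) = phase s (-w) := by
  rw [phase, phase, ← Complex.exp_conj, map_mul, Complex.conj_I, map_neg, Complex.conj_ofReal]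
  congr 1
  push_cast
  ring

lemma phase_zero_right (s : ℝ) : phase s 0 = 1 := by simp [phase]

lemma hasDerivAt_phase (s w : ℝ) :
    HasDerivAt (fun s => phase s w) (-(2 * Real.pi * w : ℝ) * Complex.I * phase s w) s := by
  have h1 : HasDerivAt (fun s : ℝ => ((2 * Real.pi * s * w : ℝ) : ℂ)) ((2 * Real.pi * w : ℝ) : ℂ) s := by
    have := (((hasDerivAt_id s).const_mul (2 * Real.pi)).mul_const w).ofReal_comp
    simpa using this
  have h2 := (h1.neg.mul_const Complex.I).cexp
  have h3 : (fun s => phase s w) = fun x : ℝ =>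
      Complex.exp ((-fun s : ℝ => ((2 * Real.pi * s * w : ℝ) : ℂ)) x * Complex.I) := by
    funext x
    rw [phase, Pi.neg_apply]
  rw [← h3] at h2
  convert h2 using 1
  rw [mul_comm]
  congr 1

/-- The iterated integral `∫_{0 ≤ u_1 ≤ ⋯ ≤ u_n ≤ t} ∏_j e^{-2πi u_j Ω_j} du`. -/
noncomputable def iterInt : ℕ → ℝ → (ℕ → ℝ) → ℂ
  | 0, _, _ => 1
  | n + 1, t, Ω => ∫ u in (0 : ℝ)..t, phase u (Ω n) * iterInt n u Ω

lemma continuous_iterInt (n : ℕ) (Ω : ℕ → ℝ) : Continuous fun t => iterInt n t Ω := by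
  induction n with
  | zero => exact continuous_const
  | succ n ih =>
    exact intervalIntegral.continuous_primitive
      (fun a b => ((continuous_phase _).mul ih).intervalIntegrable a b) 0

lemma hasDerivAt_iterInt (n : ℕ) (Ω : ℕ → ℝ) (t : ℝ) :
    HasDerivAt (fun t => iterInt (n + 1) t Ω) (phase t (Ω n) * iterInt n t Ω) t := by
  have hc : Continuous fun u => phase u (Ω n) * iterInt n u Ω :=
    (continuous_phase (Ω n)).mul (continuous_iterInt n Ω)
  exact intervalIntegral.integral_hasDerivAt_right (hc.intervalIntegrable 0 t)
    (hc.stronglyMeasurableAtFilter _ _) hc.continuousAt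

lemma iterInt_succ_zero (n : ℕ) (Ω : ℕ → ℝ) : iterInt (n + 1) 0 Ω = 0 := by
  simp [iterInt]

lemma iterInt_congr (n : ℕ) (t : ℝ) {Ω Ω' : ℕ → ℝ} (h : ∀ j < n, Ω j = Ω' j) :
    iterInt n t Ω = iterInt n t Ω' := by
  induction n generalizing t with
  | zero => rfl
  | succ n ih =>
    simp only [iterInt]
    rw [h n (Nat.lt_succ_self n)]
    simp only [fun u => ih u fun j hj => h j (Nat.lt_succ_of_lt hj)]

lemma conj_iterInt (n : ℕ) (t : ℝ) (Ω : ℕ → ℝ) :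
    conj (iterInt n t Ω) = iterInt n t fun j => -Ω j := by
  induction n generalizing t with
  | zero => simp [iterInt]
  | succ n ih =>
    simp only [iterInt]
    rw [intervalIntegral.intervalIntegral_eq_integral_uIoc,
      intervalIntegral.intervalIntegral_eq_integral_uIoc, Complex.real_smul, Complex.real_smul,
      map_mul, Complex.conj_ofReal, ← integral_conj]
    simp only [map_mul, conj_phase, ih]

lemma norm_iterInt_le (n : ℕ) {t : ℝ} (ht : 0 ≤ t) (Ω : ℕ → ℝ) : ‖iterInt n t Ω‖ ≤ t ^ n := by
  induction n generalizing t with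
  | zero => simp [iterInt]
  | succ n ih =>
    simp only [iterInt]
    refine (intervalIntegral.norm_integral_le_of_norm_le_const (C := t ^ n) fun u hu => ?_).trans ?_
    · rw [Set.uIoc_of_le ht] at hu
      rw [norm_mul, norm_phase, one_mul]
      exact (ih hu.1.le).trans (pow_le_pow_left₀ hu.1.le hu.2 n)
    · rw [sub_zero, abs_of_nonneg ht, pow_succ]

/-- Integration by parts in the outermost variable. -/
lemma norm_iterInt_succ_le_div (n : ℕ) {t : ℝ} (ht : 0 < t) (Ω : ℕ → ℝ) (hΩ : Ω n ≠ 0) :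
    ‖iterInt (n + 1) t Ω‖ ≤ 3 * t ^ n / |Ω n| := by
  set c : ℂ := -(2 * Real.pi * Ω n : ℝ) * Complex.I with hc
  have hc0 : c ≠ 0 := by
    rw [hc]
    refine mul_ne_zero (neg_ne_zero.mpr (Complex.ofReal_ne_zero.mpr ?_)) Complex.I_ne_zero
    exact mul_ne_zero Real.two_pi_pos.ne' hΩ
  have hcn : |Ω n| ≤ ‖c‖ := by
    rw [hc, norm_mul, norm_neg, Complex.norm_I, mul_one, Complex.norm_real, Real.norm_eq_abs,
      abs_mul, abs_of_pos Real.two_pi_pos]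
    exact le_mul_of_one_le_left (abs_nonneg _) (by linarith [Real.pi_gt_three])
  have hbd : ∀ X : ℂ, c * X = c * iterInt (n + 1) t Ω → ‖c * X‖ ≤ 3 * t ^ n →
      ‖iterInt (n + 1) t Ω‖ ≤ 3 * t ^ n / |Ω n| := by
    intro X hX hle
    rw [hX, norm_mul] at hle
    rw [le_div_iff₀ (abs_pos.mpr hΩ), mul_comm]
    exact (mul_le_mul_of_nonneg_right hcn (norm_nonneg _)).trans hle
  refine hbd _ rfl ?_
  have hint : c * iterInt (n + 1) t Ω = ∫ u in (0 : ℝ)..t, c * phase u (Ω n) * iterInt n u Ω := by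
    simp only [iterInt, mul_assoc, intervalIntegral.integral_const_mul]
  rw [hint]
  rcases n with - | n
  · have h1 : ∫ u in (0 : ℝ)..t, c * phase u (Ω 0) * iterInt 0 u Ω =
        phase t (Ω 0) - phase 0 (Ω 0) := by
      simp only [iterInt, mul_one]
      exact intervalIntegral.integral_eq_sub_of_hasDerivAt (fun u _ => hasDerivAt_phase u (Ω 0))
        ((continuous_const.mul (continuous_phase _)).intervalIntegrable _ _)
    rw [h1]
    refine (norm_sub_le _ _).trans ?_
    rw [norm_phase, norm_phase]
    norm_num
  -- The inner integral vanishes at time 0, which leaves one boundary term and one integral, each at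
  -- most a constant times the trivial bound on the remaining variables.
  · have h1 := intervalIntegral.integral_deriv_mul_eq_sub
      (u := fun u => phase u (Ω (n + 1))) (v := fun u => iterInt (n + 1) u Ω) (a := 0) (b := t)
      (u' := fun u => c * phase u (Ω (n + 1))) (v' := fun u => phase u (Ω n) * iterInt n u Ω)
      (fun u _ => hasDerivAt_phase u (Ω (n + 1))) (fun u _ => hasDerivAt_iterInt n Ω u)
      ((continuous_const.mul (continuous_phase _)).intervalIntegrable _ _)
      (((continuous_phase _).mul (continuous_iterInt n Ω)).intervalIntegrable _ _)
    have hcont1 : Continuous fun u => c * phase u (Ω (n + 1)) * iterInt (n + 1) u Ω :=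
      (continuous_const.mul (continuous_phase _)).mul (continuous_iterInt _ _)
    have hcont2 : Continuous fun u => phase u (Ω (n + 1)) * (phase u (Ω n) * iterInt n u Ω) :=
      (continuous_phase _).mul ((continuous_phase _).mul (continuous_iterInt n Ω))
    rw [intervalIntegral.integral_add (hcont1.intervalIntegrable _ _)
      (hcont2.intervalIntegrable _ _)] at h1
    have h2 : ∫ u in (0 : ℝ)..t, c * phase u (Ω (n + 1)) * iterInt (n + 1) u Ω =
        phase t (Ω (n + 1)) * iterInt (n + 1) t Ω -
          ∫ u in (0 : ℝ)..t, phase u (Ω (n + 1)) * (phase u (Ω n) * iterInt n u Ω) := by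
      rw [iterInt_succ_zero, mul_zero, sub_zero] at h1
      exact eq_sub_of_add_eq h1
    rw [h2]
    have h3 : ‖∫ u in (0 : ℝ)..t, phase u (Ω (n + 1)) * (phase u (Ω n) * iterInt n u Ω)‖ ≤
        t ^ n * |t - 0| := by
      refine intervalIntegral.norm_integral_le_of_norm_le_const fun u hu => ?_
      rw [Set.uIoc_of_le ht.le] at hu
      rw [norm_mul, norm_mul, norm_phase, norm_phase, one_mul, one_mul]
      exact (norm_iterInt_le n hu.1.le Ω).trans (pow_le_pow_left₀ hu.1.le hu.2 n)
    rw [sub_zero, abs_of_pos ht, ← pow_succ] at h3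
    have h4 := norm_iterInt_le (n + 1) ht.le Ω
    refine (norm_sub_le _ _).trans ?_
    rw [norm_mul, norm_phase, one_mul]
    have : 0 < t ^ (n + 1) := by positivity
    linarith

/-- The trivial bound `t^(n+1)` controls small frequencies and integration by parts the large ones;
the resolvent combines both, also when the frequency is zero. -/
lemma norm_iterInt_succ_le (n : ℕ) {t : ℝ} (ht : 0 < t) (Ω : ℕ → ℝ) :
    ‖iterInt (n + 1) t Ω‖ ≤ 4 * t ^ n * (t⁻¹ + |Ω n|)⁻¹ := by
  have h1 := norm_iterInt_le (n + 1) ht.le Ω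
  have ht' := inv_pos.mpr ht
  have htn : 0 < t ^ n := by positivity
  have hpos : 0 < t⁻¹ + |Ω n| := by positivity
  rw [← div_eq_mul_inv, le_div_iff₀ hpos, mul_add]
  have h2 : ‖iterInt (n + 1) t Ω‖ * t⁻¹ ≤ t ^ n := by
    rw [← div_eq_mul_inv, div_le_iff₀ ht, ← pow_succ]; exact h1
  have h3 : ‖iterInt (n + 1) t Ω‖ * |Ω n| ≤ 3 * t ^ n := by
    by_cases hΩ : Ω n = 0
    · rw [hΩ, abs_zero, mul_zero]; positivity
    · exact (le_div_iff₀ (abs_pos.mpr hΩ)).mp (norm_iterInt_succ_le_div n ht Ω hΩ)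
  linarith

/-- The domain of integration of `timeIntegral`. -/
def timeSimplex (n : ℕ) (t : ℝ) : Set (Fin n → ℝ) := {s | (∀ i, 0 ≤ s i) ∧ ∑ i, s i ≤ t}

/-- The integrand of `timeIntegral`. -/
noncomputable def timeIntegrand (n : ℕ) (Ω : ℕ → ℝ) (s : Fin n → ℝ) : ℂ :=
  ∏ j : Fin n, phase (∑ i ∈ Finset.univ.filter (fun i => i ≤ j), s i) (Ω j)

lemma timeIntegral_eq (n : ℕ) (t : ℝ) (Ω : ℕ → ℝ) :
    timeIntegral n t Ω = ∫ s in timeSimplex n t, timeIntegrand n Ω s := rfl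

lemma continuous_timeIntegrand (n : ℕ) (Ω : ℕ → ℝ) : Continuous (timeIntegrand n Ω) := by
  unfold timeIntegrand
  refine continuous_finsetProd _ fun j _ => (continuous_phase _).comp ?_
  exact continuous_finsetSum _ fun i _ => continuous_apply i

lemma isCompact_timeSimplex (n : ℕ) (t : ℝ) : IsCompact (timeSimplex n t) := by
  refine IsCompact.of_isClosed_subset (isCompact_univ_pi fun _ : Fin n => isCompact_Icc (a := 0) (b := t)) ?_ ?_
  · have : timeSimplex n t = (⋂ i, {s | 0 ≤ s i}) ∩ {s | ∑ i, s i ≤ t} := by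
      ext s
      simp [timeSimplex]
    rw [this]
    refine IsClosed.inter ?_ ?_
    · exact isClosed_iInter fun i => isClosed_le continuous_const (continuous_apply i)
    · exact isClosed_le (continuous_finsetSum _ fun i _ => continuous_apply i) continuous_const
  · intro s hs i _
    exact ⟨hs.1 i, (Finset.single_le_sum (fun j _ => hs.1 j) (Finset.mem_univ i)).trans hs.2⟩

/-- The coordinates in which the last entry is replaced by the sum of all. -/
noncomputable def sumCoord (n : ℕ) (p : (Fin n → ℝ) × ℝ) : Fin (n + 1) → ℝ :=
  (Fin.last n).insertNth (α := fun _ => ℝ) (p.2 - ∑ i, p.1 i) p.1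

/-- The map is a shear: up to reordering the coordinates, it translates the last variable by an
amount depending on the others. -/
lemma measurePreserving_sumCoord (n : ℕ) :
    MeasurePreserving (sumCoord n) (volume.prod volume) volume := by
  have h1 : MeasurePreserving (fun p : (Fin n → ℝ) × ℝ => (p.1, p.2 - ∑ i, p.1 i))
      (volume.prod volume) (volume.prod volume) := by
    refine (MeasurePreserving.id volume).skew_product (g := fun (a : Fin n → ℝ) (x : ℝ) => x - ∑ i, a i) ?_ ?_
    · fun_prop
    · exact Filter.Eventually.of_forall fun a => (measurePreserving_sub_right volume _).map_eq
  have h2 := (volume_preserving_piFinSuccAbove (fun _ : Fin (n + 1) => ℝ) (Fin.last n)).symm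
  exact (h2.comp (Measure.measurePreserving_swap (μ := (volume : Measure (Fin n → ℝ))) (ν := (volume : Measure ℝ)))).comp h1

lemma sumCoord_castSucc (n : ℕ) (p : (Fin n → ℝ) × ℝ) (i : Fin n) :
    sumCoord n p i.castSucc = p.1 i := by
  rw [sumCoord, ← Fin.succAbove_last_apply, Fin.insertNth_apply_succAbove]

lemma sumCoord_last (n : ℕ) (p : (Fin n → ℝ) × ℝ) :
    sumCoord n p (Fin.last n) = p.2 - ∑ i, p.1 i := by
  rw [sumCoord, Fin.insertNth_apply_same]

lemma sum_sumCoord (n : ℕ) (p : (Fin n → ℝ) × ℝ) : ∑ i, sumCoord n p i = p.2 := by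
  rw [Fin.sum_univ_castSucc, sumCoord_last]
  simp [sumCoord_castSucc]

lemma sumCoord_mem (n : ℕ) (t : ℝ) (p : (Fin n → ℝ) × ℝ) :
    sumCoord n p ∈ timeSimplex (n + 1) t ↔ p.2 ∈ Set.Icc 0 t ∧ p.1 ∈ timeSimplex n p.2 := by
  simp only [timeSimplex, Set.mem_ofPred_eq, sum_sumCoord, Fin.forall_fin_succ', sumCoord_castSucc,
    sumCoord_last, Set.mem_Icc]
  constructor
  · rintro ⟨⟨h1, h2⟩, h3⟩
    have := Finset.sum_nonneg fun i (_ : i ∈ Finset.univ) => h1 i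
    exact ⟨⟨by linarith, h3⟩, h1, by linarith⟩
  · rintro ⟨⟨h1, h2⟩, h3, h4⟩
    exact ⟨⟨h3, by linarith⟩, h2⟩

lemma timeIntegrand_sumCoord (n : ℕ) (Ω : ℕ → ℝ) (p : (Fin n → ℝ) × ℝ) :
    timeIntegrand (n + 1) Ω (sumCoord n p) = phase p.2 (Ω n) * timeIntegrand n Ω p.1 := by
  unfold timeIntegrand
  rw [Fin.prod_univ_castSucc, mul_comm]
  congr 1
  · have : (Finset.univ.filter fun i : Fin (n + 1) => i ≤ Fin.last n) = Finset.univ :=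
      Finset.filter_true_of_mem fun i _ => Fin.le_last i
    rw [this, sum_sumCoord, Fin.val_last]
  · refine Finset.prod_congr rfl fun j _ => ?_
    congr 1
    simp only [Finset.sum_filter]
    rw [Fin.sum_univ_castSucc, if_neg (Fin.castSucc_lt_last j).not_ge, add_zero]
    simp only [Fin.castSucc_le_castSucc_iff, sumCoord_castSucc]

/-- With the last waiting time replaced by the total `u`, the last phase depends on `u` alone and
the earlier waiting times range over the simplex of size `u`. -/
lemma timeIntegral_succ (n : ℕ) {t : ℝ} (ht : 0 ≤ t) (Ω : ℕ → ℝ) :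
    timeIntegral (n + 1) t Ω = ∫ u in (0 : ℝ)..t, phase u (Ω n) * timeIntegral n u Ω := by
  set G := (timeSimplex (n + 1) t).indicator (timeIntegrand (n + 1) Ω) with hG
  have hms := (isCompact_timeSimplex (n + 1) t).measurableSet
  have hGi : Integrable G volume := by
    rw [hG, integrable_indicator_iff hms]
    exact (continuous_timeIntegrand _ _).continuousOn.integrableOn_compact (isCompact_timeSimplex _ _)
  have hΦ := measurePreserving_sumCoord n
  have hGΦ : Integrable (fun p => G (sumCoord n p)) (volume.prod volume) :=
    hΦ.integrable_comp_of_integrable hGi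
  have hval : ∀ (u : ℝ) (s : Fin n → ℝ), G (sumCoord n (s, u)) = (Set.Icc 0 t).indicator
      (fun u => phase u (Ω n) * (timeSimplex n u).indicator (timeIntegrand n Ω) s) u := by
    intro u s
    by_cases h : sumCoord n (s, u) ∈ timeSimplex (n + 1) t
    · rw [hG, Set.indicator_of_mem h, timeIntegrand_sumCoord]
      rw [sumCoord_mem] at h
      rw [Set.indicator_of_mem h.1, Set.indicator_of_mem h.2]
    · rw [hG, Set.indicator_of_notMem h]
      rw [sumCoord_mem] at h
      by_cases hu : u ∈ Set.Icc 0 t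
      · rw [Set.indicator_of_mem hu, Set.indicator_of_notMem fun hs => h ⟨hu, hs⟩, mul_zero]
      · rw [Set.indicator_of_notMem hu]
  rw [timeIntegral_eq, ← integral_indicator hms, ← hG]
  have h1 : ∫ s, G s = ∫ p, G (sumCoord n p) ∂(volume.prod volume) := by
    conv_lhs => rw [← hΦ.map_eq]
    exact integral_map hΦ.aemeasurable (by rw [hΦ.map_eq]; exact hGi.aestronglyMeasurable)
  rw [h1, integral_prod_symm _ hGΦ, intervalIntegral.integral_of_le ht,
    ← integral_Icc_eq_integral_Ioc, ← integral_indicator measurableSet_Icc]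
  refine integral_congr_ae (Filter.Eventually.of_forall fun u => ?_)
  simp only [hval]
  by_cases hu : u ∈ Set.Icc 0 t
  · simp only [Set.indicator_of_mem hu]
    rw [integral_const_mul, integral_indicator (isCompact_timeSimplex n u).measurableSet,
      timeIntegral_eq]
  · simp only [Set.indicator_of_notMem hu, integral_zero]

lemma timeIntegral_eq_iterInt (n : ℕ) {t : ℝ} (ht : 0 ≤ t) (Ω : ℕ → ℝ) :
    timeIntegral n t Ω = iterInt n t Ω := by
  induction n generalizing t with
  | zero =>
    have : timeSimplex 0 t = Set.univ := by
      ext s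
      simp [timeSimplex, ht]
    rw [timeIntegral_eq, this]
    simp [timeIntegrand, iterInt, Measure.real, volume_pi]
  | succ n ih =>
    rw [timeIntegral_succ n ht, iterInt]
    refine intervalIntegral.integral_congr fun u hu => ?_
    rw [Set.uIcc_of_le ht] at hu
    simp only [ih hu.1]

end FeynmanTree

namespace FeynmanTree

/-! ### Forests: histories which end with several roots -/

/-- Interaction histories of `N` interactions which end with `M` roots. -/
abbrev Forest (M N : ℕ) := ∀ j : Fin N, Fin (2 * (N - ((j : ℕ) + 1)) + M)

/-- The positions of the interactions as a function on `ℕ`. -/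
def Forest.idx {M N : ℕ} (h : Forest M N) (j : ℕ) : ℕ :=
  if hj : j < N then (h ⟨j, hj⟩ : ℕ) else 0

lemma Forest.idx_lt {M N : ℕ} (h : Forest M N) {j : ℕ} (hj : j < N) :
    h.idx j < 2 * (N - (j + 1)) + M := by
  rw [Forest.idx, dif_pos hj]
  exact (h ⟨j, hj⟩).2

/-- This peels off the interaction next to the roots: its position ranges over the `M` roots, and
below it there is a forest with `M + 2` roots. The ranges of the earlier positions agree, since `2
(N + 1 - (j + 1)) + M = 2 (N - (j + 1)) + (M + 2)` for `j < N`. -/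
lemma sum_forest_succ {A : Type*} [AddCommMonoid A] (M N : ℕ) (F : (ℕ → ℕ) → A) :
    ∑ h : Forest M (N + 1), F h.idx =
      ∑ l ∈ Finset.range M, ∑ h : Forest (M + 2) N, F (Function.update h.idx N l) := by
  rw [← Fin.sum_univ_eq_sum_range (fun l => ∑ h : Forest (M + 2) N, F (Function.update h.idx N l)),
    ← Fintype.sum_prod_type' (fun (l : Fin M) (h : Forest (M + 2) N) => F (Function.update h.idx N l))]
  symm
  refine Finset.sum_bij'
    (i := fun (p : Fin M × Forest (M + 2) N) _ => (fun j : Fin (N + 1) =>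
      if hj : (j : ℕ) < N then (⟨p.2 ⟨j, hj⟩, by have := (p.2 ⟨j, hj⟩).2; simp only at this; omega⟩ :
        Fin (2 * (N + 1 - ((j : ℕ) + 1)) + M))
      else ⟨p.1, by have := p.1.2; omega⟩ : Forest M (N + 1)))
    (j := fun (h : Forest M (N + 1)) _ => ((⟨h (Fin.last N), by
        have := (h (Fin.last N)).2
        simp only [Fin.val_last] at this
        omega⟩ : Fin M), (fun j : Fin N => (⟨h j.castSucc, by
          have h1 := (h j.castSucc).2
          have h2 := j.2
          simp only [Fin.val_castSucc] at h1
          omega⟩ : Fin (2 * (N - ((j : ℕ) + 1)) + (M + 2))) : Forest (M + 2) N)))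
    ?_ ?_ ?_ ?_ ?_
  · intro _ _; exact Finset.mem_univ _
  · intro _ _; exact Finset.mem_univ _
  · rintro ⟨l, h⟩ _
    refine Prod.ext (Fin.ext ?_) (funext fun j => Fin.ext ?_)
    · simp
    · simp
  · intro h _
    funext j
    refine Fin.ext ?_
    by_cases hj : (j : ℕ) < N
    · simp [hj]
    · have : j = Fin.last N := Fin.ext (by have := j.2; simp only [Fin.val_last]; omega)
      subst this
      simp
  · rintro ⟨l, h⟩ _
    congr 1
    funext j
    rcases lt_trichotomy j N with hj | hj | hj
    · simp [Function.update_of_ne hj.ne, Forest.idx, hj, Nat.lt_succ_of_lt hj]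
    · subst hj
      simp [Forest.idx]
    · have h1 : ¬ j < N := by omega
      have h2 : ¬ j < N + 1 := by omega
      simp [Function.update_of_ne hj.ne', Forest.idx, h1, h2]

/-- The wave numbers on level `j` for the interactions at the positions `f`. -/
def pathLevel {d : ℕ} (f : ℕ → ℕ) (K : ℕ → Label d) : ℕ → ℕ → Label d
  | 0 => K
  | j + 1 => merge (f j) (pathLevel f K j)

/-- The frequency of the interaction at position `l`, without its sign. -/
noncomputable def cubicFreq {d : ℕ} (β : Fin d → ℝ) (L : ℝ) (l : ℕ) (R : ℕ → Label d) : ℝ :=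
  Q β (wave L (merge l R l)) - Q β (wave L (R l)) + Q β (wave L (R (l + 1)))
    - Q β (wave L (R (l + 2)))

/-- The frequencies of the interactions at the positions `f`. -/
noncomputable def pathFreq {d : ℕ} (β : Fin d → ℝ) (L : ℝ) (f : ℕ → ℕ) (K : ℕ → Label d) (j : ℕ) :
    ℝ :=
  (-1) ^ f j * cubicFreq β L (f j) (pathLevel f K j)

/-- The shifted sequence. -/
def shift {d : ℕ} (m : ℕ) (K : ℕ → Label d) : ℕ → Label d := fun i => K (m + i)

/-- `g` depends only on the first `M` entries. -/
def DependsOnFirst {d : ℕ} {A : Type*} (M : ℕ) (g : (ℕ → Label d) → A) : Prop :=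
  ∀ R R' : ℕ → Label d, (∀ i < M, R i = R' i) → g R = g R'

/-! ### Locality of the merging rule and of the frequencies -/

section merging

variable {d : ℕ}

lemma merge_of_lt {l m : ℕ} (h : m < l) (R : ℕ → Label d) : merge l R m = R m := by
  simp [merge, h]

lemma merge_self (l : ℕ) (R : ℕ → Label d) : merge l R l = R l - R (l + 1) + R (l + 2) := by
  simp [merge]

lemma merge_of_gt {l m : ℕ} (h : l < m) (R : ℕ → Label d) : merge l R m = R (m + 2) := by
  simp [merge, h.not_gt, h.ne']

lemma shift_merge_add (M l : ℕ) (R : ℕ → Label d) :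
    shift M (merge (M + l) R) = merge l (shift M R) := by
  funext i
  rcases lt_trichotomy i l with h | rfl | h
  · rw [merge_of_lt h, shift, shift, merge_of_lt (by omega)]
  · rw [merge_self, shift, shift, merge_self]
    simp only [shift, add_assoc]
  · rw [merge_of_gt h, shift, shift, merge_of_gt (by omega), add_assoc]

lemma shift_merge_of_lt {M l : ℕ} (h : l < M) (R : ℕ → Label d) :
    shift M (merge l R) = shift (M + 2) R := by
  funext i
  rw [shift, shift, merge_of_gt (by omega)]
  congr 1
  omega

lemma cubicFreq_add (β : Fin d → ℝ) (L : ℝ) (M l : ℕ) (R : ℕ → Label d) :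
    cubicFreq β L (M + l) R = cubicFreq β L l (shift M R) := by
  simp only [cubicFreq, merge_self, shift, add_assoc]

lemma merge_congr {l M : ℕ} (hl : l < M) {R R' : ℕ → Label d} (h : ∀ i < M + 2, R i = R' i) {i : ℕ}
    (hi : i < M) : merge l R i = merge l R' i := by
  rcases lt_trichotomy i l with h1 | rfl | h1
  · rw [merge_of_lt h1, merge_of_lt h1, h i (by omega)]
  · rw [merge_self, merge_self, h i (by omega), h (i + 1) (by omega), h (i + 2) (by omega)]
  · rw [merge_of_gt h1, merge_of_gt h1, h (i + 2) (by omega)]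

lemma cubicFreq_congr (β : Fin d → ℝ) (L : ℝ) {l M : ℕ} (hl : l < M) {R R' : ℕ → Label d}
    (h : ∀ i < M + 2, R i = R' i) : cubicFreq β L l R = cubicFreq β L l R' := by
  rw [cubicFreq, cubicFreq, merge_congr hl h hl, h l (by omega), h (l + 1) (by omega),
    h (l + 2) (by omega)]

lemma pathLevel_congr_idx {f f' : ℕ → ℕ} {n : ℕ} (h : ∀ j < n, f j = f' j) (K : ℕ → Label d) :
    pathLevel f K n = pathLevel f' K n := by
  induction n with
  | zero => rfl
  | succ n ih =>
    rw [pathLevel, pathLevel, ih fun j hj => h j (by omega), h n (by omega)]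

lemma pathLevel_update {f : ℕ → ℕ} {N l j : ℕ} (hj : j ≤ N) (K : ℕ → Label d) :
    pathLevel (Function.update f N l) K j = pathLevel f K j :=
  pathLevel_congr_idx (fun i hi => Function.update_of_ne (by omega) _ _) K

lemma pathFreq_update_of_lt (β : Fin d → ℝ) (L : ℝ) {f : ℕ → ℕ} {N l j : ℕ} (hj : j < N)
    (K : ℕ → Label d) :
    pathFreq β L (Function.update f N l) K j = pathFreq β L f K j := by
  rw [pathFreq, pathFreq, pathLevel_update hj.le, Function.update_of_ne hj.ne]

lemma pathFreq_update_self (β : Fin d → ℝ) (L : ℝ) (f : ℕ → ℕ) (N l : ℕ) (K : ℕ → Label d) :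
    pathFreq β L (Function.update f N l) K N = (-1) ^ l * cubicFreq β L l (pathLevel f K N) := by
  rw [pathFreq, pathLevel_update le_rfl, Function.update_self]

lemma pathLevel_congr {M N : ℕ} (h : Forest M N) {K K' : ℕ → Label d}
    (hK : ∀ i < M + 2 * N, K i = K' i) {j : ℕ} (hj : j ≤ N) :
    ∀ i < M + 2 * (N - j), pathLevel h.idx K j i = pathLevel h.idx K' j i := by
  induction j with
  | zero => exact hK
  | succ j ih =>
    intro i hi
    have h1 := h.idx_lt (j := j) (by omega)
    exact merge_congr (M := M + 2 * (N - (j + 1))) (by omega)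
      (fun i hi => ih (by omega) i (by omega)) hi

end merging

/-! ### Sums over forests -/

/-- The contribution of the history `f` with `N` interactions to the sum over forests; `e` is the
parity of the position `0`, and `g` is a function of the roots. -/
noncomputable def treeTerm {d : ℕ} (β : Fin d → ℝ) (L : ℝ) (N : ℕ) (e : ℝ) (f : ℕ → ℕ)
    (g : (ℕ → Label d) → ℂ) (K : ℕ → Label d) (t : ℝ) : ℂ :=
  (∏ j ∈ Finset.range N, (Complex.I * ((e * (-1) ^ f j : ℝ) : ℂ))) * g (pathLevel f K N) *
    iterInt N t fun j => e * pathFreq β L f K j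

/-- The sum over all forests with `N` interactions and `M` roots. -/
noncomputable def forestSum {d : ℕ} (β : Fin d → ℝ) (L : ℝ) (M N : ℕ) (e : ℝ)
    (g : (ℕ → Label d) → ℂ) (K : ℕ → Label d) (t : ℝ) : ℂ :=
  ∑ h : Forest M N, treeTerm β L N e h.idx g K t

/-- The function of the `M + 2` wave numbers before the last interaction, at position `l` and
time `t`. -/
noncomputable def stepObs {d : ℕ} (β : Fin d → ℝ) (L : ℝ) (l : ℕ) (e t : ℝ)
    (g : (ℕ → Label d) → ℂ) (R : ℕ → Label d) : ℂ :=
  phase t (e * ((-1) ^ l * cubicFreq β L l R)) * g (merge l R)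

section forestSums

variable {d : ℕ} (β : Fin d → ℝ) (L : ℝ)

lemma forestSum_zero (M : ℕ) (e : ℝ) (g : (ℕ → Label d) → ℂ) (K : ℕ → Label d) (t : ℝ) :
    forestSum β L M 0 e g K t = g K := by
  simp [forestSum, treeTerm, iterInt, pathLevel]

lemma treeTerm_succ_time_zero (N : ℕ) (e : ℝ) (f : ℕ → ℕ) (g : (ℕ → Label d) → ℂ)
    (K : ℕ → Label d) : treeTerm β L (N + 1) e f g K 0 = 0 := by
  rw [treeTerm, iterInt_succ_zero, mul_zero]

lemma forestSum_succ_time_zero (M N : ℕ) (e : ℝ) (g : (ℕ → Label d) → ℂ) (K : ℕ → Label d) :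
    forestSum β L M (N + 1) e g K 0 = 0 :=
  Finset.sum_eq_zero fun h _ => treeTerm_succ_time_zero β L N e h.idx g K

lemma treeTerm_update (N : ℕ) (e : ℝ) (f : ℕ → ℕ) (l : ℕ) (g : (ℕ → Label d) → ℂ)
    (K : ℕ → Label d) (t : ℝ) :
    treeTerm β L (N + 1) e (Function.update f N l) g K t =
      (Complex.I * ((e * (-1) ^ l : ℝ) : ℂ)) *
        ((∏ j ∈ Finset.range N, (Complex.I * ((e * (-1) ^ f j : ℝ) : ℂ))) *
          g (merge l (pathLevel f K N)) *
          iterInt (N + 1) t (Function.update (fun j => e * pathFreq β L f K j) N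
            (e * ((-1) ^ l * cubicFreq β L l (pathLevel f K N))))) := by
  have h1 : ∏ j ∈ Finset.range (N + 1),
      (Complex.I * ((e * (-1) ^ (Function.update f N l) j : ℝ) : ℂ)) =
      (∏ j ∈ Finset.range N, (Complex.I * ((e * (-1) ^ f j : ℝ) : ℂ))) *
        (Complex.I * ((e * (-1) ^ l : ℝ) : ℂ)) := by
    rw [Finset.prod_range_succ, Function.update_self]
    congr 1
    refine Finset.prod_congr rfl fun j hj => ?_
    rw [Function.update_of_ne (Finset.mem_range.mp hj).ne]
  have h2 : pathLevel (Function.update f N l) K (N + 1) = merge l (pathLevel f K N) := by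
    rw [pathLevel, pathLevel_update le_rfl, Function.update_self]
  have h3 : iterInt (N + 1) t (fun j => e * pathFreq β L (Function.update f N l) K j) =
      iterInt (N + 1) t (Function.update (fun j => e * pathFreq β L f K j) N
            (e * ((-1) ^ l * cubicFreq β L l (pathLevel f K N)))) := by
    refine iterInt_congr _ _ fun j hj => ?_
    rcases Nat.lt_succ_iff_lt_or_eq.mp hj with hj | rfl
    · rw [pathFreq_update_of_lt β L hj, Function.update_of_ne hj.ne]
    · rw [pathFreq_update_self, Function.update_self]
  rw [treeTerm, h1, h2, h3]
  ring

/-- Differentiating in `t` pins the last interaction to the time `t`. Its phase and its merging are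
then absorbed into a new function of the roots below it, and one interaction fewer is left. -/
lemma hasDerivAt_treeTerm_update (N : ℕ) (e : ℝ) (f : ℕ → ℕ) (l : ℕ) (g : (ℕ → Label d) → ℂ)
    (K : ℕ → Label d) (t : ℝ) :
    HasDerivAt (fun t => treeTerm β L (N + 1) e (Function.update f N l) g K t)
      ((Complex.I * ((e * (-1) ^ l : ℝ) : ℂ)) * treeTerm β L N e f (stepObs β L l e t g) K t) t := by
  simp only [treeTerm_update]
  refine HasDerivAt.const_mul _ ?_
  have h := (hasDerivAt_iterInt N (Function.update (fun j => e * pathFreq β L f K j) N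
            (e * ((-1) ^ l * cubicFreq β L l (pathLevel f K N)))) t).const_mul
    ((∏ j ∈ Finset.range N, (Complex.I * ((e * (-1) ^ f j : ℝ) : ℂ))) *
          g (merge l (pathLevel f K N)))
  convert h using 1
  rw [Function.update_self, iterInt_congr N t (Ω' := fun j => e * pathFreq β L f K j) fun j hj =>
    Function.update_of_ne hj.ne _ _, treeTerm, stepObs]
  ring

lemma hasDerivAt_forestSum_succ (M N : ℕ) (e : ℝ) (g : (ℕ → Label d) → ℂ) (K : ℕ → Label d)
    (t : ℝ) : HasDerivAt (fun t => forestSum β L M (N + 1) e g K t)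
      (∑ l ∈ Finset.range M, (Complex.I * ((e * (-1) ^ l : ℝ) : ℂ)) *
        forestSum β L (M + 2) N e (stepObs β L l e t g) K t) t := by
  have h : (fun t => forestSum β L M (N + 1) e g K t) = fun t => ∑ l ∈ Finset.range M,
      ∑ h : Forest (M + 2) N, treeTerm β L (N + 1) e (Function.update h.idx N l) g K t := by
    funext t
    exact sum_forest_succ M N fun f => treeTerm β L (N + 1) e f g K t
  rw [h]
  refine HasDerivAt.fun_sum fun l _ => ?_
  rw [forestSum, Finset.mul_sum]
  exact HasDerivAt.fun_sum fun h _ => hasDerivAt_treeTerm_update β L N e h.idx l g K t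

/-- The time derivative of `forestSum`. -/
noncomputable def forestDeriv (M : ℕ) (e : ℝ) (g : (ℕ → Label d) → ℂ) (K : ℕ → Label d) (t : ℝ) :
    ℕ → ℂ
  | 0 => 0
  | N + 1 => ∑ l ∈ Finset.range M, (Complex.I * ((e * (-1) ^ l : ℝ) : ℂ)) *
        forestSum β L (M + 2) N e (stepObs β L l e t g) K t

lemma hasDerivAt_forestSum (M N : ℕ) (e : ℝ) (g : (ℕ → Label d) → ℂ) (K : ℕ → Label d) (t : ℝ) :
    HasDerivAt (fun t => forestSum β L M N e g K t) (forestDeriv β L M e g K t N) t := by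
  rcases N with - | N
  · simp only [forestSum_zero]
    exact hasDerivAt_const _ _
  · exact hasDerivAt_forestSum_succ β L M N e g K t

lemma dependsOnFirst_stepObs {M l : ℕ} (hl : l < M) (e t : ℝ) {g : (ℕ → Label d) → ℂ}
    (hg : DependsOnFirst M g) : DependsOnFirst (M + 2) (stepObs β L l e t g) := by
  intro R R' h
  rw [stepObs, stepObs, cubicFreq_congr β L hl h, hg _ _ fun i hi => merge_congr hl h hi]

lemma forestSum_congr {M N : ℕ} (e : ℝ) {g : (ℕ → Label d) → ℂ} (hg : DependsOnFirst M g)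
    {K K' : ℕ → Label d} (h : ∀ i < M + 2 * N, K i = K' i) (t : ℝ) :
    forestSum β L M N e g K t = forestSum β L M N e g K' t := by
  refine Finset.sum_congr rfl fun f _ => ?_
  rw [treeTerm, treeTerm, hg _ _ fun i hi => pathLevel_congr f h le_rfl i (by omega),
    iterInt_congr N t fun j hj => ?_]
  have h1 := f.idx_lt hj
  rw [pathFreq, pathFreq, cubicFreq_congr β L (M := M + 2 * (N - (j + 1))) (by omega) fun i hi =>
    pathLevel_congr f h hj.le i (by omega)]

/-- Juxtaposition of forests. -/
theorem sum_forestSum_mul_forestSum (S : ℕ) : ∀ (M M' : ℕ) (e : ℝ) (g g' : (ℕ → Label d) → ℂ),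
    DependsOnFirst M g → ∀ (K : ℕ → Label d) (t : ℝ),
    ∑ p ∈ Finset.HasAntidiagonal.antidiagonal S, forestSum β L M p.1 e g K t *
        forestSum β L M' p.2 (e * (-1) ^ M) g' (shift (M + 2 * p.1) K) t =
      forestSum β L (M + M') S e (fun R => g R * g' (shift M R)) K t := by
  induction S with
  | zero =>
    intro M M' e g g' hg K t
    simp [forestSum_zero]
  | succ S ih =>
    intro M M' e g g' hg K
    -- Instead of shuffling the interaction times of the two forests combinatorially, both sides are
    -- compared as functions of `t`: they agree at `t = 0` and have the same derivative by induction
    -- on the number of interactions.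
    set F : ℝ → ℂ := fun t => ∑ p ∈ Finset.HasAntidiagonal.antidiagonal (S + 1),
      forestSum β L M p.1 e g K t *
        forestSum β L M' p.2 (e * (-1) ^ M) g' (shift (M + 2 * p.1) K) t with hF
    set G : ℝ → ℂ := fun t => forestSum β L (M + M') (S + 1) e
      (fun R => g R * g' (shift M R)) K t with hG
    have hG' : ∀ t, HasDerivAt G (∑ l ∈ Finset.range (M + M'),
        (Complex.I * ((e * (-1) ^ l : ℝ) : ℂ)) * forestSum β L (M + M' + 2) S e
          (stepObs β L l e t fun R => g R * g' (shift M R)) K t) t := fun t =>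
      hasDerivAt_forestSum_succ β L (M + M') S e _ K t
    have hfst : ∀ t, HasDerivAt (fun t => ∑ p ∈ Finset.HasAntidiagonal.antidiagonal (S + 1),
        forestSum β L M p.1 e g K t *
        forestSum β L M' p.2 (e * (-1) ^ M) g' (shift (M + 2 * p.1) K) t) _ t := fun t =>
      HasDerivAt.fun_sum fun p _ => (hasDerivAt_forestSum β L M p.1 e g K t).fun_mul
        (hasDerivAt_forestSum β L M' p.2 (e * (-1) ^ M) g' (shift (M + 2 * p.1) K) t)
    have hF' : ∀ t, HasDerivAt F (∑ l ∈ Finset.range (M + M'),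
        (Complex.I * ((e * (-1) ^ l : ℝ) : ℂ)) * forestSum β L (M + M' + 2) S e
          (stepObs β L l e t fun R => g R * g' (shift M R)) K t) t := by
      intro t
      convert hfst t using 1
      rw [Finset.sum_add_distrib, Finset.Nat.sum_antidiagonal_succ, Finset.Nat.sum_antidiagonal_succ',
        Finset.sum_range_add]
      simp only [forestDeriv, zero_mul, mul_zero, zero_add, add_zero]
      congr 1
      -- The last interaction belongs to the left forest, at one of the positions `l < M`. The left
      -- forest then has `M + 2` roots, and the roots of the right one are shifted by two places.
      · simp only [Finset.sum_mul]
        rw [Finset.sum_comm]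
        refine Finset.sum_congr rfl fun l hl => ?_
        rw [Finset.mem_range] at hl
        have h1 := ih (M + 2) M' e (stepObs β L l e t g) g'
          (dependsOnFirst_stepObs β L hl e t hg) K t
        rw [show M + M' + 2 = M + 2 + M' by omega]
        have h2 : (stepObs β L l e t fun R => g R * g' (shift M R)) =
            fun R => stepObs β L l e t g R * g' (shift (M + 2) R) := by
          funext R
          simp only [stepObs, shift_merge_of_lt hl, mul_assoc]
        rw [h2, ← h1, Finset.mul_sum]
        refine Finset.sum_congr rfl fun p _ => ?_
        -- The shift by two places does not change the parity sign of the right forest.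
        rw [pow_add, neg_one_sq, mul_one, show M + 2 + 2 * p.1 = M + 2 * (p.1 + 1) by ring]
        ring
      -- The last interaction belongs to the right forest, at position `M + l` of the juxtaposition;
      -- the sign `(-1)^(M+l)` splits into the parity of the right forest and its own sign.
      · simp only [Finset.mul_sum]
        rw [Finset.sum_comm]
        refine Finset.sum_congr rfl fun l hl => ?_
        rw [Finset.mem_range] at hl
        have h1 := ih M (M' + 2) e g (stepObs β L l (e * (-1) ^ M) t g') hg K t
        rw [show M + M' + 2 = M + (M' + 2) by omega]
        have h2 : (stepObs β L (M + l) e t fun R => g R * g' (shift M R)) =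
            fun R => g R * stepObs β L l (e * (-1) ^ M) t g' (shift M R) := by
          funext R
          have h3 : g (merge (M + l) R) = g R :=
            hg _ _ fun i hi => merge_of_lt (by omega) R
          simp only [stepObs, shift_merge_add, cubicFreq_add, h3, pow_add]
          rw [show e * ((-1 : ℝ) ^ M * (-1) ^ l * cubicFreq β L l (shift M R)) =
            e * (-1) ^ M * ((-1) ^ l * cubicFreq β L l (shift M R)) by ring]
          ring
        rw [h2, ← h1, Finset.mul_sum]
        refine Finset.sum_congr rfl fun p _ => ?_
        rw [pow_add, ← mul_assoc e]
        ring
    have h0 : F 0 = G 0 := by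
      rw [hF, hG]
      simp only
      rw [forestSum_succ_time_zero]
      refine Finset.sum_eq_zero fun p hp => ?_
      rw [Finset.HasAntidiagonal.mem_antidiagonal] at hp
      rcases hp1 : p.1 with - | n
      · rw [show p.2 = S + 1 by omega, forestSum_succ_time_zero, mul_zero]
      · rw [forestSum_succ_time_zero, zero_mul]
    intro t
    have hd : ∀ t, HasDerivAt (fun t => F t - G t) 0 t := fun t => by
      have := (hF' t).fun_sub (hG' t)
      rwa [sub_self] at this
    have hconst := is_const_of_deriv_eq_zero (fun t => (hd t).differentiableAt)
      (fun t => (hd t).deriv) t 0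
    rw [h0, sub_self] at hconst
    exact sub_eq_zero.mp hconst

lemma norm_prefactor (N : ℕ) {e : ℝ} (he : |e| = 1) (f : ℕ → ℕ) :
    ‖∏ j ∈ Finset.range N, (Complex.I * ((e * (-1) ^ f j : ℝ) : ℂ))‖ = 1 := by
  rw [norm_prod]
  refine Finset.prod_eq_one fun j _ => ?_
  rw [norm_mul, Complex.norm_I, one_mul, Complex.norm_real, Real.norm_eq_abs, abs_mul, he, abs_pow,
    abs_neg, abs_one, one_pow, mul_one]

lemma norm_forestSum_le (M N : ℕ) {e : ℝ} (he : |e| = 1) {g : (ℕ → Label d) → ℂ}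
    (hg : ∀ R, ‖g R‖ ≤ 1) (K : ℕ → Label d) {t : ℝ} (ht : 0 ≤ t) :
    ‖forestSum β L M N e g K t‖ ≤ Fintype.card (Forest M N) * t ^ N := by
  rw [← nsmul_eq_mul, ← Finset.card_univ]
  refine (norm_sum_le _ _).trans (Finset.sum_le_card_nsmul _ _ _ fun h _ => ?_)
  rw [treeTerm, norm_mul, norm_mul, norm_prefactor N he, one_mul]
  exact (mul_le_of_le_one_left (norm_nonneg _) (hg _)).trans (norm_iterInt_le N ht _)

lemma continuous_forestSum (M N : ℕ) (e : ℝ) (g : (ℕ → Label d) → ℂ) (K : ℕ → Label d) :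
    Continuous fun t => forestSum β L M N e g K t := by
  unfold forestSum treeTerm
  exact continuous_finsetSum _ fun h _ => continuous_const.mul (continuous_iterInt _ _)

lemma conj_forestSum (M N : ℕ) (e : ℝ) (g : (ℕ → Label d) → ℂ) (K : ℕ → Label d) (t : ℝ) :
    conj (forestSum β L M N e g K t) = forestSum β L M N (-e) (fun R => conj (g R)) K t := by
  unfold forestSum treeTerm
  rw [map_sum]
  refine Finset.sum_congr rfl fun h _ => ?_
  rw [map_mul, map_mul, map_prod, conj_iterInt]
  congr 1
  · congr 1
    refine Finset.prod_congr rfl fun j _ => ?_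
    rw [map_mul, Complex.conj_I, Complex.conj_ofReal]
    push_cast
    ring
  · simp only [neg_mul]

end forestSums

end FeynmanTree

namespace FeynmanTree

/-! ### Splitting off the degenerate interactions -/

/-- A finite vector, continued by zero. -/
def extend {d n : ℕ} (k : Fin n → Label d) : ℕ → Label d := fun m =>
  if hm : m < n then k ⟨m, hm⟩ else 0

lemma extend_of_lt {d n : ℕ} {k : Fin n → Label d} {m : ℕ} (hm : m < n) :
    extend k m = k ⟨m, hm⟩ := dif_pos hm

section degenerate

variable {d : ℕ}

/-- The indicator function of both roots being `k₀`. -/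
def bothRoots (k₀ : Label d) (R : ℕ → Label d) : ℂ := if R 0 = k₀ ∧ R 1 = k₀ then 1 else 0

/-- The indicator function of both roots being equal. -/
def equalRoots (R : ℕ → Label d) : ℂ := if R 0 = R 1 then 1 else 0

/-- The indicator function of a nondegenerate interaction at position `l ∈ {0, 1}` which leads to
the roots `k₀`. -/
def nondeg (k₀ : Label d) (l : ℕ) (R : ℕ → Label d) : ℂ :=
  if (merge l R 0 = k₀ ∧ merge l R 1 = k₀) ∧ R l ≠ R (l + 1) ∧ R (l + 2) ≠ R (l + 1) then 1 else 0

lemma dependsOnFirst_bothRoots (k₀ : Label d) : DependsOnFirst 2 (bothRoots k₀) := by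
  intro R R' h
  rw [bothRoots, bothRoots, h 0 (by omega), h 1 (by omega)]

lemma dependsOnFirst_equalRoots : DependsOnFirst 2 (equalRoots (d := d)) := by
  intro R R' h
  rw [equalRoots, equalRoots, h 0 (by omega), h 1 (by omega)]

lemma norm_bothRoots_le (k₀ : Label d) (R : ℕ → Label d) : ‖bothRoots k₀ R‖ ≤ 1 := by
  unfold bothRoots; split_ifs <;> simp

lemma norm_equalRoots_le (R : ℕ → Label d) : ‖equalRoots R‖ ≤ 1 := by
  unfold equalRoots; split_ifs <;> simp

/-- Polarisation: for a quadratic form, `Q(a - b + c) - Q(a) + Q(b) - Q(c)` is twice the bilinear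
form of `a - b` and `c - b`. -/
lemma cubicFreq_eq (β : Fin d → ℝ) (L : ℝ) (l : ℕ) (R : ℕ → Label d) :
    cubicFreq β L l R = 2 * form β (R l - R (l + 1)) (R (l + 2) - R (l + 1)) / L ^ 2 := by
  simp only [cubicFreq, merge_self, Q, wave, form]
  rw [← Finset.sum_sub_distrib, ← Finset.sum_add_distrib, ← Finset.sum_sub_distrib, Finset.mul_sum,
    Finset.sum_div]
  refine Finset.sum_congr rfl fun i _ => ?_
  simp only [Pi.add_apply, Pi.sub_apply]
  push_cast
  ring

/-- For roots `x, y, z, w`, let `A` be `x = y, z = w = k₀`, let `B` be `y = z, x = w = k₀`, and let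
`C` be `z = w, x = y = k₀`. Position 0 contributes the union of `A` and `B`, position 1 that of `B`
and `C`. Both overlaps are the case where all four equal `k₀`, so the difference is `A` minus `C`.
-/
lemma degenerate_sub (k₀ : Label d) (R : ℕ → Label d) :
    (bothRoots k₀ (merge 0 R) - nondeg k₀ 0 R) - (bothRoots k₀ (merge 1 R) - nondeg k₀ 1 R) =
      equalRoots R * bothRoots k₀ (shift 2 R) - bothRoots k₀ R * equalRoots (shift 2 R) := by
  have h1 : merge 0 R 0 = R 0 - R 1 + R 2 := merge_self 0 R
  have h2 : merge 0 R 1 = R 3 := merge_of_gt (by omega) R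
  have h3 : merge 1 R 0 = R 0 := merge_of_lt (by omega) R
  have h4 : merge 1 R 1 = R 1 - R 2 + R 3 := merge_self 1 R
  simp only [bothRoots, equalRoots, nondeg, h1, h2, h3, h4, shift, Nat.reduceAdd, zero_add, add_zero]
  generalize R 0 = x
  generalize R 1 = y
  generalize R 2 = z
  generalize R 3 = w
  by_cases hxy : x = y
  · subst hxy
    by_cases hyz : x = z
    · subst hyz
      by_cases hw : x = w
      · subst hw; simp
      · by_cases hx : x = k₀
        · subst hx; simp [hw, Ne.symm hw]
        · simp [hx]
    · by_cases hzw : z = w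
      · subst hzw
        simp [hyz, Ne.symm hyz]
      · simp [hyz, Ne.symm hyz, hzw, Ne.symm hzw]
  · by_cases hyz : y = z
    · subst hyz
      simp [hxy]
      grind
    · by_cases hzw : z = w
      · subst hzw
        simp [hxy, hyz, Ne.symm hyz, and_comm]
      · simp [hxy, hyz, Ne.symm hyz, hzw, Ne.symm hzw]

/-- Degenerate interactions are exactly resonant, because one argument of the bilinear form
vanishes. In the degenerate part the last frequency may therefore be replaced by 0. -/
lemma cubicFreq_eq_zero_or (β : Fin d → ℝ) (L : ℝ) (k₀ : Label d) (l : ℕ) (R : ℕ → Label d) :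
    cubicFreq β L l R = 0 ∨ bothRoots k₀ (merge l R) - nondeg k₀ l R = 0 := by
  by_cases h : R l ≠ R (l + 1) ∧ R (l + 2) ≠ R (l + 1)
  · right
    simp [bothRoots, nondeg, h]
  · left
    rw [not_and_or, not_not, not_not] at h
    rw [cubicFreq_eq]
    rcases h with h | h <;> simp [h, form]

variable (β : Fin d → ℝ) (L : ℝ)

/-- The frequencies of a forest, with a given frequency of one more interaction. -/
noncomputable def lastFreq (N : ℕ) (f : ℕ → ℕ) (K : ℕ → Label d) (w : ℝ) : ℕ → ℝ :=
  Function.update (fun j => 1 * pathFreq β L f K j) N w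

/-- The product of the factors `±i` of a forest. -/
noncomputable def forestSign (N : ℕ) (f : ℕ → ℕ) : ℂ :=
  ∏ j ∈ Finset.range N, (Complex.I * ((1 * (-1) ^ f j : ℝ) : ℂ))

/-- The time integrated sum over forests with four roots. -/
noncomputable def integratedForestSum (N : ℕ) (g : (ℕ → Label d) → ℂ) (K : ℕ → Label d) (t : ℝ) :
    ℂ := ∫ s in (0 : ℝ)..t, forestSum β L 4 N 1 g K s

/-- The nondegenerate part of the sum over forests with two roots. -/
noncomputable def nondegSum (N : ℕ) (k₀ : Label d) (K : ℕ → Label d) (t : ℝ) : ℂ :=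
  ∑ l ∈ Finset.range 2, (Complex.I * ((1 * (-1) ^ l : ℝ) : ℂ)) * ∑ h : Forest 4 N,
    forestSign N h.idx * nondeg k₀ l (pathLevel h.idx K N) * iterInt (N + 1) t
      (lastFreq β L N h.idx K (1 * ((-1) ^ l * cubicFreq β L l (pathLevel h.idx K N))))

lemma integratedForestSum_eq (N : ℕ) (g : (ℕ → Label d) → ℂ) (K : ℕ → Label d) (t : ℝ) :
    integratedForestSum β L N g K t = ∑ h : Forest 4 N, forestSign N h.idx *
      g (pathLevel h.idx K N) * iterInt (N + 1) t (lastFreq β L N h.idx K 0) := by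
  simp only [integratedForestSum, forestSum, treeTerm]
  have hi : ∀ h ∈ (Finset.univ : Finset (Forest 4 N)), IntervalIntegrable (fun s =>
      (∏ j ∈ Finset.range N, (Complex.I * ((1 * (-1) ^ h.idx j : ℝ) : ℂ))) *
        g (pathLevel h.idx K N) * iterInt N s fun j => 1 * pathFreq β L h.idx K j) volume 0 t :=
    fun h _ => (continuous_const.mul (continuous_iterInt _ _)).intervalIntegrable _ _
  rw [intervalIntegral.integral_finsetSum hi]
  refine Finset.sum_congr rfl fun h _ => ?_
  rw [intervalIntegral.integral_const_mul, iterInt, lastFreq, Function.update_self]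
  simp only [phase_zero_right, one_mul, forestSign]
  congr 1
  refine intervalIntegral.integral_congr fun u _ => ?_
  exact iterInt_congr N u fun j hj => (Function.update_of_ne hj.ne _ _).symm

lemma integratedForestSum_sub (N : ℕ) (g g' : (ℕ → Label d) → ℂ) (K : ℕ → Label d) (t : ℝ) :
    integratedForestSum β L N g K t - integratedForestSum β L N g' K t =
      integratedForestSum β L N (fun R => g R - g' R) K t := by
  simp only [integratedForestSum_eq, ← Finset.sum_sub_distrib]
  exact Finset.sum_congr rfl fun h _ => by ring

/-- The last interaction sits at position 0 or 1, with opposite signs. Its degenerate part does not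
oscillate in the last time variable, so it is a plain time integral of a forest with four roots, and
`degenerate_sub` brings the difference to product form. -/
lemma forestSum_bothRoots (N : ℕ) (k₀ : Label d) (K : ℕ → Label d) (t : ℝ) :
    forestSum β L 2 (N + 1) 1 (bothRoots k₀) K t = nondegSum β L N k₀ K t + Complex.I *
      (integratedForestSum β L N (fun R => equalRoots R * bothRoots k₀ (shift 2 R)) K t -
       integratedForestSum β L N (fun R => bothRoots k₀ R * equalRoots (shift 2 R)) K t) := by
  have h1 : forestSum β L 2 (N + 1) 1 (bothRoots k₀) K t = nondegSum β L N k₀ K t +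
      ∑ l ∈ Finset.range 2, (Complex.I * ((1 * (-1) ^ l : ℝ) : ℂ)) * integratedForestSum β L N
        (fun R => bothRoots k₀ (merge l R) - nondeg k₀ l R) K t := by
    rw [forestSum, sum_forest_succ 2 N fun f => treeTerm β L (N + 1) 1 f (bothRoots k₀) K t,
      nondegSum, ← Finset.sum_add_distrib]
    refine Finset.sum_congr rfl fun l _ => ?_
    rw [← mul_add, integratedForestSum_eq, ← Finset.sum_add_distrib, Finset.mul_sum]
    refine Finset.sum_congr rfl fun h _ => ?_
    rw [treeTerm_update]
    congr 1
    rcases cubicFreq_eq_zero_or β L k₀ l (pathLevel h.idx K N) with h0 | h0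
    · rw [h0, mul_zero, mul_zero, ← add_mul, ← mul_add, add_sub_cancel]
      rfl
    · rw [h0, mul_zero, zero_mul, add_zero, ← sub_eq_zero.mp h0]
      rfl
  rw [h1, Finset.sum_range_succ, Finset.sum_range_one, integratedForestSum_sub]
  congr 1
  simp only [← degenerate_sub, ← integratedForestSum_sub]
  push_cast
  ring

end degenerate

/-! ### Cancellation of the degenerate interactions by rotating the leaves -/

section rotation

variable {d : ℕ} (β : Fin d → ℝ) (L : ℝ)

/-- The time integral of a product of two sums over forests with two roots. -/
noncomputable def pairIntegral (a b : ℕ) (g g' : (ℕ → Label d) → ℂ) (K : ℕ → Label d) (t : ℝ) : ℂ :=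
  ∫ s in (0 : ℝ)..t, forestSum β L 2 a 1 g K s * forestSum β L 2 b 1 g' (shift (2 + 2 * a) K) s

/-- This reads `sum_forestSum_mul_forestSum` backwards: a product function of the two pairs of roots
decouples the forest. Both factors carry the sign 1, as the second one starts two roots further on.
-/
lemma integratedForestSum_mul (N : ℕ) {g : (ℕ → Label d) → ℂ} (g' : (ℕ → Label d) → ℂ)
    (hg : DependsOnFirst 2 g) (K : ℕ → Label d) (t : ℝ) :
    integratedForestSum β L N (fun R => g R * g' (shift 2 R)) K t =
      ∑ p ∈ Finset.HasAntidiagonal.antidiagonal N, pairIntegral β L p.1 p.2 g g' K t := by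
  unfold pairIntegral
  have hi : ∀ p ∈ Finset.HasAntidiagonal.antidiagonal N, IntervalIntegrable (fun s =>
      forestSum β L 2 p.1 1 g K s * forestSum β L 2 p.2 1 g' (shift (2 + 2 * p.1) K) s)
      volume 0 t := fun p _ => ((continuous_forestSum β L _ _ _ _ _).mul
        (continuous_forestSum β L _ _ _ _ _)).intervalIntegrable _ _
  rw [← intervalIntegral.integral_finsetSum hi]
  refine intervalIntegral.integral_congr fun s _ => ?_
  have := sum_forestSum_mul_forestSum β L N 2 2 1 g g' hg K s
  simp only [neg_one_sq, mul_one] at this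
  exact this.symm

lemma pairIntegral_rotate (a b : ℕ) {g g' : (ℕ → Label d) → ℂ} (hg : DependsOnFirst 2 g)
    (hg' : DependsOnFirst 2 g') {K K' : ℕ → Label d} (h1 : ∀ i < 2 + 2 * a, K i = K' (2 + 2 * b + i))
    (h2 : ∀ i < 2 + 2 * b, K (2 + 2 * a + i) = K' i) (t : ℝ) :
    pairIntegral β L a b g g' K t = pairIntegral β L b a g' g K' t := by
  unfold pairIntegral
  refine intervalIntegral.integral_congr fun s _ => ?_
  rw [mul_comm, forestSum_congr β L 1 hg' (K := shift (2 + 2 * a) K) (K' := K') h2,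
    forestSum_congr β L 1 hg (K := K) (K' := shift (2 + 2 * b) K') h1]

lemma norm_pairIntegral_le (a b : ℕ) {g g' : (ℕ → Label d) → ℂ} (hg : ∀ R, ‖g R‖ ≤ 1)
    (hg' : ∀ R, ‖g' R‖ ≤ 1) (K : ℕ → Label d) {t : ℝ} (ht : 0 ≤ t) :
    ‖pairIntegral β L a b g g' K t‖ ≤
      (Fintype.card (Forest 2 a) * t ^ a) * (Fintype.card (Forest 2 b) * t ^ b) * t := by
  have := intervalIntegral.norm_integral_le_of_norm_le_const (a := 0) (b := t)
    (f := fun s => forestSum β L 2 a 1 g K s * forestSum β L 2 b 1 g' (shift (2 + 2 * a) K) s)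
    (C := (Fintype.card (Forest 2 a) * t ^ a) * (Fintype.card (Forest 2 b) * t ^ b)) ?_
  · rwa [sub_zero, abs_of_nonneg ht] at this
  · intro s hs
    rw [Set.uIoc_of_le ht] at hs
    rw [norm_mul]
    refine mul_le_mul ((norm_forestSum_le β L 2 a abs_one hg _ hs.1.le).trans ?_)
      ((norm_forestSum_le β L 2 b abs_one hg' _ hs.1.le).trans ?_) (norm_nonneg _) (by positivity)
    · exact mul_le_mul_of_nonneg_left (pow_le_pow_left₀ hs.1.le hs.2 _) (Nat.cast_nonneg _)
    · exact mul_le_mul_of_nonneg_left (pow_le_pow_left₀ hs.1.le hs.2 _) (Nat.cast_nonneg _)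

lemma nat_even_add_mod_iff (N : ℕ) (j c : ℕ) (hc : Even c) :
    Even ((j + c) % (2 * N)) ↔ Even j := by
  rw [Nat.even_iff, Nat.mod_mod_of_dvd _ (Dvd.intro _ rfl), ← Nat.even_iff, Nat.even_add]
  simp [hc]

/-- The sums over wave numbers with weights which are invariant under rotations by an even number
of places see no difference between the two degenerate interactions. -/
lemma tsum_degenerate_eq_zero (N : ℕ) (k₀ : Label d) {t : ℝ} (ht : 0 ≤ t)
    (A : (Fin (2 * N + 4) → Label d) → ℂ) (hA : Summable A)
    (hrot : ∀ c : Fin (2 * N + 4), Even (c : ℕ) → ∀ K, A (fun j => K (j + c)) = A K) :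
    ∑' K : Fin (2 * N + 4) → Label d, A K *
      (integratedForestSum β L N (fun R => equalRoots R * bothRoots k₀ (shift 2 R)) (extend K) t -
       integratedForestSum β L N (fun R => bothRoots k₀ R * equalRoots (shift 2 R)) (extend K) t)
      = 0 := by
  have hsum : ∀ (a b : ℕ) {g g' : (ℕ → Label d) → ℂ}, (∀ R, ‖g R‖ ≤ 1) → (∀ R, ‖g' R‖ ≤ 1) →
      Summable fun K : Fin (2 * N + 4) → Label d => A K * pairIntegral β L a b g g' (extend K) t := by
    intro a b g g' hg hg'
    refine Summable.of_norm_bounded (hA.norm.mul_right ((Fintype.card (Forest 2 a) * t ^ a) *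
      (Fintype.card (Forest 2 b) * t ^ b) * t)) fun K => ?_
    rw [norm_mul]
    exact mul_le_mul_of_nonneg_left (norm_pairIntegral_le β L a b hg hg' _ ht) (norm_nonneg _)
  have hswap : ∀ (a b : ℕ), a + b = N →
      ∑' K : Fin (2 * N + 4) → Label d, A K * pairIntegral β L a b equalRoots (bothRoots k₀)
        (extend K) t =
      ∑' K : Fin (2 * N + 4) → Label d, A K * pairIntegral β L b a (bothRoots k₀) equalRoots
        (extend K) t := by
    intro a b hab
    -- The second forest has `2 + 2b` leaves. Rotating by this even number brings it to the front
    -- and the first one behind it, while the weight `A` does not change.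
    set c : Fin (2 * N + 4) := ⟨2 + 2 * b, by omega⟩ with hc
    have hce : Even (c : ℕ) := by
      rw [hc]
      simp [Nat.even_add]
    rw [← (Equiv.arrowCongr (Equiv.addRight c) (Equiv.refl (Label d))).symm.tsum_eq]
    refine tsum_congr fun K => ?_
    have hK : (Equiv.arrowCongr (Equiv.addRight c) (Equiv.refl (Label d))).symm K =
        fun j => K (j + c) := rfl
    rw [hK, hrot c hce]
    congr 1
    refine pairIntegral_rotate β L a b dependsOnFirst_equalRoots (dependsOnFirst_bothRoots k₀)
      (fun i hi => ?_) (fun i hi => ?_) t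
    · rw [extend_of_lt (by omega), extend_of_lt (by omega)]
      congr 1
      refine Fin.ext ?_
      rw [Fin.val_add, hc]
      simp only
      rw [Nat.mod_eq_of_lt (by omega)]
      omega
    · rw [extend_of_lt (by omega), extend_of_lt (by omega)]
      congr 1
      refine Fin.ext ?_
      rw [Fin.val_add, hc]
      simp only
      rw [show 2 + 2 * a + i + (2 + 2 * b) = i + (2 * N + 4) by omega, Nat.add_mod_right,
        Nat.mod_eq_of_lt (by omega)]
  simp only [integratedForestSum_mul β L N (bothRoots k₀) dependsOnFirst_equalRoots,
    integratedForestSum_mul β L N equalRoots (dependsOnFirst_bothRoots k₀)]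
  simp only [mul_sub, Finset.mul_sum]
  rw [Summable.tsum_sub (summable_sum fun p _ => hsum _ _ norm_equalRoots_le (norm_bothRoots_le k₀))
    (summable_sum fun p _ => hsum _ _ (norm_bothRoots_le k₀) norm_equalRoots_le),
    Summable.tsum_finsetSum fun p _ => hsum _ _ norm_equalRoots_le (norm_bothRoots_le k₀),
    Summable.tsum_finsetSum fun p _ => hsum _ _ (norm_bothRoots_le k₀) norm_equalRoots_le,
    ← Finset.Nat.sum_antidiagonal_swap, sub_eq_zero]
  refine Finset.sum_congr rfl fun p hp => ?_
  rw [Finset.HasAntidiagonal.mem_antidiagonal] at hp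
  exact hswap p.2 p.1 (by omega)

end rotation

end FeynmanTree

namespace FeynmanTree

open scoped ENNReal

/-! ### Bounds for the nondegenerate interactions -/

/-- The wave numbers on all levels are integer combinations of those on level `0`, with
coefficients which sum up to `1`. -/
lemma exists_coefficients {d M N n : ℕ} (hn : M + 2 * N ≤ n) (f : Forest M N) {j : ℕ} (hj : j ≤ N) :
    ∃ c : ℕ → Fin n → ℤ, ∀ i < M + 2 * (N - j), ∑ m, c i m = 1 ∧
      ∀ K : Fin n → Label d, pathLevel f.idx (extend K) j i = comb (c i) K := by
  induction j with
  | zero =>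
    refine ⟨fun i m => if i = m then 1 else 0, fun i hi => ?_⟩
    have hin : i < n := by omega
    have h0 : ∀ m : Fin n, (i = m) = ((⟨i, hin⟩ : Fin n) = m) := fun m => by
      rw [Fin.ext_iff]
    refine ⟨by simp [h0], fun K => ?_⟩
    rw [pathLevel, extend_of_lt hin]
    simp [comb, h0]
  | succ j ih =>
    obtain ⟨c, hc⟩ := ih (by omega)
    have hl := f.idx_lt (j := j) (by omega)
    refine ⟨fun i => if i < f.idx j then c i else if i = f.idx j then
      c i - c (i + 1) + c (i + 2) else c (i + 2), fun i hi => ?_⟩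
    rcases lt_trichotomy i (f.idx j) with h | h | h
    · simp only [h, if_true]
      refine ⟨(hc i (by omega)).1, fun K => ?_⟩
      rw [pathLevel, merge_of_lt h, (hc i (by omega)).2]
    · simp only [h, lt_irrefl, if_true, if_false]
      rw [← h]
      refine ⟨?_, fun K => ?_⟩
      · simp only [Pi.add_apply, Pi.sub_apply, Finset.sum_add_distrib, Finset.sum_sub_distrib,
          (hc i (by omega)).1, (hc (i + 1) (by omega)).1, (hc (i + 2) (by omega)).1]
        norm_num
      · rw [pathLevel, ← h, merge_self, (hc i (by omega)).2, (hc (i + 1) (by omega)).2,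
          (hc (i + 2) (by omega)).2]
        simp only [comb, Pi.add_apply, Pi.sub_apply, add_smul, sub_smul, Finset.sum_add_distrib,
          Finset.sum_sub_distrib]
    · simp only [h.not_gt, h.ne', if_false]
      refine ⟨(hc (i + 2) (by omega)).1, fun K => ?_⟩
      rw [pathLevel, merge_of_gt h, (hc (i + 2) (by omega)).2]

/-- The coefficients of a combination of repeated vectors. -/
def collect {n v : ℕ} (q : Fin n → Fin v) (c : Fin n → ℤ) (i : Fin v) : ℤ :=
  ∑ m ∈ Finset.univ.filter fun m => q m = i, c m

lemma sum_collect {n v : ℕ} (q : Fin n → Fin v) (c : Fin n → ℤ) : ∑ i, collect q c i = ∑ m, c m :=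
  Finset.sum_fiberwise _ _ _

lemma comb_collect {d n v : ℕ} (q : Fin n → Fin v) (c : Fin n → ℤ) (x : Fin v → Label d) :
    comb (collect q c) x = comb c fun m => x (q m) := by
  simp only [comb, collect, Finset.sum_smul]
  rw [← Finset.sum_fiberwise Finset.univ q fun m => c m • x (q m)]
  refine Finset.sum_congr rfl fun i _ => Finset.sum_congr rfl fun m hm => ?_
  rw [(Finset.mem_filter.mp hm).2]

lemma comb_sub {d n : ℕ} (c c' : Fin n → ℤ) (x : Fin n → Label d) :
    comb c x - comb c' x = comb (c - c') x := by
  simp only [comb, Pi.sub_apply, sub_smul, Finset.sum_sub_distrib]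

/-- Repetitions only add factors at most 1, and surjectivity guarantees at least one factor for each
vector. -/
lemma prod_decay_comp_le {d n v : ℕ} (N : ℕ) {L : ℝ} (hL : 1 ≤ L) {q : Fin n → Fin v}
    (hq : Function.Surjective q) (x : Fin v → Label d) :
    ∏ m, decay N L (x (q m)) ≤ ∏ i, decay N L (x i) := by
  rw [← Finset.prod_fiberwise Finset.univ q fun m => decay N L (x (q m))]
  refine Finset.prod_le_prod (fun i _ => Finset.prod_nonneg fun m _ => (decay_pos N hL _).le)
    fun i _ => ?_
  rw [Finset.prod_congr rfl fun m hm => by rw [(Finset.mem_filter.mp hm).2], Finset.prod_const]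
  obtain ⟨m, hm⟩ := hq i
  refine pow_le_of_le_one (decay_pos N hL _).le (decay_le_one N hL _) (Finset.card_ne_zero.mpr ?_)
  exact ⟨m, by simp [hm]⟩

section kernel

variable {d : ℕ} (β : Fin d → ℝ) (L t : ℝ)

/-- The resolvent of a nondegenerate interaction at position `l ∈ {0, 1}`; one root is fixed. -/
noncomputable def nondegKer (k₀ : Label d) (l : ℕ) (R : ℕ → Label d) : ℝ :=
  if R (if l = 0 then 3 else 0) = k₀ ∧ R l - R (l + 1) ≠ 0 ∧ R (l + 2) - R (l + 1) ≠ 0 then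
    (t⁻¹ + |form β (R l - R (l + 1)) (R (l + 2) - R (l + 1))| / L ^ 2)⁻¹ else 0

lemma nondegKer_nonneg {t : ℝ} (ht : 0 < t) (k₀ : Label d) (l : ℕ) (R : ℕ → Label d) :
    0 ≤ nondegKer β L t k₀ l R := by
  unfold nondegKer
  split_ifs <;> positivity

/-- The resolvent is gained from the outermost time only; the other time integrals are bounded by
`t^N`. Of the two root conditions just one is kept, at the root which the last interaction leaves
untouched: this is `R 3` for `l = 0` and `R 0` for `l = 1`. -/
lemma norm_nondegSum_le {L t : ℝ} (hL : 1 ≤ L) (ht : 0 < t) (N : ℕ) (k₀ : Label d)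
    (K : ℕ → Label d) :
    ‖nondegSum β L N k₀ K t‖ ≤ 4 * t ^ N * ∑ l ∈ Finset.range 2, ∑ h : Forest 4 N,
      nondegKer β L t k₀ l (pathLevel h.idx K N) := by
  have hL0 : 0 < L := by linarith
  rw [nondegSum, Finset.mul_sum]
  refine (norm_sum_le _ _).trans (Finset.sum_le_sum fun l hl => ?_)
  rw [norm_mul, norm_mul, Complex.norm_I, Complex.norm_real, Real.norm_eq_abs, one_mul, one_mul,
    abs_pow, abs_neg, abs_one, one_pow, one_mul, Finset.mul_sum]
  refine (norm_sum_le _ _).trans (Finset.sum_le_sum fun h _ => ?_)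
  set R := pathLevel h.idx K N
  rw [norm_mul, norm_mul, forestSign, norm_prefactor N abs_one, one_mul]
  by_cases hc : (merge l R 0 = k₀ ∧ merge l R 1 = k₀) ∧ R l ≠ R (l + 1) ∧ R (l + 2) ≠ R (l + 1)
  · have hroot : R (if l = 0 then 3 else 0) = k₀ := by
      rw [Finset.mem_range] at hl
      interval_cases l
      · rw [← hc.1.2, merge_of_gt (by omega)]; rfl
      · rw [← hc.1.1, merge_of_lt (by omega)]; rfl
    rw [nondeg, if_pos hc, nondegKer, if_pos ⟨hroot, sub_ne_zero.mpr hc.2.1, sub_ne_zero.mpr hc.2.2⟩,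
      norm_one, one_mul]
    refine (norm_iterInt_succ_le N ht _).trans ?_
    have hf : |form β (R l - R (l + 1)) (R (l + 2) - R (l + 1))| / L ^ 2 ≤
        |lastFreq β L N h.idx K (1 * ((-1) ^ l * cubicFreq β L l R)) N| := by
      rw [lastFreq, Function.update_self, one_mul, abs_mul, abs_pow, abs_neg, abs_one, one_pow,
        one_mul, cubicFreq_eq, abs_div, abs_mul, abs_two, abs_of_pos (by positivity : 0 < L ^ 2)]
      gcongr
      linarith [abs_nonneg (form β (R l - R (l + 1)) (R (l + 2) - R (l + 1)))]
    have := inv_pos.mpr ht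
    gcongr
  · rw [nondeg, if_neg hc, norm_zero, zero_mul]
    exact mul_nonneg (by positivity) (nondegKer_nonneg β L ht _ _ _)

end kernel

/-- The sum over all wave numbers with a given pattern of coincidences. -/
lemma tsum_nondegKer_le {d : ℕ} (hd : 3 ≤ d) {β : Fin d → ℝ} (hβ : Generic β) (N : ℕ)
    (h : Forest 4 N) {l : ℕ} (hl : l < 2) {v : ℕ} (hv : v ≤ N + 2) {q : Fin (2 * N + 4) → Fin v}
    (hq : Function.Surjective q) :
    ∃ C : ℝ, 0 < C ∧ ∀ L : ℝ, 1 ≤ L → ∀ t : ℝ, 0 < t → t ≤ L ^ d → ∀ k₀ : Label d,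
      ∑' x : Fin v → Label d, ENNReal.ofReal ((∏ m, decay ((2 * d + 1) * 3) L (x (q m))) *
        nondegKer β L t k₀ l (pathLevel h.idx (extend fun m => x (q m)) N)) ≤
      ENNReal.ofReal (C * L ^ (d * (N + 1)) * Real.log (2 + t) ^ 2) := by
  obtain ⟨c, hc⟩ := exists_coefficients (d := d) (n := 2 * N + 4) (by omega) h le_rfl
  have h4 : ∀ i < 4, i < 4 + 2 * (N - N) := fun i hi => by omega
  have ho : (if l = 0 then 3 else 0) < 4 := by split_ifs <;> omega
  -- Identifying leaves adds their coefficients and preserves the total: it is 1 for a root, hence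
  -- `1 - 1 = 0` for the two differences.
  obtain ⟨C, hC, hle⟩ := pairing_sum_le hd hβ (collect q (c (if l = 0 then 3 else 0)))
    (collect q (c l - c (l + 1))) (collect q (c (l + 2) - c (l + 1)))
    (by rw [sum_collect, (hc _ (h4 _ ho)).1])
    (by rw [sum_collect]; simp [(hc l (h4 _ (by omega))).1, (hc (l + 1) (h4 _ (by omega))).1])
    (by rw [sum_collect]; simp [(hc (l + 2) (h4 _ (by omega))).1, (hc (l + 1) (h4 _ (by omega))).1])
  refine ⟨C, hC, fun L hL t ht htL k₀ => ?_⟩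
  refine le_trans (ENNReal.tsum_le_tsum fun x => ?_) ((hle L hL t ht htL k₀).trans ?_)
  · simp only [comb_collect, ← comb_sub]
    rw [← (hc _ (h4 _ ho)).2, ← (hc l (h4 _ (by omega))).2, ← (hc (l + 1) (h4 _ (by omega))).2,
      ← (hc (l + 2) (h4 _ (by omega))).2, nondegKer]
    generalize (if l = 0 then 3 else 0) = o
    split_ifs with h1
    · refine ENNReal.ofReal_le_ofReal ?_
      rw [mul_comm]
      exact mul_le_mul_of_nonneg_left (prod_decay_comp_le _ hL hq x) (by positivity)
    · simp
  -- At most `N + 2` different vectors with one constraint leave at most `N + 1` free sums, and `L ≥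
  -- 1`.
  · refine ENNReal.ofReal_le_ofReal ?_
    gcongr
    omega

lemma tsum_le_sum_tsum_of_cover {α ι : Type*} [Fintype ι] {γ : ι → Type*} (e : ∀ i, γ i → α)
    (F : α → ℝ≥0∞) (hF : ∀ a, F a ≠ 0 → ∃ i y, e i y = a) :
    ∑' a, F a ≤ ∑ i, ∑' y, F (e i y) := by
  have hex : ∀ a : Function.support F, ∃ p : Σ i, γ i, e p.1 p.2 = a := fun a => by
    obtain ⟨i, y, h⟩ := hF a a.2
    exact ⟨⟨i, y⟩, h⟩
  choose s hs using hex
  have hinj : Function.Injective s := fun a b hab => Subtype.ext (by rw [← hs a, ← hs b, hab])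
  calc ∑' a, F a = ∑' a : Function.support F, F a :=
        (tsum_subtype_eq_of_support_subset subset_rfl).symm
    _ = ∑' a : Function.support F, F (e (s a).1 (s a).2) := by simp only [hs]
    _ ≤ ∑' p : Σ i, γ i, F (e p.1 p.2) :=
        ENNReal.tsum_comp_le_tsum_of_injective hinj fun p => F (e p.1 p.2)
    _ = ∑ i, ∑' y, F (e i y) := by rw [ENNReal.tsum_sigma', tsum_fintype]

/-- Every value is attained at an even position. -/
def EvenCovered {d n : ℕ} (K : Fin n → Label d) : Prop := ∀ m, ∃ m' : Fin n, Even (m' : ℕ) ∧ K m' = K m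

/-- Among `2N + 4` positions `N + 2` are even, and they already exhibit all values. Thus the
assignment factors through at most `N + 2` vectors, with finitely many patterns that depend on `N`
only. -/
lemma EvenCovered.exists_factorization {d N : ℕ} {K : Fin (2 * N + 4) → Label d}
    (hK : EvenCovered K) : ∃ (v : Fin (N + 3)) (q : Fin (2 * N + 4) → Fin v)
      (x : Fin v → Label d), Function.Surjective q ∧ (fun m => x (q m)) = K := by
  classical
  set I := Finset.univ.image K with hI
  have hcard : I.card ≤ N + 2 := by
    have hsub : I ⊆ Finset.univ.image fun i : Fin (N + 2) => K ⟨2 * i, by omega⟩ := by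
      intro y hy
      obtain ⟨m, -, rfl⟩ := Finset.mem_image.mp hy
      obtain ⟨m', ⟨r, hr⟩, hm'⟩ := hK m
      refine Finset.mem_image.mpr ⟨⟨r, by omega⟩, Finset.mem_univ _, ?_⟩
      rw [← hm']
      congr 1
      exact Fin.ext (by simp only; omega)
    exact (Finset.card_le_card hsub).trans (Finset.card_image_le.trans (by simp))
  refine ⟨⟨I.card, by omega⟩, fun m => I.equivFin ⟨K m, by simp [hI]⟩, fun i => I.equivFin.symm i,
    fun i => ?_, ?_⟩
  · obtain ⟨m, -, hm⟩ := Finset.mem_image.mp (I.equivFin.symm i).2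
    refine ⟨m, ?_⟩
    simp only [hm]
    exact I.equivFin.apply_symm_apply i
  · funext m
    simp

/-- The absolute value of the product of the amplitudes. -/
noncomputable def weight {d n : ℕ} (φ : EuclideanSpace ℝ (Fin d) → ℝ) (L : ℝ)
    (K : Fin n → Label d) : ℝ := ∏ m, √(φ (wave L (K m)))

lemma weight_nonneg {d n : ℕ} (φ : EuclideanSpace ℝ (Fin d) → ℝ) (L : ℝ) (K : Fin n → Label d) :
    0 ≤ weight φ L K := Finset.prod_nonneg fun _ _ => Real.sqrt_nonneg _

lemma norm_le_norm_wave {d : ℕ} {L : ℝ} (hL : 1 ≤ L) (m : Label d) : ‖m‖ / L ≤ ‖wave L m‖ := by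
  have hL0 : 0 < L := by linarith
  rcases eq_or_ne m 0 with rfl | hm
  · simp
  · obtain ⟨i, hi⟩ := exists_abs_eq_norm hm
    have := PiLp.norm_apply_le (wave L m) i
    rw [← hi]
    refine le_trans (le_of_eq ?_) this
    rw [wave, PiLp.toLp_apply, Real.norm_eq_abs, abs_div, abs_of_pos hL0]

lemma exists_sqrt_le_decay {d : ℕ} {φ : EuclideanSpace ℝ (Fin d) → ℝ}
    (hφ : ∀ N : ℕ, ∃ A : ℝ, ∀ x, ‖x‖ ^ N * φ x ≤ A) (N : ℕ) :
    ∃ B : ℝ, 0 < B ∧ ∀ L : ℝ, 1 ≤ L → ∀ m : Label d, √(φ (wave L m)) ≤ B * decay N L m := by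
  obtain ⟨A0, hA0⟩ := hφ 0
  -- Twice the exponent, because the amplitude is the square root of `φ`. The case `N = 0` of the
  -- hypothesis covers small wave numbers.
  obtain ⟨A1, hA1⟩ := hφ (2 * N)
  set B : ℝ := 2 ^ (2 * N) * (|A0| + |A1| + 1) with hB
  have hBpos : 0 < B := by positivity
  refine ⟨√B, Real.sqrt_pos.mpr hBpos, fun L hL m => ?_⟩
  have hL0 : 0 < L := by linarith
  have hb := one_le_one_add_norm_div hL m
  have hdec : decay N L m = √(((1 + ‖m‖ / L) ^ (2 * N))⁻¹) := by
    rw [decay, mul_comm 2 N, pow_mul, Real.sqrt_inv, Real.sqrt_sq (by positivity)]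
  rw [hdec, ← Real.sqrt_mul hBpos.le]
  refine Real.sqrt_le_sqrt ?_
  rw [← div_eq_mul_inv, le_div_iff₀ (by positivity)]
  have hw := norm_le_norm_wave hL m
  set y := wave L m
  have h0 : φ y ≤ A0 := by simpa using hA0 y
  by_cases hφy : φ y ≤ 0
  · exact (mul_nonpos_of_nonpos_of_nonneg hφy (by positivity)).trans hBpos.le
  push Not at hφy
  rcases le_total (‖m‖ / L) 1 with h1 | h1
  · calc φ y * (1 + ‖m‖ / L) ^ (2 * N) ≤ |A0| * 2 ^ (2 * N) := by
          gcongr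
          · exact h0.trans (le_abs_self _)
          · linarith
      _ ≤ B := by
          rw [hB, mul_comm]
          gcongr
          linarith [abs_nonneg A1]
  · calc φ y * (1 + ‖m‖ / L) ^ (2 * N) ≤ φ y * (2 * ‖y‖) ^ (2 * N) := by
          gcongr
          linarith
      _ = 2 ^ (2 * N) * (‖y‖ ^ (2 * N) * φ y) := by rw [mul_pow]; ring
      _ ≤ 2 ^ (2 * N) * |A1| := by
          gcongr
          exact (hA1 y).trans (le_abs_self _)
      _ ≤ B := by
          rw [hB]
          gcongr
          linarith [abs_nonneg A0]

lemma weight_le {d n : ℕ} {φ : EuclideanSpace ℝ (Fin d) → ℝ} {B : ℝ} {N : ℕ} {L : ℝ}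
    (h : ∀ m : Label d, √(φ (wave L m)) ≤ B * decay N L m) (K : Fin n → Label d) :
    weight φ L K ≤ B ^ n * ∏ m, decay N L (K m) := by
  calc weight φ L K ≤ ∏ m, (B * decay N L (K m)) :=
        Finset.prod_le_prod (fun _ _ => Real.sqrt_nonneg _) fun m _ => h (K m)
    _ = _ := by rw [Finset.prod_mul_distrib, Finset.prod_const, Finset.card_univ, Fintype.card_fin]

lemma summable_weight {d : ℕ} (n : ℕ) {φ : EuclideanSpace ℝ (Fin d) → ℝ}
    (hφ : ∀ N : ℕ, ∃ A : ℝ, ∀ x, ‖x‖ ^ N * φ x ≤ A) {L : ℝ} (hL : 1 ≤ L) :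
    Summable fun K : Fin n → Label d => weight φ L K := by
  obtain ⟨B, hB, h⟩ := exists_sqrt_le_decay hφ (2 * d + 1)
  obtain ⟨C, hC, hsum⟩ := tsum_prod_decay_le d
  have hs : Summable fun K : Fin n → Label d => ∏ m, decay (2 * d + 1) L (K m) := by
    have h1 := (hsum L hL (Fin n)).trans_lt ENNReal.ofReal_lt_top
    have h2 := ENNReal.summable_toReal h1.ne
    refine h2.congr fun K => ?_
    rw [ENNReal.toReal_ofReal (Finset.prod_nonneg fun _ _ => (decay_pos _ hL _).le)]
  exact Summable.of_nonneg_of_le (weight_nonneg φ L) (weight_le (h L hL)) (hs.mul_left _)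

lemma tsum_sum_sum {α ι κ : Type*} (s : Finset ι) (s' : Finset κ) (F : ι → κ → α → ℝ≥0∞) :
    ∑' x, ∑ i ∈ s, ∑ j ∈ s', F i j x = ∑ i ∈ s, ∑ j ∈ s', ∑' x, F i j x := by
  rw [Summable.tsum_finsetSum fun _ _ => ENNReal.summable]
  exact Finset.sum_congr rfl fun i _ => Summable.tsum_finsetSum fun _ _ => ENNReal.summable

lemma tsum_le_of_cover {α ι κ κ' : Type*} [Fintype ι] [Fintype κ] [Fintype κ'] {γ : ι → Type*}
    (e : ∀ i, γ i → α) (F : α → ℝ≥0∞) (hF : ∀ a, F a ≠ 0 → ∃ i y, e i y = a)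
    (G : κ → κ' → α → ℝ≥0∞) (c : ℝ≥0∞) (hFG : ∀ a, F a ≤ c * ∑ l, ∑ h, G l h a)
    (E : κ → κ' → ι → ℝ≥0∞) (hG : ∀ l h i, ∑' y, G l h (e i y) ≤ E l h i) :
    ∑' a, F a ≤ ∑ i, c * ∑ l, ∑ h, E l h i := by
  refine (tsum_le_sum_tsum_of_cover e F hF).trans (Finset.sum_le_sum fun i _ => ?_)
  refine (ENNReal.tsum_le_tsum fun y => hFG (e i y)).trans ?_
  rw [ENNReal.tsum_mul_left, tsum_sum_sum]
  exact mul_le_mul' le_rfl (Finset.sum_le_sum fun l _ => Finset.sum_le_sum fun h _ => hG l h i)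

/-- The nondegenerate part of the sum over all wave numbers. -/
lemma tsum_nondegSum_le {d : ℕ} (hd : 3 ≤ d) {β : Fin d → ℝ} (hβ : Generic β)
    {φ : EuclideanSpace ℝ (Fin d) → ℝ} (hφ : ∀ N : ℕ, ∃ A : ℝ, ∀ x, ‖x‖ ^ N * φ x ≤ A) (N : ℕ) :
    ∃ C : ℝ, 0 < C ∧ ∀ L : ℝ, 1 ≤ L → ∀ t : ℝ, 0 < t → t ≤ L ^ d → ∀ k₀ : Label d,
      ∀ A : (Fin (2 * N + 4) → Label d) → ℂ, (∀ K, ‖A K‖ ≤ weight φ L K) →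
      (∀ K, A K ≠ 0 → EvenCovered K) →
      ∑' K : Fin (2 * N + 4) → Label d, ENNReal.ofReal ‖A K * nondegSum β L N k₀ (extend K) t‖ ≤
      ENNReal.ofReal (C * t ^ N * L ^ (d * (N + 1)) * Real.log (2 + t) ^ 2) := by
  obtain ⟨B, hB, hdec⟩ := exists_sqrt_le_decay hφ ((2 * d + 1) * 3)
  -- The finite set of coincidence patterns, independent of `L`, `t` and `k₀`; the constant is a sum
  -- over it, over the histories and over the two positions of the last interaction.
  let ι := Σ v : Fin (N + 3), {q : Fin (2 * N + 4) → Fin v // Function.Surjective q}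
  have hker : ∀ (l : Fin 2) (h : Forest 4 N) (p : ι), _ := fun l h p =>
    tsum_nondegKer_le hd hβ N h l.2 (v := p.1) (by have := p.1.2; omega) p.2.2
  choose C hC hle using hker
  refine ⟨B ^ (2 * N + 4) * 4 * ∑ p : ι, ∑ l, ∑ h, C l h p + 1, ?_, ?_⟩
  · have : 0 ≤ ∑ p : ι, ∑ l, ∑ h, C l h p := Finset.sum_nonneg fun p _ =>
      Finset.sum_nonneg fun l _ => Finset.sum_nonneg fun h _ => (hC l h p).le
    positivity
  intro L hL t ht htL k₀ A hA hcov
  have hL0 : 0 < L := by linarith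
  have hpt : ∀ K : Fin (2 * N + 4) → Label d,
      ENNReal.ofReal ‖A K * nondegSum β L N k₀ (extend K) t‖ ≤
      ENNReal.ofReal (B ^ (2 * N + 4) * 4 * t ^ N) * ∑ l : Fin 2, ∑ h : Forest 4 N,
        ENNReal.ofReal ((∏ m, decay ((2 * d + 1) * 3) L (K m)) *
          nondegKer β L t k₀ l (pathLevel h.idx (extend K) N)) := by
    intro K
    have hp : 0 ≤ ∏ m, decay ((2 * d + 1) * 3) L (K m) :=
      Finset.prod_nonneg fun _ _ => (decay_pos _ hL _).le
    have hk : ∀ l h, 0 ≤ (∏ m, decay ((2 * d + 1) * 3) L (K m)) *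
          nondegKer β L t k₀ l (pathLevel h (extend K) N) := fun l h =>
      mul_nonneg hp (nondegKer_nonneg β L ht _ _ _)
    simp only [← ENNReal.ofReal_sum_of_nonneg fun h _ => hk _ _]
    rw [← ENNReal.ofReal_sum_of_nonneg fun l _ => Finset.sum_nonneg fun h _ => hk _ _,
      ← ENNReal.ofReal_mul (by positivity)]
    refine ENNReal.ofReal_le_ofReal ?_
    rw [norm_mul]
    refine (mul_le_mul ((hA K).trans (weight_le (hdec L hL) K)) (norm_nondegSum_le β hL ht N k₀ _)
      (norm_nonneg _) (by positivity)).trans (le_of_eq ?_)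
    rw [← Fin.sum_univ_eq_sum_range (fun l => ∑ h : Forest 4 N,
      nondegKer β L t k₀ l (pathLevel h.idx (extend K) N))]
    simp only [← Finset.mul_sum]
    ring
  calc _ ≤ ∑ p : ι, ENNReal.ofReal (B ^ (2 * N + 4) * 4 * t ^ N) * ∑ l : Fin 2, ∑ h : Forest 4 N,
        ENNReal.ofReal (C l h p * L ^ (d * (N + 1)) * Real.log (2 + t) ^ 2) := by
        refine tsum_le_of_cover (ι := ι) (γ := fun p => Fin p.1 → Label d)
          (fun p x m => x (p.2.1 m)) _ (fun K hK => ?_) _ _ hpt _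
          fun l h p => hle l h p L hL t ht htL k₀
        have hAK : A K ≠ 0 := fun h0 => hK (by simp [h0])
        obtain ⟨v, q, x, hq, hx⟩ := (hcov K hAK).exists_factorization
        exact ⟨⟨v, q, hq⟩, x, hx⟩
    _ = ENNReal.ofReal (B ^ (2 * N + 4) * 4 * t ^ N * ∑ p : ι, ∑ l : Fin 2, ∑ h : Forest 4 N,
        (C l h p * L ^ (d * (N + 1)) * Real.log (2 + t) ^ 2)) := by
        have hn : ∀ l h p, 0 ≤ C l h p * L ^ (d * (N + 1)) * Real.log (2 + t) ^ 2 := fun l h p =>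
          mul_nonneg (mul_nonneg (hC l h p).le (by positivity)) (sq_nonneg _)
        rw [ENNReal.ofReal_mul (p := B ^ (2 * N + 4) * 4 * t ^ N) (by positivity), ← Finset.mul_sum,
          ENNReal.ofReal_sum_of_nonneg fun p _ => Finset.sum_nonneg fun l _ =>
            Finset.sum_nonneg fun h _ => hn l h p]
        simp only [ENNReal.ofReal_sum_of_nonneg fun l _ => Finset.sum_nonneg fun h _ => hn l h _,
          ENNReal.ofReal_sum_of_nonneg fun h _ => hn _ h _]
    _ ≤ _ := by
        refine ENNReal.ofReal_le_ofReal ?_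
        simp only [← Finset.sum_mul]
        have h0 : 0 ≤ t ^ N * L ^ (d * (N + 1)) * Real.log (2 + t) ^ 2 := by positivity
        generalize (∑ p : ι, ∑ l, ∑ h, C l h p) = X
        linear_combination h0

end FeynmanTree

namespace FeynmanTree

/-! ### Expectations of products of amplitudes -/

/-- The amplitude `signedAmp` as a function of the phase. -/
noncomputable def phaseAmp {d : ℕ} (φ : EuclideanSpace ℝ (Fin d) → ℝ) (L : ℝ) (pos : ℕ)
    (m : Label d) (x : ℝ) : ℂ :=
  if Even pos then (√(φ (wave L m)) : ℂ) * Complex.exp (Complex.I * (x : ℂ))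
  else conj ((√(φ (wave L m)) : ℂ) * Complex.exp (Complex.I * (x : ℂ)))

/-- The product of the amplitudes of the leaves. -/
noncomputable def ampProd {d n : ℕ} (φ : EuclideanSpace ℝ (Fin d) → ℝ) (L : ℝ) (θ : Label d → ℝ)
    (K : Fin n → Label d) : ℂ := ∏ j : Fin n, signedAmp φ L θ j (K j)

section amplitudes

variable {d : ℕ} (φ : EuclideanSpace ℝ (Fin d) → ℝ) (L : ℝ)

lemma signedAmp_eq (θ : Label d → ℝ) (pos : ℕ) (m : Label d) :
    signedAmp φ L θ pos m = phaseAmp φ L pos m (θ m) := rfl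

lemma norm_phaseAmp (pos : ℕ) (m : Label d) (x : ℝ) :
    ‖phaseAmp φ L pos m x‖ = √(φ (wave L m)) := by
  have h : ‖(√(φ (wave L m)) : ℂ) * Complex.exp (Complex.I * (x : ℂ))‖ = √(φ (wave L m)) := by
    rw [norm_mul, mul_comm Complex.I, Complex.norm_exp_ofReal_mul_I, mul_one, Complex.norm_real,
      Real.norm_of_nonneg (Real.sqrt_nonneg _)]
  unfold phaseAmp
  split_ifs
  · exact h
  · rw [RCLike.norm_conj, h]

lemma continuous_phaseAmp (pos : ℕ) (m : Label d) : Continuous (phaseAmp φ L pos m) := by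
  unfold phaseAmp
  split_ifs
  · fun_prop
  · exact Complex.continuous_conj.comp (by fun_prop)

lemma phaseAmp_of_not_even {pos : ℕ} (hp : ¬ Even pos) (m : Label d) (x : ℝ) :
    phaseAmp φ L pos m x = √(φ (wave L m)) * Complex.exp (-Complex.I * (x : ℂ)) := by
  rw [phaseAmp, if_neg hp, map_mul, Complex.conj_ofReal, ← Complex.exp_conj, map_mul,
    Complex.conj_I, Complex.conj_ofReal]

lemma norm_ampProd {n : ℕ} (θ : Label d → ℝ) (K : Fin n → Label d) :
    ‖ampProd φ L θ K‖ = weight φ L K := by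
  simp only [ampProd, weight, norm_prod, signedAmp_eq, norm_phaseAmp]

lemma signedAmp_add_even (θ : Label d → ℝ) {p q : ℕ} (h : Even p ↔ Even q) (m : Label d) :
    signedAmp φ L θ p m = signedAmp φ L θ q m := by
  rw [signedAmp, signedAmp, if_congr h rfl rfl]

/-- Only the parity of its position matters for a leaf, and the number of leaves is even, so an even
rotation preserves parities even across the end. -/
lemma ampProd_rotate {N : ℕ} (θ : Label d → ℝ) (c : Fin (2 * N + 4)) (hc : Even (c : ℕ))
    (K : Fin (2 * N + 4) → Label d) :
    ampProd φ L θ (fun j => K (j + c)) = ampProd φ L θ K := by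
  unfold ampProd
  rw [← Equiv.prod_comp (Equiv.addRight c) fun j : Fin (2 * N + 4) => signedAmp φ L θ j (K j)]
  refine Finset.prod_congr rfl fun j _ => ?_
  refine signedAmp_add_even φ L θ ?_ _
  rw [Equiv.coe_addRight, Fin.val_add]
  exact (nat_even_add_mod_iff (N + 2) j c hc).symm

/-- After an odd number of leaves the parities of the second block are reversed, which is precisely
the complex conjugation of the second tree. -/
lemma ampProd_append {n n' : ℕ} (hn : ¬ Even n) (θ : Label d → ℝ) (K : Fin (n + n') → Label d) :
    ampProd φ L θ K = ampProd φ L θ (fun i => K (Fin.castAdd n' i)) *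
      conj (ampProd φ L θ fun i => K (Fin.natAdd n i)) := by
  unfold ampProd
  rw [Fin.prod_univ_add, map_prod]
  congr 1
  refine Finset.prod_congr rfl fun j _ => ?_
  rw [signedAmp, signedAmp, Fin.val_natAdd]
  by_cases hj : Even (j : ℕ)
  · rw [if_pos hj, if_neg (by rw [Nat.even_add]; tauto)]
  · rw [if_neg hj, if_pos (by rw [Nat.even_add]; tauto), Complex.conj_conj]

end amplitudes

section expectation

variable {d : ℕ} {φ : EuclideanSpace ℝ (Fin d) → ℝ} {L : ℝ} {Ω : Type*} [MeasurableSpace Ω]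
  {P : Measure Ω} {ϑ : Label d → Ω → ℝ}

lemma measurable_ampProd {n : ℕ} (hm : ∀ m, Measurable (ϑ m)) (K : Fin n → Label d) :
    Measurable fun w => ampProd φ L (fun m => ϑ m w) K := by
  unfold ampProd
  simp only [signedAmp_eq]
  exact Finset.measurable_fun_prod _ fun j _ => (continuous_phaseAmp φ L j (K j)).measurable.comp (hm _)

lemma integrable_ampProd [IsProbabilityMeasure P] {n : ℕ} (hm : ∀ m, Measurable (ϑ m)) (K : Fin n → Label d) :
    Integrable (fun w => ampProd φ L (fun m => ϑ m w) K) P :=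
  Integrable.of_bound (measurable_ampProd hm K).aestronglyMeasurable (weight φ L K)
    (Filter.Eventually.of_forall fun _ => (norm_ampProd φ L _ K).le)

lemma norm_integral_ampProd_le [IsProbabilityMeasure P] {n : ℕ} (K : Fin n → Label d) :
    ‖∫ w, ampProd φ L (fun m => ϑ m w) K ∂P‖ ≤ weight φ L K := by
  refine (norm_integral_le_of_norm_le_const (C := weight φ L K)
    (Filter.Eventually.of_forall fun _ => (norm_ampProd φ L _ K).le)).trans ?_
  simp

lemma integral_exp_uniform_eq_zero {X : Ω → ℝ} (hX : Measurable X)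
    (hunif : pdf.IsUniform X (Set.Icc 0 (2 * Real.pi)) P volume) {c : ℕ} (hc : c ≠ 0) :
    ∫ w, Complex.exp (-(c : ℂ) * Complex.I * (X w : ℂ)) ∂P = 0 := by
  have h1 : ∫ w, Complex.exp (-(c : ℂ) * Complex.I * (X w : ℂ)) ∂P =
      ∫ x, Complex.exp (-(c : ℂ) * Complex.I * (x : ℂ)) ∂(P.map X) := by
    rw [integral_map hX.aemeasurable]
    exact (by fun_prop : Continuous fun x : ℝ =>
      Complex.exp (-(c : ℂ) * Complex.I * (x : ℂ))).aestronglyMeasurable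
  have hc' : (-(c : ℂ) * Complex.I) ≠ 0 :=
    mul_ne_zero (neg_ne_zero.mpr (Nat.cast_ne_zero.mpr hc)) Complex.I_ne_zero
  have hexp : Complex.exp (-(c : ℂ) * Complex.I * ((2 * Real.pi : ℝ) : ℂ)) = 1 := by
    rw [Complex.exp_eq_one_iff]
    exact ⟨-c, by push_cast; ring⟩
  rw [h1, hunif, ProbabilityTheory.cond, integral_smul_measure, integral_Icc_eq_integral_Ioc,
    ← intervalIntegral.integral_of_le Real.two_pi_pos.le, integral_exp_mul_complex hc', hexp]
  simp

/-- A value occurring at odd positions only contributes, by independence, the factor `E e^{-icϑ}`,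
where `c ≥ 1` is its multiplicity. This is zero for a uniform phase. -/
lemma integral_ampProd_eq_zero {n : ℕ} (hm : ∀ m, Measurable (ϑ m)) (hind : iIndepFun ϑ P)
    (hunif : ∀ m, pdf.IsUniform (ϑ m) (Set.Icc 0 (2 * Real.pi)) P volume) {K : Fin n → Label d}
    (hK : ¬ EvenCovered K) : ∫ w, ampProd φ L (fun m => ϑ m w) K ∂P = 0 := by
  classical
  unfold EvenCovered at hK
  push Not at hK
  obtain ⟨m, hodd⟩ := hK
  set I := Finset.univ.image K with hI
  set F : I → ℝ → ℂ := fun z x =>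
    ∏ j ∈ Finset.univ.filter fun j => K j = z, phaseAmp φ L j z x with hF
  have hprod : ∀ w, ampProd φ L (fun m => ϑ m w) K = ∏ z : I, F z (ϑ z w) := by
    intro w
    rw [Finset.prod_coe_sort I fun z => ∏ j ∈ Finset.univ.filter fun j => K j = z,
      phaseAmp φ L j z (ϑ z w), ampProd]
    rw [← Finset.prod_fiberwise_of_maps_to (t := I) (g := K) fun j _ =>
      Finset.mem_image_of_mem K (Finset.mem_univ j)]
    refine Finset.prod_congr rfl fun z _ => Finset.prod_congr rfl fun j hj => ?_
    rw [signedAmp_eq, (Finset.mem_filter.mp hj).2]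
  have hFc : ∀ z, Continuous (F z) := fun z =>
    continuous_finsetProd _ fun j _ => continuous_phaseAmp φ L j z
  simp only [hprod]
  rw [iIndepFun.integral_fun_prod_comp (hind.precomp (g := ((↑) : I → Label d))
    Subtype.val_injective) (fun z => (hm z).aemeasurable) fun z => (hFc z).aestronglyMeasurable]
  refine Finset.prod_eq_zero (Finset.mem_univ ⟨K m, Finset.mem_image_of_mem K (Finset.mem_univ m)⟩) ?_
  set s := Finset.univ.filter fun j => K j = K m with hs
  have hsc : s.card ≠ 0 := Finset.card_ne_zero.mpr ⟨m, by simp [hs]⟩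
  have hval : ∀ x : ℝ, F ⟨K m, Finset.mem_image_of_mem K (Finset.mem_univ m)⟩ x =
      (√(φ (wave L (K m))) : ℂ) ^ s.card * Complex.exp (-(s.card : ℂ) * Complex.I * (x : ℂ)) := by
    intro x
    have h1 : ∀ j ∈ s, phaseAmp φ L j (K m) x =
        √(φ (wave L (K m))) * Complex.exp (-Complex.I * (x : ℂ)) := fun j hj =>
      phaseAmp_of_not_even φ L (fun he => hodd j he (Finset.mem_filter.mp hj).2) _ _
    rw [hF]
    simp only
    rw [Finset.prod_congr rfl h1, Finset.prod_const, mul_pow, ← Complex.exp_nat_mul]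
    congr 2
    ring
  simp only [hval]
  rw [integral_const_mul, integral_exp_uniform_eq_zero (hm _) (hunif _) hsc, mul_zero]

end expectation

/-! ### The Feynman trees as sums over forests -/

section trees

variable {d : ℕ} (β : Fin d → ℝ) (φ : EuclideanSpace ℝ (Fin d) → ℝ) (L : ℝ)

/-- The indicator function of the root being `k₀`. -/
def oneRoot (k₀ : Label d) (R : ℕ → Label d) : ℂ := if R 0 = k₀ then 1 else 0

lemma dependsOnFirst_oneRoot (k₀ : Label d) : DependsOnFirst 1 (oneRoot k₀) := by
  intro R R' h
  rw [oneRoot, oneRoot, h 0 (by omega)]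

lemma norm_oneRoot_le (k₀ : Label d) (R : ℕ → Label d) : ‖oneRoot k₀ R‖ ≤ 1 := by
  unfold oneRoot; split_ifs <;> simp

lemma conj_oneRoot (k₀ : Label d) (R : ℕ → Label d) : conj (oneRoot k₀ R) = oneRoot k₀ R := by
  unfold oneRoot; split_ifs <;> simp

lemma level_eq {n : ℕ} (h : History n) (k : Fin (2 * n + 1) → Label d) (j : ℕ) :
    level h k j = pathLevel h.idx (extend k) j := by
  induction j with
  | zero => rfl
  | succ j ih => rw [level, pathLevel, ih]

lemma freq_eq {n : ℕ} (h : History n) (k : Fin (2 * n + 1) → Label d) :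
    freq β L h k = pathFreq β L h.idx (extend k) := by
  funext j
  rw [freq, pathFreq, cubicFreq, level_eq, level_eq, pathLevel]

lemma sign_eq {n : ℕ} (h : History n) : h.sign = ∏ j ∈ Finset.range n, (-1 : ℂ) ^ h.idx j := by
  rw [History.sign, Finset.prod_range]
  refine Finset.prod_congr rfl fun j _ => ?_
  rw [History.idx, dif_pos j.2]

/-- The contribution of the leaves `k` to a Feynman tree without the amplitudes. -/
noncomputable def leafTerm {n : ℕ} (t : ℝ) (h : History n) (k₀ : Label d)
    (k : Fin (2 * n + 1) → Label d) : ℂ :=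
  treeTerm β L n 1 h.idx (oneRoot k₀) (extend k) t

variable {β φ L}

/-- Attaching one factor `±i` to each interaction makes a Feynman tree a forest with one root and
parity 1; the real prefactor `λ² / L^{2d}` stays outside. -/
lemma summand_eq {n : ℕ} {t : ℝ} (ht : 0 ≤ t) (θ : Label d → ℝ) (h : History n) (k₀ : Label d)
    (k : Fin (2 * n + 1) → Label d) :
    Complex.I ^ n * h.sign * summand β φ L t θ h k₀ k =
      ampProd φ L θ k * leafTerm β L t h k₀ k := by
  have hpre : ∏ j ∈ Finset.range n, (Complex.I * ((1 * (-1) ^ h.idx j : ℝ) : ℂ)) =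
      Complex.I ^ n * h.sign := by
    rw [Finset.prod_mul_distrib, Finset.prod_const, Finset.card_range, sign_eq]
    simp
  rw [leafTerm, treeTerm, hpre, summand, level_eq, freq_eq, oneRoot,
    timeIntegral_eq_iterInt n ht, ampProd]
  simp only [one_mul]
  split_ifs <;> ring

lemma norm_leafTerm_le {n : ℕ} {t : ℝ} (ht : 0 ≤ t) (h : History n) (k₀ : Label d)
    (k : Fin (2 * n + 1) → Label d) : ‖leafTerm β L t h k₀ k‖ ≤ t ^ n := by
  rw [leafTerm, treeTerm, norm_mul, norm_mul, norm_prefactor n abs_one, one_mul]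
  exact (mul_le_of_le_one_left (norm_nonneg _) (norm_oneRoot_le _ _)).trans (norm_iterInt_le n ht _)

lemma norm_I_pow_mul_sign {n : ℕ} (h : History n) : ‖Complex.I ^ n * h.sign‖ = 1 := by
  rw [sign_eq, norm_mul, norm_pow, Complex.norm_I, one_pow, one_mul, norm_prod]
  simp

lemma summable_ampProd_mul {n : ℕ} (hφ : ∀ N : ℕ, ∃ A : ℝ, ∀ x, ‖x‖ ^ N * φ x ≤ A) (hL : 1 ≤ L)
    (θ : Label d → ℝ) {T : (Fin n → Label d) → ℂ} {B : ℝ} (hT : ∀ k, ‖T k‖ ≤ B) :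
    Summable fun k : Fin n → Label d => ‖ampProd φ L θ k * T k‖ := by
  refine Summable.of_nonneg_of_le (fun _ => norm_nonneg _) (fun k => ?_)
    ((summable_weight n hφ hL).mul_right B)
  rw [norm_mul, norm_ampProd]
  exact mul_le_mul_of_nonneg_left (hT k) (weight_nonneg φ L k)

lemma summable_summand {n : ℕ} (hφ : ∀ N : ℕ, ∃ A : ℝ, ∀ x, ‖x‖ ^ N * φ x ≤ A) (hL : 1 ≤ L) {t : ℝ}
    (ht : 0 ≤ t) (θ : Label d → ℝ) (h : History n) (k₀ : Label d) :
    Summable (summand β φ L t θ h k₀) := by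
  have hne : Complex.I ^ n * h.sign ≠ 0 := by
    rw [← norm_ne_zero_iff, norm_I_pow_mul_sign]
    exact one_ne_zero
  rw [← summable_mul_left_iff hne]
  simp only [summand_eq ht]
  exact (summable_ampProd_mul hφ hL θ (norm_leafTerm_le ht h k₀)).of_norm

lemma J_eq {n : ℕ} (lam : ℝ) {t : ℝ} (ht : 0 ≤ t) (θ : Label d → ℝ) (h : History n) (k₀ : Label d) :
    J β φ L lam t θ h k₀ = ((lam ^ 2 / L ^ (2 * d) : ℝ) : ℂ) ^ n *
      ∑' k, ampProd φ L θ k * leafTerm β L t h k₀ k := by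
  rw [J, mul_pow]
  simp only [← summand_eq ht, tsum_mul_left]
  ring

/-- The contribution of the leaves `K` to the product of two Feynman trees without the
amplitudes. -/
noncomputable def pairTerm (β : Fin d → ℝ) (L : ℝ) {n n' : ℕ} (t : ℝ) (h : History n)
    (h' : History n') (k₀ : Label d) (K : Fin ((2 * n + 1) + (2 * n' + 1)) → Label d) : ℂ :=
  leafTerm β L t h k₀ (fun i => K (Fin.castAdd _ i)) *
    conj (leafTerm β L t h' k₀ fun i => K (Fin.natAdd _ i))

lemma norm_pairTerm_le {n n' : ℕ} {t : ℝ} (ht : 0 ≤ t) (h : History n) (h' : History n')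
    (k₀ : Label d) (K : Fin ((2 * n + 1) + (2 * n' + 1)) → Label d) :
    ‖pairTerm β L t h h' k₀ K‖ ≤ t ^ n * t ^ n' := by
  rw [pairTerm, norm_mul, RCLike.norm_conj]
  exact mul_le_mul (norm_leafTerm_le ht _ _ _) (norm_leafTerm_le ht _ _ _) (norm_nonneg _)
    (by positivity)

lemma J_mul_conj_J {n n' : ℕ} (hφ : ∀ N : ℕ, ∃ A : ℝ, ∀ x, ‖x‖ ^ N * φ x ≤ A) (hL : 1 ≤ L)
    (lam : ℝ) {t : ℝ} (ht : 0 ≤ t) (θ : Label d → ℝ) (h : History n) (h' : History n')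
    (k₀ : Label d) :
    J β φ L lam t θ h k₀ * conj (J β φ L lam t θ h' k₀) =
      ((lam ^ 2 / L ^ (2 * d) : ℝ) : ℂ) ^ (n + n') *
      ∑' K, ampProd φ L θ K * pairTerm β L t h h' k₀ K := by
  have hs := summable_ampProd_mul hφ hL θ (norm_leafTerm_le (β := β) (L := L) ht h k₀)
  have hs' := summable_ampProd_mul hφ hL θ (norm_leafTerm_le (β := β) (L := L) ht h' k₀)
  have hs'' : Summable fun k => ‖conj (ampProd φ L θ k * leafTerm β L t h' k₀ k)‖ := by
    simpa only [RCLike.norm_conj] using hs'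
  rw [J_eq lam ht, J_eq lam ht, map_mul, map_pow, Complex.conj_ofReal, Complex.conj_tsum, pow_add,
    mul_mul_mul_comm, tsum_mul_tsum_of_summable_norm hs hs'']
  congr 1
  rw [← (Fin.appendEquiv (2 * n + 1) (2 * n' + 1)).symm.tsum_eq]
  refine tsum_congr fun K => ?_
  rw [ampProd_append φ L (by simp) θ K, pairTerm, map_mul]
  simp only [Fin.appendEquiv, Equiv.coe_fn_symm_mk]
  ring

/-- Conjugating the second tree reverses all its frequencies and factors `i`, which amounts to
changing the parity `e` from 1 to -1. -/
lemma sum_pairTerm {n n' : ℕ} (t : ℝ) (k₀ : Label d)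
    (K : Fin ((2 * n + 1) + (2 * n' + 1)) → Label d) :
    ∑ h : History n, ∑ h' : History n', pairTerm β L t h h' k₀ K =
      forestSum β L 1 n 1 (oneRoot k₀) (extend K) t *
        forestSum β L 1 n' (-1) (oneRoot k₀) (shift (1 + 2 * n) (extend K)) t := by
  have h1 : ∑ h : History n, leafTerm β L t h k₀ (fun i => K (Fin.castAdd _ i)) =
      forestSum β L 1 n 1 (oneRoot k₀) (extend K) t := by
    rw [forestSum_congr β L 1 (dependsOnFirst_oneRoot k₀)
      (K' := extend fun i : Fin (2 * n + 1) => K (Fin.castAdd _ i))]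
    · rfl
    · intro i hi
      rw [extend_of_lt (by omega), extend_of_lt (by omega)]
      rfl
  have h2 : conj (∑ h : History n', leafTerm β L t h k₀ (fun i => K (Fin.natAdd _ i))) =
      forestSum β L 1 n' (-1) (oneRoot k₀) (shift (1 + 2 * n) (extend K)) t := by
    rw [forestSum_congr β L (-1) (dependsOnFirst_oneRoot k₀)
      (K' := extend fun i : Fin (2 * n' + 1) => K (Fin.natAdd _ i))]
    · have := conj_forestSum β L 1 n' 1 (oneRoot k₀)
        (extend fun i : Fin (2 * n' + 1) => K (Fin.natAdd _ i)) t
      simp only [conj_oneRoot] at this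
      exact this
    · intro i hi
      rw [shift, extend_of_lt (by omega), extend_of_lt (by omega)]
      congr 1
      exact Fin.ext (by simp only [Fin.val_natAdd]; omega)
  rw [← h1, ← h2, map_sum, Finset.sum_mul_sum]
  rfl

lemma norm_J_le {n : ℕ} (hφ : ∀ N : ℕ, ∃ A : ℝ, ∀ x, ‖x‖ ^ N * φ x ≤ A) (hL : 1 ≤ L)
    (lam : ℝ) {t : ℝ} (ht : 0 ≤ t) (θ : Label d → ℝ) (h : History n) (k₀ : Label d) :
    ‖J β φ L lam t θ h k₀‖ ≤ ‖((lam ^ 2 / L ^ (2 * d) : ℝ) : ℂ) ^ n‖ *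
      ∑' k : Fin (2 * n + 1) → Label d, weight φ L k * t ^ n := by
  rw [J_eq lam ht, norm_mul]
  refine mul_le_mul_of_nonneg_left ?_ (norm_nonneg _)
  have hs := summable_ampProd_mul hφ hL θ (norm_leafTerm_le (β := β) (L := L) ht h k₀)
  refine (norm_tsum_le_tsum_norm hs).trans (hs.tsum_le_tsum (fun k => ?_)
    ((summable_weight _ hφ hL).mul_right _))
  rw [norm_mul, norm_ampProd]
  exact mul_le_mul_of_nonneg_left (norm_leafTerm_le ht _ _ _) (weight_nonneg φ L k)

/-! ### Averages of products of trees over the random phases -/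

section randomPhases

variable {Ω : Type*} [MeasurableSpace Ω] {P : Measure Ω} {ϑ : Label d → Ω → ℝ}

lemma measurable_J {n : ℕ} (hφ : ∀ N : ℕ, ∃ A : ℝ, ∀ x, ‖x‖ ^ N * φ x ≤ A) (hL : 1 ≤ L)
    (lam : ℝ) {t : ℝ} (ht : 0 ≤ t) (hm : ∀ m, Measurable (ϑ m)) (h : History n) (k₀ : Label d) :
    Measurable fun w => J β φ L lam t (fun m => ϑ m w) h k₀ := by
  simp only [J_eq lam ht]
  refine Measurable.const_mul ?_ _
  refine measurable_of_tendsto_metrizable' (Filter.atTop : Filter (Finset (Fin (2 * n + 1) → Label d)))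
    (f := fun s w => ∑ k ∈ s, ampProd φ L (fun m => ϑ m w) k * leafTerm β L t h k₀ k)
    (fun s => Finset.measurable_fun_sum _ fun k _ => (measurable_ampProd hm k).mul_const _) ?_
  rw [tendsto_pi_nhds]
  intro w
  exact (summable_ampProd_mul hφ hL _ (norm_leafTerm_le ht h k₀)).of_norm.hasSum

lemma integrable_J_mul_conj_J [IsProbabilityMeasure P] {n n' : ℕ}
    (hφ : ∀ N : ℕ, ∃ A : ℝ, ∀ x, ‖x‖ ^ N * φ x ≤ A) (hL : 1 ≤ L) (lam : ℝ) {t : ℝ} (ht : 0 ≤ t)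
    (hm : ∀ m, Measurable (ϑ m)) (h : History n) (h' : History n') (k₀ : Label d) :
    Integrable (fun w => J β φ L lam t (fun m => ϑ m w) h k₀ *
      conj (J β φ L lam t (fun m => ϑ m w) h' k₀)) P := by
  have hbound := fun w => mul_le_mul (norm_J_le (β := β) hφ hL lam ht (fun m => ϑ m w) h k₀)
    (norm_J_le (β := β) hφ hL lam ht (fun m => ϑ m w) h' k₀) (norm_nonneg _)
    (mul_nonneg (norm_nonneg _) (tsum_nonneg fun k =>
      mul_nonneg (weight_nonneg φ L k) (by positivity)))
  exact Integrable.of_bound ((measurable_J hφ hL lam ht hm h k₀).mul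
    (Complex.continuous_conj.measurable.comp
      (measurable_J hφ hL lam ht hm h' k₀))).aestronglyMeasurable _
    (Filter.Eventually.of_forall fun w =>
      (le_of_eq (by rw [norm_mul, RCLike.norm_conj])).trans (hbound w))

lemma integral_tsum_ampProd [IsProbabilityMeasure P] {n : ℕ}
    (hφ : ∀ N : ℕ, ∃ A : ℝ, ∀ x, ‖x‖ ^ N * φ x ≤ A) (hL : 1 ≤ L) (hm : ∀ m, Measurable (ϑ m))
    {T : (Fin n → Label d) → ℂ} {B : ℝ} (hT : ∀ k, ‖T k‖ ≤ B) :
    ∫ w, ∑' K, ampProd φ L (fun m => ϑ m w) K * T K ∂P =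
      ∑' K, (∫ w, ampProd φ L (fun m => ϑ m w) K ∂P) * T K := by
  rw [← integral_tsum_of_summable_integral_norm]
  · simp only [integral_mul_const]
  · exact fun K => (integrable_ampProd hm K).mul_const _
  · simp only [norm_mul, norm_ampProd, integral_const, probReal_univ, one_smul]
    exact Summable.of_nonneg_of_le (fun k => mul_nonneg (weight_nonneg φ L k) (norm_nonneg _))
      (fun k => mul_le_mul_of_nonneg_left (hT k) (weight_nonneg φ L k))
      ((summable_weight n hφ hL).mul_right B)

lemma summable_integral_ampProd_mul [IsProbabilityMeasure P] {n : ℕ}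
    (hφ : ∀ N : ℕ, ∃ A : ℝ, ∀ x, ‖x‖ ^ N * φ x ≤ A) (hL : 1 ≤ L)
    {T : (Fin n → Label d) → ℂ} {B : ℝ} (hT : ∀ k, ‖T k‖ ≤ B) :
    Summable fun K => (∫ w, ampProd φ L (fun m => ϑ m w) K ∂P) * T K := by
  refine Summable.of_norm_bounded ((summable_weight n hφ hL).mul_right B) fun K => ?_
  rw [norm_mul]
  exact mul_le_mul (norm_integral_ampProd_le K) (hT K) (norm_nonneg _) (weight_nonneg φ L K)

/-- The sum over all pairs of histories of given lengths. -/
lemma sum_integral_J_mul_conj_J [IsProbabilityMeasure P] {n n' m : ℕ}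
    (hnm : (2 * n + 1) + (2 * n' + 1) = m)
    (hφ : ∀ N : ℕ, ∃ A : ℝ, ∀ x, ‖x‖ ^ N * φ x ≤ A) (hL : 1 ≤ L) (lam : ℝ) {t : ℝ} (ht : 0 ≤ t)
    (hm : ∀ m, Measurable (ϑ m)) (k₀ : Label d) :
    ∑ h : History n, ∑ h' : History n', ∫ w, J β φ L lam t (fun m => ϑ m w) h k₀ *
        conj (J β φ L lam t (fun m => ϑ m w) h' k₀) ∂P =
      ((lam ^ 2 / L ^ (2 * d) : ℝ) : ℂ) ^ (n + n') *
      ∑' K : Fin m → Label d, (∫ w, ampProd φ L (fun m => ϑ m w) K ∂P) *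
        (forestSum β L 1 n 1 (oneRoot k₀) (extend K) t *
          forestSum β L 1 n' (-1) (oneRoot k₀) (shift (1 + 2 * n) (extend K)) t) := by
  subst hnm
  simp only [J_mul_conj_J hφ hL lam ht, integral_const_mul,
    integral_tsum_ampProd hφ hL hm (norm_pairTerm_le ht _ _ k₀), ← Finset.mul_sum, ← sum_pairTerm]
  congr 1
  simp only [Finset.mul_sum]
  have hs : ∀ (h : History n) (h' : History n'), Summable fun K =>
      (∫ w, ampProd φ L (fun m => ϑ m w) K ∂P) * pairTerm β L t h h' k₀ K := fun h h' =>
    summable_integral_ampProd_mul hφ hL (norm_pairTerm_le ht h h' k₀)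
  rw [Summable.tsum_finsetSum fun h _ => summable_sum fun h' _ => hs h h']
  exact Finset.sum_congr rfl fun h _ => (Summable.tsum_finsetSum fun h' _ => hs h h').symm

lemma oneRoot_mul_oneRoot (k₀ : Label d) :
    (fun R : ℕ → Label d => oneRoot k₀ R * oneRoot k₀ (shift 1 R)) = bothRoots k₀ := by
  funext R
  simp only [oneRoot, bothRoots, shift, add_zero]
  split_ifs <;> simp_all

/-- The sum over all pairs of histories of given total length. -/
lemma sum_antidiagonal_integral_J_mul_conj_J [IsProbabilityMeasure P] (S : ℕ)
    (hφ : ∀ N : ℕ, ∃ A : ℝ, ∀ x, ‖x‖ ^ N * φ x ≤ A) (hL : 1 ≤ L) (lam : ℝ) {t : ℝ} (ht : 0 ≤ t)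
    (hm : ∀ m, Measurable (ϑ m)) (k₀ : Label d) {m : ℕ} (hSm : 2 * S + 2 = m) :
    ∑ p ∈ Finset.HasAntidiagonal.antidiagonal S, ∑ h : History p.1, ∑ h' : History p.2,
        ∫ w, J β φ L lam t (fun m => ϑ m w) h k₀ *
        conj (J β φ L lam t (fun m => ϑ m w) h' k₀) ∂P =
      ((lam ^ 2 / L ^ (2 * d) : ℝ) : ℂ) ^ S *
      ∑' K : Fin m → Label d, (∫ w, ampProd φ L (fun m => ϑ m w) K ∂P) *
        forestSum β L 2 S 1 (bothRoots k₀) (extend K) t := by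
  have hs : ∀ p : ℕ × ℕ, Summable fun K : Fin m → Label d =>
      (∫ w, ampProd φ L (fun m => ϑ m w) K ∂P) *
      (forestSum β L 1 p.1 1 (oneRoot k₀) (extend K) t *
          forestSum β L 1 p.2 (-1) (oneRoot k₀) (shift (1 + 2 * p.1) (extend K)) t) := fun p =>
    summable_integral_ampProd_mul hφ hL fun K => by
      rw [norm_mul]
      exact mul_le_mul (norm_forestSum_le β L 1 p.1 abs_one (norm_oneRoot_le k₀) _ ht)
        (norm_forestSum_le β L 1 p.2 (by simp) (norm_oneRoot_le k₀) _ ht) (norm_nonneg _)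
        (by positivity)
  -- Placed after one root, the second tree has parity `(-1)^1 = -1` in the juxtaposition, the same
  -- sign that the conjugation produced. Hence the product of the two trees is exactly a two-root
  -- forest sum.
  have hshuffle : ∀ K : Fin m → Label d, ∑ p ∈ Finset.HasAntidiagonal.antidiagonal S,
      forestSum β L 1 p.1 1 (oneRoot k₀) (extend K) t *
          forestSum β L 1 p.2 (-1) (oneRoot k₀) (shift (1 + 2 * p.1) (extend K)) t =
      forestSum β L 2 S 1 (bothRoots k₀) (extend K) t := fun K => by
    have := sum_forestSum_mul_forestSum β L S 1 1 1 (oneRoot k₀) (oneRoot k₀)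
      (dependsOnFirst_oneRoot k₀) (extend K) t
    rw [oneRoot_mul_oneRoot] at this
    rw [← this, pow_one, one_mul]
  simp only [← hshuffle, Finset.mul_sum]
  rw [Summable.tsum_finsetSum fun p _ => hs p, Finset.mul_sum]
  refine Finset.sum_congr rfl fun p hp => ?_
  rw [Finset.HasAntidiagonal.mem_antidiagonal] at hp
  rw [sum_integral_J_mul_conj_J (m := m) (by omega) hφ hL lam ht hm k₀, hp]

/-- The weight `A` abstracts the averaged product of amplitudes. What matters is its decay, its
support on even-covered assignments, which limits the number of free vectors, and its invariance
under even rotations, which removes the degenerate part. -/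
lemma norm_tsum_forestSum_le (hd : 3 ≤ d) (hβ : Generic β)
    (hφ : ∀ N : ℕ, ∃ A : ℝ, ∀ x, ‖x‖ ^ N * φ x ≤ A) (N : ℕ) :
    ∃ C : ℝ, 0 < C ∧ ∀ L : ℝ, 1 ≤ L → ∀ t : ℝ, 0 < t → t ≤ L ^ d → ∀ k₀ : Label d,
      ∀ A : (Fin (2 * N + 4) → Label d) → ℂ, (∀ K, ‖A K‖ ≤ weight φ L K) →
      (∀ K, A K ≠ 0 → EvenCovered K) →
      (∀ c : Fin (2 * N + 4), Even (c : ℕ) → ∀ K, A (fun j => K (j + c)) = A K) →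
      ‖∑' K : Fin (2 * N + 4) → Label d, A K * forestSum β L 2 (N + 1) 1 (bothRoots k₀) (extend K) t‖
        ≤ C * t ^ N * L ^ (d * (N + 1)) * Real.log (2 + t) ^ 2 := by
  obtain ⟨C, hC, hle⟩ := tsum_nondegSum_le hd hβ hφ N
  refine ⟨C, hC, fun L hL t ht htL k₀ A hA hcov hrot => ?_⟩
  have hfin := hle L hL t ht htL k₀ A hA hcov
  have hn : Summable fun K : Fin (2 * N + 4) → Label d => ‖A K * nondegSum β L N k₀ (extend K) t‖ := by
    have h2 := ENNReal.summable_toReal (hfin.trans_lt ENNReal.ofReal_lt_top).ne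
    exact h2.congr fun K => ENNReal.toReal_ofReal (norm_nonneg _)
  have hAs : Summable A := Summable.of_norm_bounded (summable_weight _ hφ hL) hA
  have hdeg := tsum_degenerate_eq_zero β L N k₀ ht.le A hAs hrot
  have hall : Summable fun K : Fin (2 * N + 4) → Label d =>
      A K * forestSum β L 2 (N + 1) 1 (bothRoots k₀) (extend K) t := by
    refine Summable.of_norm_bounded (hAs.norm.mul_right
      (Fintype.card (Forest 2 (N + 1)) * t ^ (N + 1))) fun K => ?_
    rw [norm_mul]
    exact mul_le_mul_of_nonneg_left
      (norm_forestSum_le β L 2 (N + 1) abs_one (norm_bothRoots_le k₀) _ ht.le) (norm_nonneg _)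
  -- The cancellation has to be used before absolute values are taken; only the nondegenerate part
  -- is then bounded term by term.
  have hsub : ∑' K : Fin (2 * N + 4) → Label d,
      A K * forestSum β L 2 (N + 1) 1 (bothRoots k₀) (extend K) t =
      ∑' K : Fin (2 * N + 4) → Label d, A K * nondegSum β L N k₀ (extend K) t := by
    rw [← sub_eq_zero, ← hall.tsum_sub hn.of_norm]
    have : ∀ K : Fin (2 * N + 4) → Label d,
        A K * forestSum β L 2 (N + 1) 1 (bothRoots k₀) (extend K) t -
          A K * nondegSum β L N k₀ (extend K) t = Complex.I * (A K *
      (integratedForestSum β L N (fun R => equalRoots R * bothRoots k₀ (shift 2 R)) (extend K) t -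
       integratedForestSum β L N (fun R => bothRoots k₀ R * equalRoots (shift 2 R)) (extend K) t)) :=
      fun K => by
        rw [forestSum_bothRoots]
        ring
    simp only [this]
    rw [tsum_mul_left, hdeg, mul_zero]
  rw [hsub]
  refine (norm_tsum_le_tsum_norm hn).trans ?_
  have h0 : 0 ≤ C * t ^ N * L ^ (d * (N + 1)) * Real.log (2 + t) ^ 2 := by positivity
  rw [← ENNReal.ofReal_le_ofReal_iff h0, ENNReal.ofReal_tsum_of_nonneg (fun _ => norm_nonneg _) hn]
  exact hfin

lemma sqrt_kineticTime {L lam : ℝ} (hL : 0 < L) (hlam : 0 < lam) :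
    √(kineticTime d L lam) = L ^ d / (√2 * lam ^ 2) := by
  have h2 : kineticTime d L lam = (L ^ d / (√2 * lam ^ 2)) ^ 2 := by
    rw [kineticTime, div_pow, mul_pow, Real.sq_sqrt zero_le_two, ← pow_mul, ← pow_mul, mul_comm d 2]
  rw [h2, Real.sqrt_sq (by positivity)]

/-- The left side equals `(t λ² / L^d)^(N+1) / t`, while `√τ = L^d / (√2 λ²)`; the inequality only
gives away powers of `√2`. -/
lemma prefactor_le {L lam t : ℝ} (hL : 0 < L) (hlam : 0 < lam) (ht : 0 < t) (N : ℕ) :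
    (lam ^ 2 / L ^ (2 * d)) ^ (N + 1) * (t ^ N * L ^ (d * (N + 1))) ≤
      (t / √(kineticTime d L lam)) ^ (N + 1) * (1 / t) := by
  have h1 : (lam ^ 2 / L ^ (2 * d)) ^ (N + 1) * (t ^ N * L ^ (d * (N + 1))) =
      (t * lam ^ 2 / L ^ d) ^ (N + 1) * (1 / t) := by
    have h3 : t * lam ^ 2 / L ^ d = lam ^ 2 / L ^ (2 * d) * (t * L ^ d) := by
      rw [mul_comm 2 d, pow_mul L d 2]
      field_simp
    rw [h3, mul_pow _ (t * L ^ d), mul_pow t, ← pow_mul, pow_succ t]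
    field_simp
  have h2 : 1 ≤ √2 := by
    rw [Real.one_le_sqrt]
    exact one_le_two
  have h4 : t * lam ^ 2 / L ^ d ≤ t / (L ^ d / (√2 * lam ^ 2)) := by
    rw [div_div_eq_mul_div]
    gcongr
    exact le_mul_of_one_le_left (by positivity) h2
  rw [h1, sqrt_kineticTime hL hlam]
  gcongr

end randomPhases

end trees

end FeynmanTree

/-! ### The variance bound for generic parameters -/

theorem proposition4p1 (d : ℕ) (hd : 3 ≤ d) :
    ∀ᵐ β : Fin d → ℝ ∂(volume.restrict (Set.pi Set.univ fun _ => Set.Icc (1 : ℝ) 2)),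
      ∀ φ : EuclideanSpace ℝ (Fin d) → ℝ,
        ContDiff ℝ ∞ φ → (∀ x, 0 ≤ φ x) → (∀ N : ℕ, ∃ A : ℝ, ∀ x, ‖x‖ ^ N * φ x ≤ A) →
      ∀ ε₀ : ℝ, 0 < ε₀ → ∀ S : ℕ, 1 ≤ S →
      ∃ C : ℝ, ∀ (Ω : Type*) [MeasurableSpace Ω] (P : Measure Ω) [IsProbabilityMeasure P]
        (ϑ : FeynmanTree.Label d → Ω → ℝ),
        (∀ m, Measurable (ϑ m)) → iIndepFun ϑ P →
        (∀ m, pdf.IsUniform (ϑ m) (Set.Icc 0 (2 * Real.pi)) P volume) →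
      ∀ L : ℝ, 1 ≤ L → ∀ lam : ℝ, 0 < lam → ∀ t : ℝ, 0 < t → t < L ^ ((d : ℝ) - ε₀) →
      ∀ k : FeynmanTree.Label d,
        (∀ (n : ℕ) (l : FeynmanTree.History n) (w : Ω),
          Summable (FeynmanTree.summand β φ L t (fun m => ϑ m w) l k)) ∧
        (∀ (n n' : ℕ) (l : FeynmanTree.History n) (l' : FeynmanTree.History n'),
          Integrable (fun w => FeynmanTree.J β φ L lam t (fun m => ϑ m w) l k *
            conj (FeynmanTree.J β φ L lam t (fun m => ϑ m w) l' k)) P) ∧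
        ‖∑ p ∈ Finset.HasAntidiagonal.antidiagonal S,
            ∑ l : FeynmanTree.History p.1, ∑ l' : FeynmanTree.History p.2,
              ∫ w, FeynmanTree.J β φ L lam t (fun m => ϑ m w) l k *
                conj (FeynmanTree.J β φ L lam t (fun m => ϑ m w) l' k) ∂P‖
          ≤ C * Real.log (2 + t) ^ 2 * (t / √(FeynmanTree.kineticTime d L lam)) ^ S * (1 / t) := by
  have h0 := FeynmanTree.ae_generic hd
  rw [← FeynmanTree.cubeMeasure_eq] at h0
  filter_upwards [h0] with β hβ
  intro φ _ _ hφ ε₀ hε₀ S hS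
  -- With `S ≥ 1` there is a last interaction to exploit; the other `N` interactions are estimated
  -- trivially in time.
  obtain ⟨N, rfl⟩ : ∃ N, S = N + 1 := ⟨S - 1, by omega⟩
  obtain ⟨C, hC, hle⟩ := FeynmanTree.norm_tsum_forestSum_le hd hβ hφ N
  refine ⟨C, ?_⟩
  intro Ω _ P _ ϑ hm hind hunif L hL lam hlam t ht htL k
  have hL0 : 0 < L := by linarith
  -- The restriction on the time enters as `t ≤ L^d`: the width `1/t` of the resolvent does not fall
  -- below the scale `L^(-d)` resolved by generic parameters.
  have htL' : t ≤ L ^ d := by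
    refine htL.le.trans ?_
    rw [← Real.rpow_natCast L d]
    exact Real.rpow_le_rpow_of_exponent_le hL (by linarith)
  refine ⟨fun n l w => FeynmanTree.summable_summand hφ hL ht.le _ l k, fun n n' l l' =>
    FeynmanTree.integrable_J_mul_conj_J hφ hL lam ht.le hm l l' k, ?_⟩
  rw [FeynmanTree.sum_antidiagonal_integral_J_mul_conj_J (N + 1) hφ hL lam ht.le hm k
    (show 2 * (N + 1) + 2 = 2 * N + 4 by ring), norm_mul, norm_pow, Complex.norm_real,
    Real.norm_of_nonneg (by positivity)]
  -- The weight is the expectation of the product of the amplitudes; its support comes from the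
  -- uniform independent phases, and its rotation invariance holds already before averaging.
  have hmain := hle L hL t ht htL' k
    (fun K => ∫ w, FeynmanTree.ampProd φ L (fun m => ϑ m w) K ∂P)
    (fun K => FeynmanTree.norm_integral_ampProd_le K)
    (fun K hK => by
      by_contra hcov
      exact hK (FeynmanTree.integral_ampProd_eq_zero hm hind hunif hcov))
    (fun c hc K => by simp only [FeynmanTree.ampProd_rotate φ L _ c hc K])
  have hpre := FeynmanTree.prefactor_le (d := d) hL0 hlam ht N
  calc _ ≤ (lam ^ 2 / L ^ (2 * d)) ^ (N + 1) *
        (C * t ^ N * L ^ (d * (N + 1)) * Real.log (2 + t) ^ 2) :=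
        mul_le_mul_of_nonneg_left hmain (by positivity)
    _ = C * Real.log (2 + t) ^ 2 *
        ((lam ^ 2 / L ^ (2 * d)) ^ (N + 1) * (t ^ N * L ^ (d * (N + 1)))) := by ring
    _ ≤ C * Real.log (2 + t) ^ 2 *
        ((t / √(FeynmanTree.kineticTime d L lam)) ^ (N + 1) * (1 / t)) :=
        mul_le_mul_of_nonneg_left hpre (by positivity)
    _ = _ := by ring
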